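/- Let $d\ge 1$ and let $\Omega\subset\mathbb R^d$ be a bounded open set with Lipschitz boundary, $n$ its outer unit normal and $ds$ the surface measure on $\partial\Omega$. Let $\widetilde{\mathcal T}$ be a finite mesh whose elements are all nondegenerate closed simplices, or all nondegenerate closed axis-parallel boxes, with pairwise disjoint interiors and whose union contains $\Omega$. Let $\mathcal T=\{T\in\widetilde{\mathcal T}: T\cap\Omega\ne\emptyset\}$, $\widetilde\Omega=\bigcup_{T\in\mathcal T}T$, let $k\ge 1$ and $$V_h=\{v\in C(\widetilde\Omega): v|_T\in P_k(T)\ \text{for all } T\in\mathcal T\},$$ where $P_k$ denotes the polynomials of total degree at most $k$ (on a mesh of boxes, alternatively, the polynomials of degree at most $k$ in each variable, the same choice for all elements). For $T\in\mathcal T$ let $V_h|_T^0$ be the space of functions in $V_h|_T$ that are $L^2(T)$-orthogonal to constants, and let $$\lambda_T=2\max\mu_T,$$ where $\mu_T$ runs over the eigenvalues of the local problem: find $0\ne w\in V_h|_T^0$ and $\mu_T\in\mathbb R$ with $$\int_{\partial\Omega\cap T}\partial_n w\,\partial_n v\,ds=\mu_T\int_{\Omega\cap T}\nabla w\cdot\nabla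 v\,dx\qquad\text{for all } v\in V_h|_T^0 .$$ In integrals over $\partial\Omega$, the element $T$ at a boundary point $x$ (in $\lambda_T$ and in $\partial_n v|_T$ for $v\in V_h$) is an element of $\mathcal T$ containing $x$; at points lying in several such elements the choice is arbitrary, but fixed and measurable. For $w,v\in V_h$ put $$a_h(w,v)=\int_\Omega\nabla w\cdot\nabla v\,dx-\int_{\partial\Omega}\partial_n w\,v\,ds-\int_{\partial\Omega}\partial_n v\,w\,ds+\int_{\partial\Omega}\lambda_T\,w\,v\,ds,$$ $$l_h(v)=\int_\Omega f v\,dx+\int_{\partial\Omega}(-\partial_n v+\lambda_T v)\,g\,ds .$$ Let $u\in H^2(\Omega)$ satisfy $-\Delta u=f$ in $\Omega$ and $u=g$ on $\partial\Omega$ (in the sense of traces), and let $u_h\in V_h$ satisfy $a_h(u_h,v_h)=l_h(v_h)$ for all $v_h\in V_h$. For $v\in V_h+H^2(\Omega)$ let $$|||v|||^2=\|\nabla v\|_{L^2(\Omega)}^2+\|\lambda_T^{-1/2}\partial_n v\|_{L^2(\partial\Omega)}^2+\|\lambda_T^{1/2}v\|_{L^2(\partial\Omega)}^2,$$ with $v$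 and $\nabla v$ on $\partial\Omega$ understood as traces for the $H^2$ part and elementwise for the discrete part. Then $|||u-v_h|||<\infty$ for all $v_h\in V_h$, and $$|||u-u_h|||\le 11\inf_{v_h\in V_h}|||u-v_h||| .$$ -/

import Mathlib

open MeasureTheory Filter Topology
open scoped ENNReal NNReal ContDiff

namespace Nitsche

/-- The Euclidean space `ℝ^d`. -/
abbrev E (d : ℕ) := EuclideanSpace ℝ (Fin d)

variable {d : ℕ}

/-! ### Lipschitz domains, surface measure and outer normal -/

/-- `Ω` is a bounded open set with Lipschitz boundary: near each boundary point, `Ω` is the set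
of points strictly below the graph (over the hyperplane orthogonal to some unit vector `e`, in
direction `e`) of a Lipschitz function. -/
def IsLipschitzDomain (Ω : Set (E d)) : Prop :=
  IsOpen Ω ∧ Bornology.IsBounded Ω ∧
    ∀ x ∈ frontier Ω, ∃ (e : E d) (φ : E d → ℝ) (K : ℝ≥0) (r : ℝ),
      ‖e‖ = 1 ∧ LipschitzWith K φ ∧ 0 < r ∧
        ∀ y ∈ Metric.ball x r, y ∈ Ω ↔ inner ℝ e y < φ (y - inner ℝ e y • e)

/-- The surface measure on the boundary: the `(d-1)`-dimensional Hausdorff measure (normalised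
to agree with Lebesgue measure on hyperplanes), restricted to `∂Ω`. -/
noncomputable def surf (Ω : Set (E d)) : Measure (E d) :=
  (μHE[d - 1] : Measure (E d)).restrict (frontier Ω)

/-- `n` is the outer unit normal of `Ω` at `x`: to first order at `x`, the set `Ω` is the
half-space `{y | ⟪y - x, n⟫ < 0}`. -/
def IsOuterNormal (Ω : Set (E d)) (x n : E d) : Prop :=
  ‖n‖ = 1 ∧ ∀ ε : ℝ, 0 < ε → ∀ᶠ y in 𝓝 x,
    (inner ℝ (y - x) n < -(ε * ‖y - x‖) → y ∈ Ω) ∧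
    (ε * ‖y - x‖ < inner ℝ (y - x) n → y ∉ Ω)

open Classical in
/-- The outer unit normal field (`0` at points without a normal, a null set of the boundary of
a Lipschitz domain). -/
noncomputable def outerNormal (Ω : Set (E d)) (x : E d) : E d :=
  if h : ∃ n, IsOuterNormal Ω x n then h.choose else 0

/-! ### Sobolev spaces and traces -/

/-- `G` is the weak gradient of `v` on `Ω`. -/
def HasWeakGradient (Ω : Set (E d)) (v : E d → ℝ) (G : E d → E d) : Prop :=
  LocallyIntegrableOn v Ω ∧ LocallyIntegrableOn G Ω ∧
    ∀ φ : E d → ℝ, ContDiff ℝ ∞ φ → HasCompactSupport φ → tsupport φ ⊆ Ω →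
      ∫ x in Ω, v x • gradient φ x = -∫ x in Ω, φ x • G x

open Classical in
/-- The weak gradient (junk value `0` if there is none). -/
noncomputable def weakGrad (Ω : Set (E d)) (v : E d → ℝ) : E d → E d :=
  if h : ∃ G, HasWeakGradient Ω v G then h.choose else 0

/-- The weak partial derivative in the `i`-th coordinate direction. -/
noncomputable def weakPartial (Ω : Set (E d)) (i : Fin d) (v : E d → ℝ) : E d → ℝ :=
  fun x => weakGrad Ω v x i

/-- `v ∈ H¹(Ω)`. -/
def MemH1 (Ω : Set (E d)) (v : E d → ℝ) : Prop :=
  MemLp v 2 (volume.restrict Ω) ∧ (∃ G, HasWeakGradient Ω v G) ∧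
    MemLp (weakGrad Ω v) 2 (volume.restrict Ω)

/-- `v ∈ H²(Ω)`. -/
def MemH2 (Ω : Set (E d)) (v : E d → ℝ) : Prop :=
  MemH1 Ω v ∧ ∀ i, MemH1 Ω (weakPartial Ω i v)

/-- The (weak) Laplacian. -/
noncomputable def laplacian (Ω : Set (E d)) (v : E d → ℝ) (x : E d) : ℝ :=
  ∑ i, weakPartial Ω i (weakPartial Ω i v) x

/-- `γ ∈ L²(∂Ω)` is the trace of `v ∈ H¹(Ω)`: there are functions in `C¹(ℝ^d)` that converge to
`v` in `H¹(Ω)` and whose restrictions to `∂Ω` converge to `γ` in `L²(∂Ω)`. -/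
def HasTrace (Ω : Set (E d)) (v γ : E d → ℝ) : Prop :=
  MemLp γ 2 (surf Ω) ∧ ∃ φ : ℕ → E d → ℝ, (∀ n, ContDiff ℝ 1 (φ n)) ∧
    Tendsto (fun n => eLpNorm (fun x => φ n x - v x) 2 (volume.restrict Ω)) atTop (𝓝 0) ∧
    Tendsto (fun n => eLpNorm (fun x => gradient (φ n) x - weakGrad Ω v x) 2
      (volume.restrict Ω)) atTop (𝓝 0) ∧
    Tendsto (fun n => eLpNorm (fun x => φ n x - γ x) 2 (surf Ω)) atTop (𝓝 0)

open Classical in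
/-- The trace operator `H¹(Ω) → L²(∂Ω)` (junk value `0` if there is no trace). -/
noncomputable def trace (Ω : Set (E d)) (v : E d → ℝ) : E d → ℝ :=
  if h : ∃ γ, HasTrace Ω v γ then h.choose else 0

/-- The normal derivative `∂ₙ v` on `∂Ω` of `v ∈ H²(Ω)`: the trace of the gradient, tested with
the outer normal. -/
noncomputable def normalDeriv (Ω : Set (E d)) (v : E d → ℝ) (x : E d) : ℝ :=
  ∑ i, trace Ω (weakPartial Ω i v) x * outerNormal Ω x i

/-- `u ∈ H²(Ω)` solves `-Δu = f` in `Ω`, `u = g` on `∂Ω`. -/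
def SolvesPoisson (Ω : Set (E d)) (f g u : E d → ℝ) : Prop :=
  MemH2 Ω u ∧ (∀ᵐ x ∂volume.restrict Ω, -laplacian Ω u x = f x) ∧
    (∀ᵐ x ∂surf Ω, trace Ω u x = g x)

/-! ### Mesh and finite element space -/

/-- A nondegenerate closed `d`-simplex. -/
def IsSimplex (T : Set (E d)) : Prop :=
  ∃ p : Fin (d + 1) → E d, AffineIndependent ℝ p ∧ T = convexHull ℝ (Set.range p)

/-- A nondegenerate closed axis-parallel box. -/
def IsBox (T : Set (E d)) : Prop :=
  ∃ a b : Fin d → ℝ, (∀ i, a i < b i) ∧ T = {x | ∀ i, a i ≤ x i ∧ x i ≤ b i}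

/-- A (simplicial or rectilinear) background mesh that encapsulates `Ω`. -/
def IsBackgroundMesh (bg : Finset (Set (E d))) (Ω : Set (E d)) : Prop :=
  ((∀ T ∈ bg, IsSimplex T) ∨ (∀ T ∈ bg, IsBox T)) ∧
    (∀ T ∈ bg, ∀ T' ∈ bg, T ≠ T' → Disjoint (interior T) (interior T')) ∧
    Ω ⊆ ⋃ T ∈ bg, T

/-- The active mesh: the elements that intersect `Ω`. -/
def activeMesh (bg : Finset (Set (E d))) (Ω : Set (E d)) : Set (Set (E d)) :=
  {T | T ∈ bg ∧ (T ∩ Ω).Nonempty}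

/-- The local polynomials of order `k`: total degree at most `k`; on a rectilinear mesh the
tensor-product polynomials of degree at most `k` in each variable are admitted as well. -/
def IsLocalPolySpace (bg : Finset (Set (E d))) (k : ℕ)
    (P : Submodule ℝ (MvPolynomial (Fin d) ℝ)) : Prop :=
  P = MvPolynomial.restrictTotalDegree (Fin d) ℝ k ∨
    ((∀ T ∈ bg, IsBox T) ∧ P = MvPolynomial.restrictDegree (Fin d) ℝ k)

/-- The space `V_h` of continuous functions on the union of the active elements that are
polynomial on each of them. Values outside this union are irrelevant. -/
def feSpace (bg : Finset (Set (E d))) (Ω : Set (E d))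
    (P : Submodule ℝ (MvPolynomial (Fin d) ℝ)) : Set (E d → ℝ) :=
  {v | ContinuousOn v (⋃ T ∈ activeMesh bg Ω, T) ∧
    ∀ T ∈ activeMesh bg Ω, ∃ p ∈ P, ∀ x ∈ T, v x = MvPolynomial.eval (fun i => x i) p}

/-- `el` assigns (measurably) to each boundary point an active element that contains it. The
choice is forced except at points that lie in several active elements. -/
def IsElementAssignment (bg : Finset (Set (E d))) (Ω : Set (E d))
    (el : E d → Set (E d)) : Prop :=
  (∀ x ∈ frontier Ω, el x ∈ activeMesh bg Ω ∧ x ∈ el x) ∧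
    ∀ T ∈ activeMesh bg Ω, MeasurableSet {x | x ∈ frontier Ω ∧ el x = T}

/-- The normal derivative at `x ∈ ∂Ω ∩ T` of the polynomial `v|_T`. -/
noncomputable def elemNormalDeriv (Ω T : Set (E d)) (v : E d → ℝ) (x : E d) : ℝ :=
  inner ℝ (gradientWithin v T x) (outerNormal Ω x)

/-! ### Stabilization parameter -/

/-- The space `V_h|_T^0` of functions in `V_h|_T` that are `L²(T)`-orthogonal to constants
(represented by functions of `V_h`, of which only the values on `T` are used). -/
def localSpace (V : Set (E d → ℝ)) (T : Set (E d)) : Set (E d → ℝ) :=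
  {v | v ∈ V ∧ ∫ x in T, v x = 0}

/-- `μ` is an eigenvalue of the local eigenvalue problem on `T`. -/
def IsLocalEigenvalue (Ω : Set (E d)) (V : Set (E d → ℝ)) (T : Set (E d)) (μ : ℝ) : Prop :=
  ∃ w ∈ localSpace V T, (∃ x ∈ T, w x ≠ 0) ∧ ∀ v ∈ localSpace V T,
    ∫ x in T, elemNormalDeriv Ω T w x * elemNormalDeriv Ω T v x ∂surf Ω =
      μ * ∫ x in Ω ∩ T, inner ℝ (gradientWithin w T x) (gradientWithin v T x)

/-- `λ_T`: twice the largest eigenvalue of the local eigenvalue problem. -/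
noncomputable def stabParam (Ω : Set (E d)) (V : Set (E d → ℝ)) (T : Set (E d)) : ℝ :=
  2 * sSup {μ | IsLocalEigenvalue Ω V T μ}

/-! ### Nitsche's method and the energy norm -/

section Method

variable (Ω : Set (E d)) (V : Set (E d → ℝ)) (el : E d → Set (E d))

/-- The bilinear form `a_h` on `V_h`. -/
noncomputable def aForm (w v : E d → ℝ) : ℝ :=
  (∫ x in Ω, inner ℝ (gradient w x) (gradient v x))
    + (∫ x, -elemNormalDeriv Ω (el x) w x * v x ∂surf Ω)
    + (∫ x, -elemNormalDeriv Ω (el x) v x * w x ∂surf Ω)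
    + ∫ x, stabParam Ω V (el x) * w x * v x ∂surf Ω

/-- The linear form `l_h` on `V_h`. -/
noncomputable def lForm (f g v : E d → ℝ) : ℝ :=
  (∫ x in Ω, f x * v x)
    + ∫ x, (-elemNormalDeriv Ω (el x) v x + stabParam Ω V (el x) * v x) * g x ∂surf Ω

/-- `u_h ∈ V_h` solves the discrete problem. -/
def SolvesNitsche (f g uh : E d → ℝ) : Prop :=
  uh ∈ V ∧ ∀ vh ∈ V, aForm Ω V el uh vh = lForm Ω V el f g vh

/-- The energy norm of a function with gradient `G` in `Ω`, normal derivative `q` on `∂Ω` and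
boundary values `b` on `∂Ω`. -/
noncomputable def energyNorm (G : E d → E d) (q b : E d → ℝ) : ℝ≥0∞ :=
  ((∫⁻ x in Ω, ENNReal.ofReal (‖G x‖ ^ 2))
    + (∫⁻ x, ENNReal.ofReal ((stabParam Ω V (el x))⁻¹ * q x ^ 2) ∂surf Ω)
    + ∫⁻ x, ENNReal.ofReal (stabParam Ω V (el x) * b x ^ 2) ∂surf Ω) ^ (1 / 2 : ℝ)

/-- The energy norm of `u - v`, for `u ∈ H²(Ω)` and `v ∈ V_h`. -/
noncomputable def errorNorm (u v : E d → ℝ) : ℝ≥0∞ :=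
  energyNorm Ω V el (fun x => weakGrad Ω u x - gradient v x)
    (fun x => normalDeriv Ω u x - elemNormalDeriv Ω (el x) v x)
    (fun x => trace Ω u x - v x)

end Method

end Nitsche

namespace Nitsche

variable {d : ℕ}

/-! ### Area formula for expanding injective maps, with Hausdorff measure on the image. -/

section AreaFormula

set_option linter.unusedSectionVars false

open Module

/-! Quasi-optimality is Nitsche's argument, run on triples in L²: the gradient in Ω, the normal
derivative scaled by λ^(-1/2), the boundary values scaled by λ^(1/2). Since λ_T is twice the largest
Rayleigh quotient of the boundary form against the Dirichlet form on T, summing over elements gives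
2‖λ^(-1/2) ∂ₙv‖² ≤ ‖∇v‖² for v ∈ V_h (`integral_inv_stabParam_mul_sq_le`). Hence a_h(v,v) ≥
|||v|||²/5 on V_h (`form_coercive`), while the form on triples is bounded with constant 2
(`form_continuous`). Galerkin orthogonality of u - u_h then yields |||u_h - v_h||| ≤ 10 |||u -
v_h|||, and the triangle inequality makes this 11 (`tripleNorm_sub_le_of_orthogonal`).

Orthogonality is consistency, that is, Green's identity for u ∈ H² and a test function in V_h
(`MemH2.green_feSpace`). Most of the work goes into this identity on a Lipschitz domain. An area
formula identifies Hausdorff measure on a Lipschitz graph with √(1+|∇ψ|²) dy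
(`measure_image_graphMap`), and Rademacher's theorem provides normals almost everywhere. Flattening
the graph by a measure-preserving shear gives the divergence theorem in a chart, and a partition of
unity makes it global (`IsLipschitzDomain.divergence`). Mollifiers shifted so as to reach only into
Ω give density of C¹ functions in H¹ (`IsLipschitzDomain.exists_approx`), a trace inequality gives
traces (`hasTrace_of_memH1`), and integration by parts passes to the limit. Elements of V_h enter as
Lipschitz test functions, because on the closure of Ω they are restrictions of Lipschitz functions
(`exists_lipschitz_extension`).

The local eigenvalue problem lives on a finite-dimensional space of mean-zero polynomials, on which
the Dirichlet form over Ω ∩ T is positive definite because Ω ∩ T has interior points. So a largest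
eigenvalue exists (`exists_greatest_localEigenvalue`), and it is positive as soon as ∂Ω ∩ T has
positive measure (`stabParam_pos`). The weights in the norm are therefore meaningful almost
everywhere on ∂Ω. -/

theorem euclideanHausdorffMeasure_image_le_of_edist_le {α X Y : Type*}
    [EMetricSpace X] [MeasurableSpace X] [BorelSpace X]
    [EMetricSpace Y] [MeasurableSpace Y] [BorelSpace Y] [Nonempty α]
    {g : α → Y} {h : α → X} {S : Set α} {c : ℝ≥0}
    (H : ∀ x ∈ S, ∀ y ∈ S, edist (g x) (g y) ≤ c * edist (h x) (h y)) (n : ℕ) :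
    (μHE[n] : Measure Y) (g '' S) ≤ (c : ℝ≥0∞) ^ n * (μHE[n] : Measure X) (h '' S) := by
  classical
  -- The hypothesis makes g a c-Lipschitz function of h on S. The normalising factor of the
  -- Hausdorff measures depends only on n, so it is the same on both sides.
  set k : X → Y := g ∘ Function.invFunOn h S with hk
  have hinv : ∀ p ∈ h '' S, Function.invFunOn h S p ∈ S ∧ h (Function.invFunOn h S p) = p := by
    rintro p ⟨x, hx, rfl⟩
    exact ⟨Function.invFunOn_mem ⟨x, hx, rfl⟩, Function.invFunOn_eq ⟨x, hx, rfl⟩⟩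
  have hlip : LipschitzOnWith c k (h '' S) := by
    intro p hp q hq
    have := H _ (hinv p hp).1 _ (hinv q hq).1
    rwa [(hinv p hp).2, (hinv q hq).2] at this
  have hsub : g '' S ⊆ k '' (h '' S) := by
    rintro _ ⟨x, hx, rfl⟩
    refine ⟨h x, ⟨x, hx, rfl⟩, ?_⟩
    have h1 := hinv (h x) ⟨x, hx, rfl⟩
    have := H _ h1.1 _ hx
    rw [h1.2, edist_self, mul_zero, nonpos_iff_eq_zero, edist_eq_zero] at this
    exact this
  have key := hlip.hausdorffMeasure_image_le (d := n) (by positivity)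
  rw [Measure.euclideanHausdorffMeasure_def, Measure.euclideanHausdorffMeasure_def,
    Measure.smul_apply, Measure.smul_apply, ENNReal.smul_def, ENNReal.smul_def, smul_eq_mul,
    smul_eq_mul, mul_left_comm]
  rw [ENNReal.rpow_natCast] at key
  gcongr
  exact (measure_mono hsub).trans key

variable {U V : Type*} [NormedAddCommGroup U] [InnerProductSpace ℝ U] [FiniteDimensional ℝ U]
  [MeasurableSpace U] [BorelSpace U] [NormedAddCommGroup V] [InnerProductSpace ℝ V]
  [FiniteDimensional ℝ V] [MeasurableSpace V] [BorelSpace V]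

theorem edist_le_mul_of_norm_le {α X Y : Type*} [NormedAddCommGroup X] [NormedAddCommGroup Y]
    {g : α → Y} {h : α → X} {x y : α} {c : ℝ≥0}
    (H : ‖g x - g y‖ ≤ c * ‖h x - h y‖) : edist (g x) (g y) ≤ c * edist (h x) (h y) := by
  rw [edist_eq_enorm_sub, edist_eq_enorm_sub, ← ofReal_norm, ← ofReal_norm,
    ← ENNReal.ofReal_coe_nnreal, ← ENNReal.ofReal_mul (by positivity)]
  exact ENNReal.ofReal_le_ofReal H

/-- Both determinants are ratios of the Hausdorff measure of the image of the unit ball to the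
volume of the ball, so comparing the two images suffices. -/
theorem normDet_le_of_norm_le {A B : U →L[ℝ] V} {c : ℝ≥0} (h : ∀ v, ‖A v‖ ≤ c * ‖B v‖) :
    ENNReal.ofReal (LinearMap.normDet (A : U →ₗ[ℝ] V)) ≤
      (c : ℝ≥0∞) ^ finrank ℝ U * ENNReal.ofReal (LinearMap.normDet (B : U →ₗ[ℝ] V)) := by
  have key := euclideanHausdorffMeasure_image_le_of_edist_le (g := A) (h := B)
    (S := Metric.ball (0 : U) 1) (c := c) (fun x _ y _ ↦ edist_le_mul_of_norm_le (by
      simpa using h (x - y))) (finrank ℝ U)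
  have h1 := LinearMap.euclideanHausdorffMeasure_image_eq_normDet_mul_volume
    (A : U →ₗ[ℝ] V) (Metric.ball (0 : U) 1)
  have h2 := LinearMap.euclideanHausdorffMeasure_image_eq_normDet_mul_volume
    (B : U →ₗ[ℝ] V) (Metric.ball (0 : U) 1)
  simp only [ContinuousLinearMap.coe_coe] at h1 h2
  rw [h1, h2, ← mul_assoc] at key
  exact (ENNReal.mul_le_mul_iff_left (Metric.measure_ball_pos volume _ one_pos).ne'
    measure_ball_lt_top.ne).1 key

/-- Almost isometric perturbations of an expanding linear map. -/
theorem norm_le_mul_of_norm_sub_le {a b : V} {t : ℝ} {c : ℝ} (hc : 1 < c)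
    (hab : ‖a - b‖ ≤ (c - 1) / (2 * c) * 2 * t) (hb : t ≤ ‖b‖) :
    ‖a‖ ≤ c * ‖b‖ ∧ ‖b‖ ≤ c * ‖a‖ := by
  have hc0 : 0 < c := by linarith
  -- A relative error of 1 - 1/c is what leaves ‖a‖ ≥ ‖b‖ / c. The unreduced form is twice the
  -- tolerance δ of `area_formula_aux`.
  have e : (c - 1) / (2 * c) * 2 = (c - 1) / c := by field_simp
  rw [e] at hab
  have h0 : 0 ≤ (c - 1) / c := div_nonneg (by linarith) hc0.le
  have h1 : ‖a - b‖ ≤ (c - 1) / c * ‖b‖ := hab.trans (by gcongr)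
  have h2 : (c - 1) / c * ‖b‖ * c = (c - 1) * ‖b‖ := by field_simp
  have h3 : (c - 1) / c ≤ c - 1 := div_le_self (by linarith) hc.le
  have h4 : (c - 1) / c * ‖b‖ ≤ (c - 1) * ‖b‖ := by gcongr
  constructor
  · have := norm_le_norm_sub_add a b
    nlinarith
  · have := norm_le_norm_sub_add b a
    rw [norm_sub_rev] at this
    nlinarith

/-- Both f and f' are compared with one expanding linear model A, for which the formula is exact.
Each comparison costs a factor c to the power of the dimension. -/
theorem area_formula_aux_of_approx {f : U → V} {f' : U → U →L[ℝ] V} {s : Set U}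
    {A : U →L[ℝ] V} {c : ℝ≥0} (hc : 1 < c) (hs : MeasurableSet s)
    (hA : ∀ v, ‖v‖ ≤ ‖A v‖)
    (hclose : ∀ x ∈ s, ∀ v, ‖f' x v - A v‖ ≤ ((c : ℝ) - 1) / (2 * c) * 2 * ‖v‖)
    (happrox : ∀ x ∈ s, ∀ y ∈ s,
      ‖(f x - f y) - A (x - y)‖ ≤ ((c : ℝ) - 1) / (2 * c) * 2 * ‖x - y‖) :
    (μHE[finrank ℝ U] : Measure V) (f '' s) ≤ ((c : ℝ≥0∞) ^ finrank ℝ U) ^ 2 *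
        ∫⁻ x in s, ENNReal.ofReal (LinearMap.normDet (f' x : U →ₗ[ℝ] V)) ∧
      ∫⁻ x in s, ENNReal.ofReal (LinearMap.normDet (f' x : U →ₗ[ℝ] V)) ≤
        ((c : ℝ≥0∞) ^ finrank ℝ U) ^ 2 * (μHE[finrank ℝ U] : Measure V) (f '' s) := by
  have hc' : (1 : ℝ) < c := by exact_mod_cast hc
  have hcn : ((c : ℝ≥0∞) ^ finrank ℝ U) ≠ ⊤ := by finiteness
  have hAim := LinearMap.euclideanHausdorffMeasure_image_eq_normDet_mul_volume
    (A : U →ₗ[ℝ] V) s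
  simp only [ContinuousLinearMap.coe_coe] at hAim
  have h1 := euclideanHausdorffMeasure_image_le_of_edist_le (g := f) (h := A) (S := s) (c := c)
    (fun x hx y hy ↦ edist_le_mul_of_norm_le (by
      rw [← map_sub]
      exact (norm_le_mul_of_norm_sub_le hc' (happrox x hx y hy) (hA _)).1)) (finrank ℝ U)
  have h2 := euclideanHausdorffMeasure_image_le_of_edist_le (g := A) (h := f) (S := s) (c := c)
    (fun x hx y hy ↦ edist_le_mul_of_norm_le (by
      rw [← map_sub]
      exact (norm_le_mul_of_norm_sub_le hc' (happrox x hx y hy) (hA _)).2)) (finrank ℝ U)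
  rw [hAim] at h1 h2
  have h3 : ∀ x ∈ s, _ := fun x hx ↦ normDet_le_of_norm_le (A := A) (B := f' x) (c := c)
    (fun v ↦ (norm_le_mul_of_norm_sub_le hc' (hclose x hx v) (hA _)).2)
  have h4 : ∀ x ∈ s, _ := fun x hx ↦ normDet_le_of_norm_le (A := f' x) (B := A) (c := c)
    (fun v ↦ (norm_le_mul_of_norm_sub_le hc' (hclose x hx v) (hA _)).1)
  constructor
  · calc _ ≤ _ := h1
      _ = (c : ℝ≥0∞) ^ finrank ℝ U *
          ∫⁻ _ in s, ENNReal.ofReal (LinearMap.normDet (A : U →ₗ[ℝ] V)) := by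
        rw [setLIntegral_const]
      _ ≤ (c : ℝ≥0∞) ^ finrank ℝ U * ∫⁻ x in s, (c : ℝ≥0∞) ^ finrank ℝ U *
          ENNReal.ofReal (LinearMap.normDet (f' x : U →ₗ[ℝ] V)) := by
        gcongr 1
        exact setLIntegral_mono' hs h3
      _ = _ := by rw [lintegral_const_mul' _ _ hcn, ← mul_assoc, sq]
  · calc _ ≤ ∫⁻ _ in s, (c : ℝ≥0∞) ^ finrank ℝ U *
          ENNReal.ofReal (LinearMap.normDet (A : U →ₗ[ℝ] V)) := setLIntegral_mono' hs h4
      _ = (c : ℝ≥0∞) ^ finrank ℝ U *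
          (ENNReal.ofReal (LinearMap.normDet (A : U →ₗ[ℝ] V)) * volume s) := by
        rw [setLIntegral_const, mul_assoc]
      _ ≤ _ := by
        rw [sq, mul_assoc]
        gcongr

/-- Two-sided estimates add up over a countable partition: injectivity keeps the images disjoint,
and injective continuous images of Borel sets are Borel. -/
theorem measure_image_eq_lintegral_of_partition {f : U → V} (hfc : Continuous f)
    (hinj : Function.Injective f) {s : Set U} (hs : MeasurableSet s) {D : U → ℝ≥0∞}
    {C : ℝ≥0∞} {n : ℕ} {t : ℕ → Set U} (ht : ∀ n, MeasurableSet (t n))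
    (hd : Pairwise (Function.onFun Disjoint t)) (hst : s ⊆ ⋃ n, t n)
    (H : ∀ m, (μHE[n] : Measure V) (f '' (s ∩ t m)) ≤ C * ∫⁻ x in s ∩ t m, D x ∧
      ∫⁻ x in s ∩ t m, D x ≤ C * (μHE[n] : Measure V) (f '' (s ∩ t m))) :
    (μHE[n] : Measure V) (f '' s) ≤ C * ∫⁻ x in s, D x ∧
      ∫⁻ x in s, D x ≤ C * (μHE[n] : Measure V) (f '' s) := by
  have hs' : s = ⋃ m, s ∩ t m := by
    rw [← Set.inter_iUnion, Set.inter_eq_left.2 hst]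
  have hd' : Pairwise (Function.onFun Disjoint fun m ↦ s ∩ t m) := fun i j hij ↦
    (hd hij).mono Set.inter_subset_right Set.inter_subset_right
  have e1 : (μHE[n] : Measure V) (f '' s) = ∑' m, (μHE[n] : Measure V) (f '' (s ∩ t m)) := by
    conv_lhs => rw [hs', Set.image_iUnion]
    refine measure_iUnion (fun i j hij ↦ ?_) fun m ↦
      (hs.inter (ht m)).image_of_continuousOn_injOn hfc.continuousOn hinj.injOn
    exact (Set.disjoint_image_iff hinj).2 (hd' hij)
  have e2 : ∫⁻ x in s, D x = ∑' m, ∫⁻ x in s ∩ t m, D x := by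
    conv_lhs => rw [hs']
    exact lintegral_iUnion (fun m ↦ hs.inter (ht m)) hd' _
  rw [e1, e2, ← ENNReal.tsum_mul_left, ← ENNReal.tsum_mul_left]
  exact ⟨ENNReal.tsum_le_tsum fun m ↦ (H m).1, ENNReal.tsum_le_tsum fun m ↦ (H m).2⟩

/-- Two partitions are superposed. Cells of the first keep f' within δ of an operator from a dense
sequence. On cells of the second, f is δ-close to its derivative at some point of the first cell. On
a common piece one linear map thus approximates f and, up to 2δ, also f'. -/
theorem area_formula_aux {f : U → V} {f' : U → U →L[ℝ] V} (hfc : Continuous f)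
    (hinj : Function.Injective f) (hfm : Measurable f') {s : Set U} (hs : MeasurableSet s)
    (hf' : ∀ x ∈ s, HasFDerivAt f (f' x) x) (hexp : ∀ x ∈ s, ∀ v, ‖v‖ ≤ ‖f' x v‖)
    {c : ℝ≥0} (hc : 1 < c) :
    (μHE[finrank ℝ U] : Measure V) (f '' s) ≤ ((c : ℝ≥0∞) ^ finrank ℝ U) ^ 2 *
        ∫⁻ x in s, ENNReal.ofReal (LinearMap.normDet (f' x : U →ₗ[ℝ] V)) ∧
      ∫⁻ x in s, ENNReal.ofReal (LinearMap.normDet (f' x : U →ₗ[ℝ] V)) ≤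
        ((c : ℝ≥0∞) ^ finrank ℝ U) ^ 2 * (μHE[finrank ℝ U] : Measure V) (f '' s) := by
  have hc' : (1 : ℝ) < c := by exact_mod_cast hc
  set δ : ℝ := ((c : ℝ) - 1) / (2 * c) with hδ
  have hδ0 : 0 < δ := div_pos (by linarith) (by positivity)
  let δ' : ℝ≥0 := ⟨δ, hδ0.le⟩
  let D := TopologicalSpace.denseSeq (U →L[ℝ] V)
  let t : ℕ → Set U := disjointed fun j ↦ {x | ‖f' x - D j‖ < δ}
  have htm : ∀ j, MeasurableSet (t j) := MeasurableSet.disjointed fun j ↦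
    measurableSet_lt ((hfm.sub_const _).norm) measurable_const
  have hcov : s ⊆ ⋃ j, t j := by
    rw [iUnion_disjointed]
    intro x _
    obtain ⟨j, hj⟩ := (TopologicalSpace.denseRange_denseSeq (U →L[ℝ] V)).exists_dist_lt (f' x) hδ0
    exact Set.mem_iUnion.2 ⟨j, by simpa [dist_eq_norm] using hj⟩
  refine measure_image_eq_lintegral_of_partition hfc hinj hs htm (disjoint_disjointed _) hcov
    fun j ↦ ?_
  obtain ⟨r, A, hrd, hrm, hrc, happ, hA⟩ :=
    exists_partition_approximatesLinearOn_of_hasFDerivWithinAt f (s ∩ t j) f'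
      (fun x hx ↦ (hf' x hx.1).hasFDerivWithinAt) (fun _ ↦ δ') (fun _ h ↦ by
        simp only [δ'] at h
        exact hδ0.ne' (congrArg NNReal.toReal h))
  refine measure_image_eq_lintegral_of_partition hfc hinj (hs.inter (htm j)) hrm hrd hrc
    fun m ↦ ?_
  rcases (s ∩ t j).eq_empty_or_nonempty with he | hne
  · simp [he]
  obtain ⟨y, hy, hAy⟩ := hA hne m
  have hclose : ∀ x ∈ s ∩ t j, ‖f' x - D j‖ < δ := fun x hx ↦
    disjointed_subset (fun j ↦ {x | ‖f' x - D j‖ < δ}) j hx.2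
  refine area_formula_aux_of_approx hc ((hs.inter (htm j)).inter (hrm m)) (A := A m)
    (by rw [hAy]; exact hexp y hy.1) (fun x hx v ↦ ?_) (fun x hx z hz ↦ ?_)
  · have h1 : ‖f' x - A m‖ ≤ δ * 2 := by
      rw [hAy]
      have := norm_sub_le_norm_sub_add_norm_sub (f' x) (D j) (f' y)
      have h2 := hclose x hx.1
      have h3 := hclose y hy
      rw [norm_sub_rev] at h3
      linarith
    calc ‖f' x v - A m v‖ = ‖(f' x - A m) v‖ := by simp
      _ ≤ ‖f' x - A m‖ * ‖v‖ := ContinuousLinearMap.le_opNorm _ _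
      _ ≤ _ := by gcongr
  · have := happ m x hx z hz
    refine this.trans ?_
    change δ * _ ≤ _
    gcongr
    linarith

/-- The area formula for expanding continuous injective maps. -/
theorem area_formula {f : U → V} {f' : U → U →L[ℝ] V} (hfc : Continuous f)
    (hinj : Function.Injective f) (hfm : Measurable f') {s : Set U} (hs : MeasurableSet s)
    (hf' : ∀ x ∈ s, HasFDerivAt f (f' x) x) (hexp : ∀ x ∈ s, ∀ v, ‖v‖ ≤ ‖f' x v‖) :
    (μHE[finrank ℝ U] : Measure V) (f '' s) =
      ∫⁻ x in s, ENNReal.ofReal (LinearMap.normDet (f' x : U →ₗ[ℝ] V)) := by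
  -- The two-sided bounds hold for every c > 1; the loss disappears as c decreases to 1.
  have hlim : ∀ X : ℝ≥0∞, Tendsto (fun c : ℝ≥0 ↦ ((c : ℝ≥0∞) ^ finrank ℝ U) ^ 2 * X)
      (𝓝[>] 1) (𝓝 X) := by
    intro X
    have h1 : Tendsto (fun c : ℝ≥0 ↦ ((c : ℝ≥0∞) ^ finrank ℝ U) ^ 2) (𝓝[>] 1)
        (𝓝 (((1 : ℝ≥0) : ℝ≥0∞) ^ finrank ℝ U) ) := by
      have h2 : Continuous fun c : ℝ≥0 ↦ (((c ^ finrank ℝ U) ^ 2 : ℝ≥0) : ℝ≥0∞) := by fun_prop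
      have := (h2.tendsto 1).mono_left (nhdsWithin_le_nhds (s := Set.Ioi 1))
      simpa using this
    simpa using ENNReal.Tendsto.mul_const (b := X) h1 (Or.inl (by simp))
  refine le_antisymm ?_ ?_
  · refine ge_of_tendsto (hlim _) ?_
    filter_upwards [self_mem_nhdsWithin] with c hc
    exact (area_formula_aux hfc hinj hfm hs hf' hexp hc).1
  · refine ge_of_tendsto (hlim _) ?_
    filter_upwards [self_mem_nhdsWithin] with c hc
    exact (area_formula_aux hfc hinj hfm hs hf' hexp hc).2

end AreaFormula


/-! ### Lipschitz graphs: surface measure and outer normal. -/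

section Graph

open Module

/-- The hyperplane orthogonal to `e`. -/
noncomputable abbrev Perp (e : E d) : Submodule ℝ (E d) := (ℝ ∙ e)ᗮ

/-- The orthogonal projection onto the hyperplane orthogonal to `e`. -/
noncomputable def perpProj (e : E d) : E d →L[ℝ] Perp e := (Perp e).orthogonalProjectionOnto

theorem coe_perpProj {e : E d} (he : ‖e‖ = 1) (x : E d) :
    (perpProj e x : E d) = x - inner ℝ e x • e := by
  rw [perpProj, Submodule.coe_orthogonalProjectionOnto_apply, Submodule.starProjection_orthogonal,
    sub_apply, Submodule.starProjection_unit_singleton ℝ he]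
  rfl

theorem perpProj_coe {e : E d} (y : Perp e) : perpProj e (y : E d) = y :=
  Submodule.orthogonalProjectionOnto_mem_subspace_eq_self y

theorem inner_perp {e : E d} (y : Perp e) : inner ℝ e (y : E d) = 0 :=
  Submodule.mem_orthogonal_singleton_iff_inner_right.1 y.2

theorem inner_perp' {e : E d} (y : Perp e) : inner ℝ (y : E d) e = 0 :=
  Submodule.mem_orthogonal_singleton_iff_inner_left.1 y.2

theorem perpProj_self {e : E d} (he : ‖e‖ = 1) : perpProj e e = 0 := by
  ext1
  rw [coe_perpProj he, real_inner_self_eq_norm_sq, he]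
  simp

theorem inner_coe_perpProj {e : E d} (y : Perp e) (x : E d) :
    inner ℝ y (perpProj e x) = inner ℝ (y : E d) x :=
  Submodule.inner_orthogonalProjectionOnto_eq_of_mem_left y x

theorem norm_perpProj_le {e : E d} (x : E d) : ‖perpProj e x‖ ≤ ‖x‖ :=
  Submodule.norm_orthogonalProjectionOnto_apply_le _ x

theorem finrank_perp {e : E d} (he : ‖e‖ = 1) : finrank ℝ (Perp e) = d - 1 := by
  have h0 : e ≠ 0 := by rintro rfl; simp at he
  have h1 := (ℝ ∙ e).finrank_add_finrank_orthogonal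
  rw [finrank_span_singleton h0, finrank_euclideanSpace_fin] at h1
  have h2 : finrank ℝ (Perp e) = finrank ℝ ↥(ℝ ∙ e)ᗮ := rfl
  omega

/-- The parametrisation of the graph of `ψ` over the hyperplane orthogonal to `e`. -/
noncomputable def graphMap (e : E d) (ψ : Perp e → ℝ) (y : Perp e) : E d := (y : E d) + ψ y • e

/-- The surface element of the graph of `ψ`. -/
noncomputable def surfaceElement {e : E d} (ψ : Perp e → ℝ) (y : Perp e) : ℝ :=
  √(1 + ‖gradient ψ y‖ ^ 2)

theorem one_le_surfaceElement {e : E d} (ψ : Perp e → ℝ) (y : Perp e) :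
    1 ≤ surfaceElement ψ y := by
  rw [surfaceElement, Real.one_le_sqrt]
  nlinarith [sq_nonneg ‖gradient ψ y‖]

theorem surfaceElement_sq {e : E d} (ψ : Perp e → ℝ) (y : Perp e) :
    surfaceElement ψ y ^ 2 = 1 + ‖gradient ψ y‖ ^ 2 :=
  Real.sq_sqrt (by positivity)

theorem measurable_gradient_of_continuous {F : Type*} [NormedAddCommGroup F]
    [InnerProductSpace ℝ F] [FiniteDimensional ℝ F] [MeasurableSpace F] [BorelSpace F]
    (ψ : F → ℝ) : Measurable (gradient ψ) := by
  unfold gradient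
  exact (InnerProductSpace.toDual ℝ F).symm.continuous.measurable.comp (measurable_fderiv ℝ ψ)

theorem measurable_surfaceElement {e : E d} (ψ : Perp e → ℝ) :
    Measurable (surfaceElement ψ) := by
  unfold surfaceElement
  have := (measurable_gradient_of_continuous ψ).norm
  fun_prop

section

variable {e : E d} {ψ : Perp e → ℝ}

theorem perpProj_graphMap (he : ‖e‖ = 1) (y : Perp e) : perpProj e (graphMap e ψ y) = y := by
  rw [graphMap, map_add, map_smul, perpProj_self he, perpProj_coe, smul_zero, add_zero]

theorem inner_graphMap (he : ‖e‖ = 1) (y : Perp e) : inner ℝ e (graphMap e ψ y) = ψ y := by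
  rw [graphMap, inner_add_right, inner_smul_right, inner_perp, real_inner_self_eq_norm_sq, he]
  simp

theorem injective_graphMap (he : ‖e‖ = 1) : Function.Injective (graphMap e ψ) := fun x y h ↦ by
  rw [← perpProj_graphMap (ψ := ψ) he x, h, perpProj_graphMap he]

theorem continuous_graphMap (hψ : Continuous ψ) : Continuous (graphMap e ψ) := by
  unfold graphMap; fun_prop

theorem hasFDerivAt_graphMap {y : Perp e} (h : DifferentiableAt ℝ ψ y) :
    HasFDerivAt (graphMap e ψ) ((Perp e).subtypeL + (fderiv ℝ ψ y).smulRight e) y :=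
  ((Perp e).subtypeL.hasFDerivAt).add (h.hasFDerivAt.smul_const e)

/-- For A = inclusion + L(·)e one has A*A = id + L(·)ξ with ξ the Riesz vector of L. This is a
transvection, of determinant 1 + L ξ = 1 + ‖ξ‖². -/
theorem normDet_graph (he : ‖e‖ = 1) (L : Perp e →L[ℝ] ℝ) :
    LinearMap.normDet (((Perp e).subtypeL + L.smulRight e : Perp e →L[ℝ] E d) :
      Perp e →ₗ[ℝ] E d) = √(1 + ‖L‖ ^ 2) := by
  set ξ := (InnerProductSpace.toDual ℝ (Perp e)).symm L with hξ
  have hL : ∀ y, L y = inner ℝ ξ y := fun y ↦ by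
    rw [hξ, InnerProductSpace.toDual_symm_apply]
  have hn : ‖L‖ = ‖ξ‖ := by rw [hξ, LinearIsometryEquiv.norm_map]
  set A : Perp e →L[ℝ] E d := (Perp e).subtypeL + L.smulRight e with hA
  have hAv : ∀ v, A v = (v : E d) + L v • e := fun v ↦ rfl
  have h1 := A.normDet_sq
  have h2 : (A.adjoint ∘L A : Perp e →L[ℝ] Perp e).det = 1 + ‖ξ‖ ^ 2 := by
    have h3 : ((A.adjoint ∘L A : Perp e →L[ℝ] Perp e) : Perp e →ₗ[ℝ] Perp e) =
        LinearMap.transvection (L : Perp e →ₗ[ℝ] ℝ) ξ := by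
      refine LinearMap.ext fun v ↦ ext_inner_right ℝ fun w ↦ ?_
      rw [LinearMap.transvection.apply, ContinuousLinearMap.coe_coe,
        ContinuousLinearMap.comp_apply, ContinuousLinearMap.adjoint_inner_left, hAv, hAv,
        inner_add_left, inner_add_left, inner_add_right, inner_add_right, inner_smul_right,
        inner_smul_left, inner_smul_left, inner_smul_left, inner_perp, inner_perp',
        inner_smul_right, real_inner_self_eq_norm_sq, he, hL w]
      simp [hL v]
    rw [ContinuousLinearMap.det, h3, LinearMap.transvection.det]
    simp [hL]
  rw [h2] at h1
  rw [hn, ← Real.sqrt_sq (LinearMap.normDet_nonneg _)]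
  congr 1

theorem surfaceElement_eq (y : Perp e) : surfaceElement ψ y = √(1 + ‖fderiv ℝ ψ y‖ ^ 2) := by
  rw [surfaceElement, gradient, LinearIsometryEquiv.norm_map]

theorem lipschitzWith_graphMap {K : ℝ≥0} (he : ‖e‖ = 1) (hψ : LipschitzWith K ψ) :
    LipschitzWith (1 + K) (graphMap e ψ) := by
  refine LipschitzWith.of_dist_le_mul fun x y ↦ ?_
  rw [dist_eq_norm, graphMap, graphMap, add_sub_add_comm, ← sub_smul]
  refine (norm_add_le _ _).trans ?_
  rw [norm_smul, he, mul_one, ← dist_eq_norm (ψ x)]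
  have := hψ.dist_le_mul x y
  have h2 : ‖(x : E d) - y‖ = dist x y := by rw [← dist_eq_norm]; rfl
  rw [h2]
  push_cast
  linarith

/-- The points where ψ is not differentiable form a null set by Rademacher, with null image because
the graph map is Lipschitz. Elsewhere the area formula applies: the graph map is expanding, since
the projection along e is a left inverse of norm at most one. -/
theorem measure_image_graphMap {K : ℝ≥0} (he : ‖e‖ = 1) (hψ : LipschitzWith K ψ)
    {s : Set (Perp e)} (hs : MeasurableSet s) :
    (μHE[d - 1] : Measure (E d)) (graphMap e ψ '' s) =
      ∫⁻ y in s, ENNReal.ofReal (surfaceElement ψ y) := by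
  rw [← finrank_perp he]
  set D := {y | DifferentiableAt ℝ ψ y}
  have hD : MeasurableSet D := measurableSet_of_differentiableAt ℝ ψ
  have hDc : volume Dᶜ = 0 := hψ.ae_differentiableAt
  have h0 : (μHE[finrank ℝ (Perp e)] : Measure (E d)) (graphMap e ψ '' (s \ D)) = 0 := by
    have h1 := euclideanHausdorffMeasure_image_le_of_edist_le (g := graphMap e ψ) (h := id)
      (S := s \ D) (c := 1 + K) (fun x _ y _ ↦ lipschitzWith_graphMap he hψ x y)
      (finrank ℝ (Perp e))
    rw [Set.image_id, InnerProductSpace.euclideanHausdorffMeasure_eq_volume,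
      measure_mono_null (Set.sdiff_subset_compl s D) hDc, mul_zero] at h1
    exact nonpos_iff_eq_zero.1 h1
  have h1 := area_formula (continuous_graphMap hψ.continuous) (injective_graphMap he)
    (f' := fun y ↦ (Perp e).subtypeL + (fderiv ℝ ψ y).smulRight e)
    (by
      have h3 : Continuous fun L : Perp e →L[ℝ] ℝ ↦ (Perp e).subtypeL + L.smulRight e := by
        have := (ContinuousLinearMap.smulRightL ℝ (Perp e) (E d)).flip e |>.continuous
        exact continuous_const.add this
      exact h3.measurable.comp (measurable_fderiv ℝ ψ))
    (hs.inter hD) (fun x hx ↦ hasFDerivAt_graphMap hx.2) (fun x _ v ↦ by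
      calc ‖v‖ = ‖perpProj e (((Perp e).subtypeL + (fderiv ℝ ψ x).smulRight e) v)‖ := by
            congr 1
            change v = perpProj e ((v : E d) + (fderiv ℝ ψ x v) • e)
            rw [map_add, map_smul, perpProj_self he, perpProj_coe, smul_zero, add_zero]
        _ ≤ _ := norm_perpProj_le _)
  simp only [normDet_graph he, ← surfaceElement_eq] at h1
  have h2 : ∫⁻ y in s, ENNReal.ofReal (surfaceElement ψ y) =
      ∫⁻ y in s ∩ D, ENNReal.ofReal (surfaceElement ψ y) := by
    refine setLIntegral_congr ?_
    have : D =ᵐ[volume] Set.univ := by rw [ae_eq_univ]; exact hDc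
    simpa using (ae_eq_refl s).inter this.symm
  rw [h2, ← h1]
  refine le_antisymm ?_ (measure_mono (Set.image_mono Set.inter_subset_left))
  conv_lhs => rw [← Set.inter_union_sdiff s D, Set.image_union]
  exact (measure_union_le _ _).trans (by rw [h0, add_zero])

end

/-- Inside `B`, the set `Ω` lies strictly below the graph of the Lipschitz function `ψ`. -/
structure GraphChart (Ω : Set (E d)) (e : E d) (ψ : Perp e → ℝ) (K : ℝ≥0) (B : Set (E d)) :
    Prop where
  norm_eq_one : ‖e‖ = 1
  lipschitz : LipschitzWith K ψ
  isOpen : IsOpen B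
  mem_iff : ∀ x ∈ B, x ∈ Ω ↔ inner ℝ e x < ψ (perpProj e x)

theorem IsLipschitzDomain.exists_graphChart {Ω : Set (E d)} (hΩ : IsLipschitzDomain Ω)
    {x : E d} (hx : x ∈ frontier Ω) :
    ∃ (e : E d) (ψ : Perp e → ℝ) (K : ℝ≥0) (r : ℝ), 0 < r ∧
      GraphChart Ω e ψ K (Metric.ball x r) := by
  obtain ⟨e, φ, K, r, he, hφ, hr, h⟩ := hΩ.2.2 x hx
  refine ⟨e, fun y ↦ φ y, K, r, hr, he, ?_, Metric.isOpen_ball, fun y hy ↦ ?_⟩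
  · exact LipschitzWith.of_dist_le_mul fun y z ↦ hφ.dist_le_mul y z
  · rw [h y hy, coe_perpProj he]

namespace GraphChart

variable {Ω : Set (E d)} {e : E d} {ψ : Perp e → ℝ} {K : ℝ≥0} {B : Set (E d)}

theorem eq_graphMap_iff (h : GraphChart Ω e ψ K B) (x : E d) :
    inner ℝ e x = ψ (perpProj e x) ↔ x = graphMap e ψ (perpProj e x) := by
  rw [graphMap, coe_perpProj h.1]
  constructor
  · intro hx; rw [← hx]; simp
  · intro hx
    have h2 := congrArg (inner ℝ e) hx
    rw [inner_add_right, inner_sub_right, inner_smul_right, inner_smul_right,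
      real_inner_self_eq_norm_sq, h.1] at h2
    rw [h2]; ring

/-- Both strict inequalities are open conditions, which excludes points off the graph. A point on
the graph is not in Ω, but it is the limit of the points x - t e of Ω. -/
theorem mem_frontier_iff (h : GraphChart Ω e ψ K B) {x : E d} (hx : x ∈ B) :
    x ∈ frontier Ω ↔ inner ℝ e x = ψ (perpProj e x) := by
  have hψ := h.lipschitz.continuous
  have hc : Continuous fun z ↦ ψ (perpProj e z) := hψ.comp (perpProj e).continuous
  have hB := h.isOpen.mem_nhds hx
  rcases lt_trichotomy (inner ℝ e x) (ψ (perpProj e x)) with hlt | heq | hgt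
  · refine iff_of_false (fun hf ↦ ?_) hlt.ne
    have : Ω ∈ 𝓝 x := by
      filter_upwards [hB, (isOpen_lt (by fun_prop) hc).mem_nhds hlt] with z hz hz'
      exact (h.mem_iff z hz).2 hz'
    exact hf.2 (mem_interior_iff_mem_nhds.2 this)
  · refine iff_of_true ⟨?_, fun hi ↦ ?_⟩ heq
    · have hlim : Tendsto (fun t : ℝ ↦ x - t • e) (𝓝[>] 0) (𝓝 x) := by
        have : Continuous fun t : ℝ ↦ x - t • e := by fun_prop
        simpa using (this.tendsto 0).mono_left nhdsWithin_le_nhds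
      refine mem_closure_of_tendsto hlim ?_
      filter_upwards [hlim hB, self_mem_nhdsWithin] with t ht ht0
      rw [h.mem_iff _ ht, map_sub, map_smul, perpProj_self h.1, smul_zero, sub_zero, ← heq,
        inner_sub_right, inner_smul_right, real_inner_self_eq_norm_sq, h.1]
      simpa using ht0
    · exact absurd ((h.mem_iff x hx).1 (interior_subset hi)) heq.not_lt
  · refine iff_of_false (fun hf ↦ ?_) hgt.ne'
    have : Ωᶜ ∈ 𝓝 x := by
      filter_upwards [hB, (isOpen_lt hc (by fun_prop)).mem_nhds hgt] with z hz hz' hzΩ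
      exact lt_asymm ((h.mem_iff z hz).1 hzΩ) hz'
    exact (mem_closure_iff_nhds.1 hf.1 _ this).elim fun z hz ↦ hz.1 hz.2

/-- In a chart, the surface measure is the graph measure. -/
theorem surf_restrict (h : GraphChart Ω e ψ K B) :
    (surf Ω).restrict B = (Measure.map (graphMap e ψ)
      (volume.withDensity fun y ↦ ENNReal.ofReal (surfaceElement ψ y))).restrict B := by
  have hc := continuous_graphMap (e := e) h.lipschitz.continuous
  ext S hS
  rw [Measure.restrict_apply hS, Measure.restrict_apply hS, surf,
    Measure.restrict_apply (hS.inter h.isOpen.measurableSet),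
    Measure.map_apply hc.measurable (hS.inter h.isOpen.measurableSet),
    withDensity_apply _ (hc.measurable (hS.inter h.isOpen.measurableSet)),
    ← measure_image_graphMap h.1 h.2 (hc.measurable (hS.inter h.isOpen.measurableSet)),
    Set.image_preimage_eq_inter_range]
  congr 1
  ext x
  refine and_congr_right fun hx ↦ ?_
  rw [h.mem_frontier_iff hx.2, h.eq_graphMap_iff]
  exact ⟨fun h ↦ ⟨_, h.symm⟩, fun ⟨y, hy⟩ ↦ by rw [← hy, perpProj_graphMap h.1]⟩

theorem measurableEmbedding_graphMap (h : GraphChart Ω e ψ K B) :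
    MeasurableEmbedding (graphMap e ψ) :=
  (continuous_graphMap h.lipschitz.continuous).measurableEmbedding (injective_graphMap h.1)

theorem setIntegral_surf (h : GraphChart Ω e ψ K B) (F : E d → ℝ) :
    ∫ x in B, F x ∂surf Ω =
      ∫ y in graphMap e ψ ⁻¹' B, surfaceElement ψ y * F (graphMap e ψ y) := by
  have hc := continuous_graphMap (e := e) h.lipschitz.continuous
  have hB := hc.measurable h.isOpen.measurableSet
  rw [h.surf_restrict, h.measurableEmbedding_graphMap.setIntegral_map,
    setIntegral_withDensity_eq_setIntegral_toReal_smul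
      ((measurable_surfaceElement ψ).ennreal_ofReal) (by simp) _ hB]
  refine setIntegral_congr_fun hB fun y _ ↦ ?_
  simp only [smul_eq_mul]
  rw [ENNReal.toReal_ofReal (zero_le_one.trans (one_le_surfaceElement ψ y))]

end GraphChart

/-- If n ≠ m, a small step from x in the direction m - n enters Ω according to n and leaves it
according to m. -/
theorem isOuterNormal_unique {Ω : Set (E d)} {x n m : E d} (hn : IsOuterNormal Ω x n)
    (hm : IsOuterNormal Ω x m) : n = m := by
  by_contra hne
  set v := m - n
  have hinn : inner ℝ m n < 1 := by
    have h0 : 0 < ‖v‖ ^ 2 := by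
      have : v ≠ 0 := sub_ne_zero.2 (Ne.symm hne)
      positivity
    have h1 := norm_sub_sq_real m n
    rw [hn.1, hm.1] at h1
    linarith
  have hvn : inner ℝ v n = inner ℝ m n - 1 := by
    rw [inner_sub_left, real_inner_self_eq_norm_sq, hn.1]; norm_num
  have hvm : inner ℝ v m = 1 - inner ℝ m n := by
    rw [inner_sub_left, real_inner_self_eq_norm_sq, hm.1, real_inner_comm]; norm_num
  set ε := (1 - inner ℝ m n) / (‖v‖ + 1) / 2
  have hp : 0 < ‖v‖ + 1 := by positivity
  have hε : 0 < ε := by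
    have : 0 < 1 - inner ℝ m n := by linarith
    positivity
  have hεv : ε * ‖v‖ < 1 - inner ℝ m n := by
    have h1 : ε * (‖v‖ + 1) = (1 - inner ℝ m n) / 2 := by
      simp only [ε]; field_simp
    nlinarith
  have hlim : Tendsto (fun t : ℝ ↦ x + t • v) (𝓝[>] 0) (𝓝 x) := by
    have : Continuous fun t : ℝ ↦ x + t • v := by fun_prop
    simpa using (this.tendsto 0).mono_left nhdsWithin_le_nhds
  have hev := (hlim.eventually (hn.2 ε hε)).and
    ((hlim.eventually (hm.2 ε hε)).and self_mem_nhdsWithin)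
  obtain ⟨t, ⟨h1, -⟩, ⟨-, h2⟩, ht⟩ := hev.exists
  have ht' : 0 < t := ht
  simp only [add_sub_cancel_left, inner_smul_left, norm_smul, Real.norm_of_nonneg ht'.le,
    RCLike.conj_to_real] at h1 h2
  refine h2 ?_ (h1 ?_)
  · rw [hvm]; nlinarith
  · rw [hvn]; nlinarith

theorem outerNormal_eq {Ω : Set (E d)} {x n : E d} (hn : IsOuterNormal Ω x n) :
    outerNormal Ω x = n := by
  have h : ∃ n, IsOuterNormal Ω x n := ⟨n, hn⟩
  rw [outerNormal, dif_pos h]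
  exact isOuterNormal_unique h.choose_spec hn

/-- The upward unit normal of the graph of `ψ`. -/
noncomputable def graphNormal (e : E d) (ψ : Perp e → ℝ) (y : Perp e) : E d :=
  (surfaceElement ψ y)⁻¹ • (e - ((gradient ψ y : Perp e) : E d))

theorem measurable_graphNormal (e : E d) (ψ : Perp e → ℝ) : Measurable (graphNormal e ψ) := by
  unfold graphNormal
  have h1 := (measurable_surfaceElement ψ).inv
  have h2 : Measurable fun y ↦ ((gradient ψ y : Perp e) : E d) :=
    measurable_subtype_coe.comp (measurable_gradient_of_continuous ψ)
  exact h1.smul (h2.const_sub e)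

theorem inner_gradient_eq {F : Type*} [NormedAddCommGroup F] [InnerProductSpace ℝ F]
    [CompleteSpace F] (f : F → ℝ) (x v : F) : inner ℝ (gradient f x) v = fderiv ℝ f x v := by
  rw [gradient, InnerProductSpace.toDual_symm_apply]

/-- The surface element cancels the normalisation of the normal, so fluxes through the graph become
flat integrals against e - ∇ψ. -/
theorem surfaceElement_mul_inner_graphNormal (e : E d) (ψ : Perp e → ℝ) (y : Perp e) (v : E d) :
    surfaceElement ψ y * inner ℝ v (graphNormal e ψ y) =
      inner ℝ e v - fderiv ℝ ψ y (perpProj e v) := by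
  have h0 : surfaceElement ψ y ≠ 0 := (zero_lt_one.trans_le (one_le_surfaceElement ψ y)).ne'
  rw [graphNormal, inner_smul_right, mul_inv_cancel_left₀ h0, inner_sub_right,
    real_inner_comm e v, real_inner_comm ((gradient ψ y : Perp e) : E d) v, ← inner_coe_perpProj,
    inner_gradient_eq]

namespace GraphChart

variable {Ω : Set (E d)} {e : E d} {ψ : Perp e → ℝ} {K : ℝ≥0} {B : Set (E d)}

/-- The first-order expansion of ψ along the projection decides on which side of the graph a nearby
point lies. Multiplying by the surface element only enlarges the margin, because it is at least one.
-/
theorem isOuterNormal (h : GraphChart Ω e ψ K B) {y : Perp e} (hy : DifferentiableAt ℝ ψ y)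
    (hB : graphMap e ψ y ∈ B) : IsOuterNormal Ω (graphMap e ψ y) (graphNormal e ψ y) := by
  set x := graphMap e ψ y with hx
  set J := surfaceElement ψ y with hJ
  have hJ1 : 1 ≤ J := one_le_surfaceElement ψ y
  have hJ0 : 0 < J := by linarith
  constructor
  · have h1 : ‖e - ((gradient ψ y : Perp e) : E d)‖ = J := by
      rw [← sq_eq_sq₀ (norm_nonneg _) hJ0.le, hJ, surfaceElement_sq, norm_sub_sq_real, inner_perp,
        h.1]
      simp
    rw [graphNormal, norm_smul, h1, Real.norm_of_nonneg (inv_nonneg.2 hJ0.le)]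
    exact inv_mul_cancel₀ hJ0.ne'
  · intro ε hε
    have hpx : perpProj e x = y := perpProj_graphMap h.1 y
    have hd : HasFDerivAt (fun z ↦ ψ (perpProj e z)) ((fderiv ℝ ψ y).comp (perpProj e)) x := by
      have h1 : HasFDerivAt ψ (fderiv ℝ ψ y) (perpProj e x) := by rw [hpx]; exact hy.hasFDerivAt
      exact h1.comp x (perpProj e).hasFDerivAt
    have hev := (hasFDerivAt_iff_isLittleO.1 hd).def hε
    filter_upwards [hev, h.isOpen.mem_nhds hB] with z hz hzB
    have key : inner ℝ (z - x) (graphNormal e ψ y) * J =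
        inner ℝ e (z - x) - fderiv ℝ ψ y (perpProj e (z - x)) := by
      rw [mul_comm]; exact surfaceElement_mul_inner_graphNormal e ψ y _
    have hex : inner ℝ e x = ψ y := inner_graphMap h.1 y
    rw [inner_sub_right, hex] at key
    rw [hpx, ContinuousLinearMap.comp_apply, Real.norm_eq_abs, abs_le] at hz
    rw [h.mem_iff z hzB]
    have hnn : 0 ≤ ε * ‖z - x‖ := by positivity
    have hle : ε * ‖z - x‖ ≤ J * (ε * ‖z - x‖) := le_mul_of_one_le_left hnn hJ1
    constructor
    · intro hlt
      have := mul_lt_mul_of_pos_right hlt hJ0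
      linarith
    · intro hlt hlt2
      have := mul_lt_mul_of_pos_right hlt hJ0
      linarith

theorem ae_outerNormal_graphMap (h : GraphChart Ω e ψ K B) :
    ∀ᵐ y : Perp e, graphMap e ψ y ∈ B →
      outerNormal Ω (graphMap e ψ y) = graphNormal e ψ y := by
  filter_upwards [h.lipschitz.ae_differentiableAt] with y hy hB
  exact outerNormal_eq (h.isOuterNormal hy hB)

theorem ae_surf_restrict {p : E d → Prop} (h : GraphChart Ω e ψ K B)
    (hp : ∀ᵐ y : Perp e, graphMap e ψ y ∈ B → p (graphMap e ψ y)) :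
    ∀ᵐ x ∂(surf Ω).restrict B, p x := by
  rw [h.surf_restrict, ae_restrict_iff' h.isOpen.measurableSet,
    h.measurableEmbedding_graphMap.ae_map_iff]
  exact (withDensity_absolutelyContinuous _ _).ae_le hp

theorem ae_isOuterNormal (h : GraphChart Ω e ψ K B) :
    ∀ᵐ x ∂(surf Ω).restrict B, IsOuterNormal Ω x (outerNormal Ω x) := by
  refine h.ae_surf_restrict ?_
  filter_upwards [h.lipschitz.ae_differentiableAt] with y hy hB
  have := h.isOuterNormal hy hB
  rwa [outerNormal_eq this]

theorem aemeasurable_outerNormal (h : GraphChart Ω e ψ K B) :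
    AEMeasurable (outerNormal Ω) ((surf Ω).restrict B) := by
  refine ⟨fun x ↦ graphNormal e ψ (perpProj e x),
    (measurable_graphNormal e ψ).comp (perpProj e).continuous.measurable, ?_⟩
  refine h.ae_surf_restrict (p := fun x ↦ outerNormal Ω x = graphNormal e ψ (perpProj e x)) ?_
  filter_upwards [h.ae_outerNormal_graphMap] with y hy hB
  rw [hy hB, perpProj_graphMap h.1]

/-- The direction of a chart is uniformly transversal to the boundary. -/
theorem ae_le_inner_outerNormal (h : GraphChart Ω e ψ K B) :
    ∀ᵐ x ∂(surf Ω).restrict B, (√(1 + (K : ℝ) ^ 2))⁻¹ ≤ inner ℝ e (outerNormal Ω x) := by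
  refine h.ae_surf_restrict
    (p := fun x ↦ (√(1 + (K : ℝ) ^ 2))⁻¹ ≤ inner ℝ e (outerNormal Ω x)) ?_
  filter_upwards [h.ae_outerNormal_graphMap] with y hy hB
  rw [hy hB]
  have h1 := surfaceElement_mul_inner_graphNormal e ψ y e
  rw [perpProj_self h.1, map_zero, sub_zero, real_inner_self_eq_norm_sq, h.1, one_pow] at h1
  have h0 : 0 < surfaceElement ψ y := zero_lt_one.trans_le (one_le_surfaceElement ψ y)
  rw [eq_inv_of_mul_eq_one_right h1]
  refine inv_anti₀ h0 ?_
  rw [surfaceElement_eq]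
  gcongr
  exact norm_fderiv_le_of_lipschitz ℝ h.lipschitz

theorem surf_lt_top (h : GraphChart Ω e ψ K B) (hB : Bornology.IsBounded B) :
    surf Ω B < ⊤ := by
  have hc := continuous_graphMap (e := e) h.lipschitz.continuous
  have h1 : surf Ω B = (surf Ω).restrict B B := by
    rw [Measure.restrict_apply_self]
  rw [h1, h.surf_restrict, Measure.restrict_apply_self,
    Measure.map_apply hc.measurable h.isOpen.measurableSet,
    withDensity_apply _ (hc.measurable h.isOpen.measurableSet)]
  have hb : Bornology.IsBounded (graphMap e ψ ⁻¹' B) := by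
    obtain ⟨R, hR⟩ := hB.exists_norm_le
    refine (Metric.isBounded_closedBall (x := (0 : Perp e)) (r := R)).subset fun y hy ↦ ?_
    rw [mem_closedBall_zero_iff, ← perpProj_graphMap (ψ := ψ) h.1 y]
    exact (norm_perpProj_le _).trans (hR _ hy)
  calc ∫⁻ y in graphMap e ψ ⁻¹' B, ENNReal.ofReal (surfaceElement ψ y)
      ≤ ∫⁻ _ in graphMap e ψ ⁻¹' B, ENNReal.ofReal (√(1 + (K : ℝ) ^ 2)) := by
        refine lintegral_mono fun y ↦ ENNReal.ofReal_le_ofReal ?_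
        rw [surfaceElement_eq]
        gcongr
        exact norm_fderiv_le_of_lipschitz ℝ h.lipschitz
    _ < ⊤ := by
        rw [setLIntegral_const]
        exact ENNReal.mul_lt_top ENNReal.ofReal_lt_top hb.measure_lt_top

end GraphChart

end Graph


/-! ### Divergence theorem in one boundary chart. -/

section LocalGreen

open Module

theorem integral_fderiv_apply_eq_zero {F : Type*} [NormedAddCommGroup F] [NormedSpace ℝ F]
    [FiniteDimensional ℝ F] [MeasurableSpace F] [BorelSpace F] {μ : Measure F}
    [μ.IsAddHaarMeasure] {f : F → ℝ} {C : ℝ≥0} (hf : LipschitzWith C f)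
    (hfc : HasCompactSupport f) (v : F) : ∫ x, fderiv ℝ f x v ∂μ = 0 := by
  -- Integration by parts against the constant 1, whose line derivatives vanish; starting from -v
  -- makes the other side differentiate along v.
  have h1 := LipschitzWith.integral_lineDeriv_mul_eq (μ := μ)
    (LipschitzWith.const' (α := F) (K := 0) (1 : ℝ)) hf hfc (-v)
  have h2 : ∀ x : F, lineDeriv ℝ (fun _ : F ↦ (1 : ℝ)) x (-v) = 0 := fun x ↦ by
    rw [(differentiableAt_const _).lineDeriv_eq_fderiv]; simp
  simp only [h2, zero_mul, integral_zero, neg_neg, mul_one] at h1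
  rw [h1]
  refine integral_congr_ae ?_
  filter_upwards [hf.ae_differentiableAt] with x hx
  rw [hx.lineDeriv_eq_fderiv]

/-- Lipschitz functions are absolutely continuous, so the fundamental theorem of calculus applies,
starting from a point to the left of the support. -/
theorem setIntegral_Iic_deriv {f : ℝ → ℝ} {C : ℝ≥0} (hf : LipschitzWith C f)
    (hfc : HasCompactSupport f) (a : ℝ) : ∫ s in Set.Iic a, deriv f s = f a := by
  obtain ⟨R, hR⟩ := hfc.isCompact.isBounded.exists_norm_le
  set b := min a (-(R + 1)) with hb
  have hout : ∀ s, s < -R → s ∉ tsupport f := fun s hs h ↦ by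
    have := hR s h
    rw [Real.norm_eq_abs] at this
    linarith [neg_abs_le s]
  have hbR : b < -R := (min_le_right _ _).trans_lt (by linarith)
  have h1 := (hf.lipschitzOnWith (s := Set.uIcc b a)).absolutelyContinuousOnInterval
    |>.integral_deriv_eq_sub
  rw [intervalIntegral.integral_of_le (min_le_left _ _),
    image_eq_zero_of_notMem_tsupport (hout b hbR), sub_zero] at h1
  rw [← h1]
  refine setIntegral_eq_of_subset_of_forall_sdiff_eq_zero measurableSet_Iic
    Set.Ioc_subset_Iic_self fun s hs ↦ ?_
  have hsb : s ≤ b := by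
    by_contra h
    exact hs.2 ⟨not_le.1 h, hs.1⟩
  exact image_eq_zero_of_notMem_tsupport
    (fun h ↦ hout s (hsb.trans_lt hbR) (tsupport_deriv_subset h))

theorem measurePreserving_add_smul {e : E d} (he : ‖e‖ = 1) :
    MeasurePreserving (fun p : Perp e × ℝ ↦ (p.1 : E d) + p.2 • e) volume volume := by
  have h1 := (ℝ ∙ e).measurePreserving_measurableEquivProd (0 : E d)
  rw [InnerProductSpace.euclideanHausdorffMeasure_eq_volume] at h1
  have h2 := (LinearIsometryEquiv.toSpanUnitSingleton (𝕜 := ℝ) e he).measurePreserving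
  have h3 : MeasurePreserving
      (Prod.map (LinearIsometryEquiv.toSpanUnitSingleton (𝕜 := ℝ) e he) (id : Perp e → Perp e))
      ((volume : Measure ℝ).prod (volume : Measure (Perp e))) (volume.prod volume) :=
    h2.prod (MeasurePreserving.id _)
  have h4 := (h1.symm.comp h3).comp (Measure.measurePreserving_swap
    (μ := (volume : Measure (Perp e))) (ν := (volume : Measure ℝ)))
  have h5 : (fun p : Perp e × ℝ ↦ (p.1 : E d) + p.2 • e) =
      (((ℝ ∙ e).measurableEquivProd (0 : E d)).symm ∘
        Prod.map (LinearIsometryEquiv.toSpanUnitSingleton (𝕜 := ℝ) e he) id) ∘ Prod.swap := by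
    ext1 p
    simp [add_comm]
  rw [h5]
  exact h4

/-- The shear that flattens the graph translates every fibre parallel to e. It therefore preserves
volume without any differentiability of ψ. -/
theorem measurePreserving_graph {e : E d} (he : ‖e‖ = 1) {ψ : Perp e → ℝ} (hψ : Continuous ψ) :
    MeasurePreserving (fun p : Perp e × ℝ ↦ (p.1 : E d) + (ψ p.1 + p.2) • e)
      volume volume := by
  have h1 : MeasurePreserving (fun p : Perp e × ℝ ↦ (p.1, ψ p.1 + p.2))
      ((volume : Measure (Perp e)).prod volume) (volume.prod volume) := by
    refine (MeasurePreserving.id _).skew_product (g := fun y t ↦ ψ y + t) ?_ ?_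
    · have : Continuous fun p : Perp e × ℝ ↦ ψ p.1 + p.2 := by fun_prop
      exact this.measurable
    · exact .of_forall fun y ↦ map_add_left_eq_self volume (ψ y)
  exact (measurePreserving_add_smul he).comp h1

theorem integrable_fderiv_apply {F : Type*} [NormedAddCommGroup F] [NormedSpace ℝ F]
    [FiniteDimensional ℝ F] [MeasurableSpace F] [BorelSpace F] {μ : Measure F}
    [IsFiniteMeasureOnCompacts μ] {f : F → ℝ} {C : ℝ≥0} (hf : LipschitzWith C f)
    (hfc : HasCompactSupport f) (v : F) : Integrable (fun x ↦ fderiv ℝ f x v) μ := by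
  refine (IntegrableOn.of_bound (s := tsupport f) hfc.isCompact.measure_lt_top
    (measurable_fderiv_apply_const ℝ f v).aestronglyMeasurable (C * ‖v‖)
    (.of_forall fun x ↦ ?_)).integrable_of_forall_notMem_eq_zero fun x hx ↦ ?_
  · exact (ContinuousLinearMap.le_opNorm _ _).trans (by
      gcongr; exact norm_fderiv_le_of_lipschitz ℝ hf)
  · rw [fderiv_of_notMem_tsupport ℝ hx]; simp

/-- The divergence theorem in a chart, in the coordinates of the graph. -/
theorem GraphChart.setIntegral_fderiv_eq {Ω : Set (E d)} {e : E d} {ψ : Perp e → ℝ} {K : ℝ≥0}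
    {B : Set (E d)} (h : GraphChart Ω e ψ K B) (hΩ : MeasurableSet Ω) {f : E d → ℝ} {C : ℝ≥0}
    (hf : LipschitzWith C f) (hfc : HasCompactSupport f) (hfB : tsupport f ⊆ B) (v : E d) :
    ∫ x in Ω, fderiv ℝ f x v =
      ∫ y, (inner ℝ e v - fderiv ℝ ψ y (perpProj e v)) * f (graphMap e ψ y) := by
  have hψ := h.lipschitz
  set Ψ : Perp e × ℝ → E d := fun p ↦ (p.1 : E d) + (ψ p.1 + p.2) • e with hΨ
  have hΨm : MeasurePreserving Ψ volume volume := measurePreserving_graph h.1 hψ.continuous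
  have hΨc : Continuous Ψ := by
    have := hψ.continuous
    simp only [hΨ]; fun_prop
  have hproj : ∀ p, perpProj e (Ψ p) = p.1 := fun p ↦ by
    simp only [hΨ]
    rw [map_add, map_smul, perpProj_self h.1, perpProj_coe, smul_zero, add_zero]
  have hinn : ∀ p, inner ℝ e (Ψ p) = ψ p.1 + p.2 := fun p ↦ by
    simp only [hΨ]
    rw [inner_add_right, inner_smul_right, inner_perp, real_inner_self_eq_norm_sq, h.1]
    simp
  have hΨinj : Function.Injective Ψ := fun p q hpq ↦ by
    have h1 : p.1 = q.1 := by rw [← hproj p, hpq, hproj]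
    have h2 : ψ p.1 + p.2 = ψ q.1 + q.2 := by rw [← hinn p, hpq, hinn]
    rw [h1] at h2
    exact Prod.ext h1 (by linarith)
  have hΨe : MeasurableEmbedding Ψ := hΨc.measurableEmbedding hΨinj
  set w := perpProj e v with hw
  set c := inner ℝ e v with hc
  have hv : v = (w : E d) + c • e := by rw [hw, coe_perpProj h.1]; simp [hc]
  -- In flat coordinates the derivative of f along v is a horizontal derivative along w plus `b`
  -- times the derivative along e. The horizontal part integrates to zero over each slice of
  -- constant s; the other part integrates over s < 0 to the value on the graph.
  set b : Perp e → ℝ := fun y ↦ c - fderiv ℝ ψ y w with hb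
  have hbm : Measurable b := (measurable_fderiv_apply_const ℝ ψ w).const_sub c
  have hbb : ∀ y, ‖b y‖ ≤ |c| + K * ‖w‖ := fun y ↦ by
    refine (norm_sub_le _ _).trans (add_le_add le_rfl ?_)
    exact (ContinuousLinearMap.le_opNorm _ _).trans (by
      gcongr; exact norm_fderiv_le_of_lipschitz ℝ hψ)
  set T : Perp e × ℝ → ℝ := fun p ↦ fderiv ℝ f (Ψ p) v with hT
  set D : Perp e × ℝ → ℝ := fun p ↦ fderiv ℝ f (Ψ p) e with hD
  have hTi : Integrable T volume :=
    hΨm.integrable_comp_of_integrable (integrable_fderiv_apply hf hfc v)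
  have hDi : Integrable D volume :=
    hΨm.integrable_comp_of_integrable (integrable_fderiv_apply hf hfc e)
  have hbDi : Integrable (fun p ↦ b p.1 * D p) volume :=
    hDi.bdd_mul (hbm.comp measurable_fst).aestronglyMeasurable (.of_forall fun p ↦ hbb p.1)
  -- reduction to the half space
  have hsub : ∫ x in Ω, fderiv ℝ f x v = ∫ p in Set.univ ×ˢ Set.Iio 0, T p := by
    classical
    rw [← hΨm.setIntegral_preimage_emb hΨe, ← integral_indicator (hΨc.measurable hΩ),
      ← integral_indicator (MeasurableSet.univ.prod measurableSet_Iio)]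
    congr 1
    ext p
    by_cases hp : Ψ p ∈ tsupport f
    · have : p ∈ Ψ ⁻¹' Ω ↔ p ∈ (Set.univ ×ˢ Set.Iio 0 : Set (Perp e × ℝ)) := by
        rw [Set.mem_preimage, h.mem_iff _ (hfB hp), hproj, hinn]
        simp
      by_cases hp2 : p ∈ Ψ ⁻¹' Ω
      · rw [Set.indicator_of_mem hp2, Set.indicator_of_mem (this.1 hp2)]
      · rw [Set.indicator_of_notMem hp2, Set.indicator_of_notMem (fun h ↦ hp2 (this.2 h))]
    · have h0 : fderiv ℝ f (Ψ p) v = 0 := by rw [fderiv_of_notMem_tsupport ℝ hp]; simp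
      have h0' : T p = 0 := h0
      rw [Set.indicator_apply, Set.indicator_apply, h0, h0', ite_self, ite_self]
  -- Rademacher holds for f and ψ in their own variables; it transfers to the flat coordinates
  -- because `Ψ` and the first projection pull null sets back to null sets.
  have hdiff : ∀ᵐ p : Perp e × ℝ, DifferentiableAt ℝ f (Ψ p) ∧ DifferentiableAt ℝ ψ p.1 := by
    refine (hΨm.quasiMeasurePreserving.ae hf.ae_differentiableAt).and ?_
    exact (Measure.quasiMeasurePreserving_fst (μ := (volume : Measure (Perp e)))
      (ν := (volume : Measure ℝ))).ae hψ.ae_differentiableAt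
  obtain ⟨R, hR⟩ := hfc.isCompact.isBounded.exists_norm_le
  have hcomp1 : ∀ s, HasCompactSupport fun y ↦ f (Ψ (y, s)) := fun s ↦ by
    refine HasCompactSupport.intro (hfc.isCompact.image (perpProj e).continuous) fun y hy ↦ ?_
    by_contra h0
    refine hy ⟨Ψ (y, s), subset_tsupport _ h0, hproj _⟩
  have hcomp2 : ∀ y, HasCompactSupport fun s ↦ f (Ψ (y, s)) := fun y ↦ by
    refine HasCompactSupport.intro (K := (fun x ↦ inner ℝ e x - ψ y) '' tsupport f)
      (hfc.isCompact.image (by fun_prop)) fun s hs ↦ ?_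
    by_contra h0
    refine hs ⟨Ψ (y, s), subset_tsupport _ h0, ?_⟩
    simp only [hinn]; ring
  have hlip1 : ∀ s, LipschitzWith (C * (1 + K)) fun y ↦ f (Ψ (y, s)) := fun s ↦ by
    have h1 : LipschitzWith K fun y ↦ ψ y + s := LipschitzWith.of_dist_le_mul fun x y ↦ by
      rw [dist_add_right]; exact hψ.dist_le_mul x y
    exact hf.comp (lipschitzWith_graphMap h.1 h1)
  have hlip2 : ∀ y, LipschitzWith (C * 1) fun s ↦ f (Ψ (y, s)) := fun y ↦ by
    refine hf.comp (LipschitzWith.of_dist_le_mul fun s t ↦ ?_)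
    simp only [hΨ]
    rw [dist_add_left, dist_eq_norm, ← sub_smul, norm_smul, h.1, dist_eq_norm]
    simp
  -- chain rule
  have hA : ∀ᵐ p : Perp e × ℝ, T p - b p.1 * D p =
      fderiv ℝ (fun y ↦ f (Ψ (y, p.2))) p.1 w := by
    filter_upwards [hdiff] with p hp
    have h1 : HasFDerivAt (fun y ↦ Ψ (y, p.2))
        ((Perp e).subtypeL + (fderiv ℝ ψ p.1).smulRight e) p.1 :=
      ((Perp e).subtypeL.hasFDerivAt).add ((hp.2.hasFDerivAt.add_const p.2).smul_const e)
    have h2 : HasFDerivAt f (fderiv ℝ f (Ψ p)) (Ψ (p.1, p.2)) := hp.1.hasFDerivAt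
    have h3 := h2.comp p.1 h1
    have h4 : fderiv ℝ (fun y ↦ f (Ψ (y, p.2))) p.1 = _ := h3.fderiv
    rw [h4, ContinuousLinearMap.comp_apply]
    change fderiv ℝ f (Ψ p) v - b p.1 * fderiv ℝ f (Ψ p) e =
      fderiv ℝ f (Ψ p) ((w : E d) + (fderiv ℝ ψ p.1 w) • e)
    conv_lhs => rw [hv]
    simp only [map_add, map_smul, smul_eq_mul, hb]
    ring
  have hDd : ∀ᵐ p : Perp e × ℝ, D p = deriv (fun s ↦ f (Ψ (p.1, s))) p.2 := by
    filter_upwards [hdiff] with p hp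
    have h1 : HasDerivAt (fun s ↦ Ψ (p.1, s)) ((1 : ℝ) • e) p.2 :=
      (((hasDerivAt_id p.2).const_add (ψ p.1)).smul_const e).const_add (p.1 : E d)
    have h2 : HasFDerivAt f (fderiv ℝ f (Ψ p)) (Ψ (p.1, p.2)) := hp.1.hasFDerivAt
    have h3 := h2.comp_hasDerivAt p.2 h1
    have h4 : deriv (fun s ↦ f (Ψ (p.1, s))) p.2 = _ := h3.deriv
    rw [h4, one_smul]
  have hprod : (volume : Measure (Perp e × ℝ)).restrict (Set.univ ×ˢ Set.Iio 0) =
      (volume : Measure (Perp e)).prod (volume.restrict (Set.Iio (0 : ℝ))) := by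
    rw [Measure.volume_eq_prod, ← Measure.prod_restrict, Measure.restrict_univ]
  have hac : ((volume : Measure (Perp e)).prod (volume.restrict (Set.Iio (0 : ℝ)))) ≪
      (volume : Measure (Perp e × ℝ)) := by
    rw [← hprod]; exact Measure.absolutelyContinuous_of_le Measure.restrict_le_self
  have i1 : Integrable (fun p ↦ T p - b p.1 * D p)
      ((volume : Measure (Perp e)).prod (volume.restrict (Set.Iio (0 : ℝ)))) := by
    rw [← hprod]; exact (hTi.sub hbDi).integrableOn
  have i2 : Integrable (fun p ↦ b p.1 * D p)
      ((volume : Measure (Perp e)).prod (volume.restrict (Set.Iio (0 : ℝ)))) := by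
    rw [← hprod]; exact hbDi.integrableOn
  have z1 : ∫ p, (T p - b p.1 * D p)
      ∂((volume : Measure (Perp e)).prod (volume.restrict (Set.Iio (0 : ℝ)))) = 0 := by
    rw [integral_prod_symm _ i1]
    have hA' := Measure.ae_ae_of_ae_prod
      (Measure.measurePreserving_swap (μ := (volume.restrict (Set.Iio (0 : ℝ))))
        (ν := (volume : Measure (Perp e))) |>.quasiMeasurePreserving.ae (hac.ae_le hA))
    refine integral_eq_zero_of_ae ?_
    filter_upwards [hA'] with s hs
    simp only [Prod.swap_prod_mk] at hs
    rw [integral_congr_ae hs]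
    exact integral_fderiv_apply_eq_zero (hlip1 s) (hcomp1 s) w
  have z2 : ∫ p, b p.1 * D p
      ∂((volume : Measure (Perp e)).prod (volume.restrict (Set.Iio (0 : ℝ)))) =
      ∫ y, b y * f (graphMap e ψ y) := by
    rw [integral_prod _ i2]
    refine integral_congr_ae ?_
    filter_upwards [Measure.ae_ae_of_ae_prod (hac.ae_le hDd)] with y hy
    rw [integral_const_mul, integral_congr_ae hy, ← integral_Iic_eq_integral_Iio,
      setIntegral_Iic_deriv (hlip2 y) (hcomp2 y)]
    simp [hΨ, graphMap]
  rw [hsub, hprod, ← z2, ← sub_eq_zero, ← integral_sub _ i2, z1]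
  rw [← hprod]; exact hTi.integrableOn

theorem GraphChart.divergence {Ω : Set (E d)} {e : E d} {ψ : Perp e → ℝ} {K : ℝ≥0}
    {B : Set (E d)} (h : GraphChart Ω e ψ K B) (hΩ : MeasurableSet Ω) {f : E d → ℝ} {C : ℝ≥0}
    (hf : LipschitzWith C f) (hfc : HasCompactSupport f) (hfB : tsupport f ⊆ B) (v : E d) :
    ∫ x in Ω, fderiv ℝ f x v = ∫ x, f x * inner ℝ v (outerNormal Ω x) ∂surf Ω := by
  have hB := (continuous_graphMap (e := e) h.lipschitz.continuous).measurable
    h.isOpen.measurableSet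
  have hz : ∀ x, x ∉ B → f x = 0 := fun x hx ↦
    image_eq_zero_of_notMem_tsupport fun h' ↦ hx (hfB h')
  rw [h.setIntegral_fderiv_eq hΩ hf hfc hfB,
    ← setIntegral_eq_integral_of_forall_compl_eq_zero (s := B)
      (fun x hx ↦ by rw [hz x hx, zero_mul]), h.setIntegral_surf,
    ← setIntegral_eq_integral_of_forall_compl_eq_zero (s := graphMap e ψ ⁻¹' B)
      (fun y hy ↦ by rw [hz _ hy, mul_zero])]
  refine setIntegral_congr_ae hB ?_
  filter_upwards [h.ae_outerNormal_graphMap] with y hy hyB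
  rw [hy hyB, mul_left_comm, surfaceElement_mul_inner_graphNormal, mul_comm]

end LocalGreen


/-! ### Partition of unity and the divergence theorem on Ω. -/

section GlobalGreen

open scoped Manifold

/-- A function localised either in the interior of `Ω` or in a boundary chart. -/
def IsLocalized (Ω : Set (E d)) (χ : E d → ℝ) : Prop :=
  tsupport χ ⊆ Ω ∨ ∃ (e : E d) (ψ : Perp e → ℝ) (K : ℝ≥0) (B : Set (E d)),
    GraphChart Ω e ψ K B ∧ tsupport χ ⊆ B

theorem IsLipschitzDomain.isCompact_closure {Ω : Set (E d)} (hΩ : IsLipschitzDomain Ω) :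
    IsCompact (closure Ω) := hΩ.2.1.isCompact_closure

theorem IsLipschitzDomain.isCompact_frontier {Ω : Set (E d)} (hΩ : IsLipschitzDomain Ω) :
    IsCompact (frontier Ω) := hΩ.isCompact_closure.of_isClosed_subset isClosed_frontier
      frontier_subset_closure

/-- Boundary points are covered by chart balls, and Ω itself serves as the neighbourhood of every
interior point. All these sets are bounded, hence the supports are compact. -/
theorem IsLipschitzDomain.exists_partition {Ω : Set (E d)} (hΩ : IsLipschitzDomain Ω) :
    ∃ (ι : Type) (_ : Fintype ι) (χ : ι → E d → ℝ), (∀ i, ContDiff ℝ ∞ (χ i)) ∧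
      (∀ i, HasCompactSupport (χ i)) ∧ (∀ i x, 0 ≤ χ i x) ∧
      (∀ x ∈ closure Ω, ∑ i, χ i x = 1) ∧ ∀ i, IsLocalized Ω (χ i) := by
  have hU : ∀ x ∈ closure Ω, ∃ U : Set (E d), x ∈ U ∧ IsOpen U ∧ Bornology.IsBounded U ∧
      (U = Ω ∨ ∃ (e : E d) (ψ : Perp e → ℝ) (K : ℝ≥0), GraphChart Ω e ψ K U) := by
    intro x hx
    by_cases hxf : x ∈ frontier Ω
    · obtain ⟨e, ψ, K, r, hr, h⟩ := hΩ.exists_graphChart hxf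
      exact ⟨Metric.ball x r, Metric.mem_ball_self hr, Metric.isOpen_ball, Metric.isBounded_ball,
        Or.inr ⟨e, ψ, K, h⟩⟩
    · have : x ∈ Ω := by
        by_contra h
        exact hxf ⟨hx, fun hi ↦ h (interior_subset hi)⟩
      exact ⟨Ω, this, hΩ.1, hΩ.2.1, Or.inl rfl⟩
  choose! U hxU hUo hUb hUc using hU
  obtain ⟨t, ht, hcov⟩ := hΩ.isCompact_closure.elim_nhds_subcover U
    fun x hx ↦ (hUo x hx).mem_nhds (hxU x hx)
  obtain ⟨f, hf⟩ := SmoothPartitionOfUnity.exists_isSubordinate 𝓘(ℝ, E d)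
    (isClosed_closure (s := Ω)) (fun i : t ↦ U i) (fun i ↦ hUo _ (ht i i.2)) (by
      refine hcov.trans fun x hx ↦ ?_
      obtain ⟨y, hy, hxy⟩ := Set.mem_iUnion₂.1 hx
      exact Set.mem_iUnion.2 ⟨⟨y, hy⟩, hxy⟩)
  let eqv := t.equivFin
  refine ⟨Fin t.card, inferInstance, fun i ↦ f (eqv.symm i), fun i ↦ (f _).contMDiff.contDiff,
    fun i ↦ ?_, fun i x ↦ f.nonneg _ x, fun x hx ↦ ?_, fun i ↦ ?_⟩
  · exact Metric.isCompact_of_isClosed_isBounded (isClosed_tsupport _)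
      ((hUb _ (ht _ (eqv.symm i).2)).subset (hf _))
  · rw [← f.sum_eq_one hx, finsum_eq_sum_of_fintype]
    exact eqv.symm.sum_comp fun i ↦ f i x
  · rcases hUc _ (ht _ (eqv.symm i).2) with h | ⟨e, ψ, K, h⟩
    · exact Or.inl ((hf _).trans h.le)
    · exact Or.inr ⟨e, ψ, K, _, h, hf _⟩

/-- The boundary is covered by finitely many bounded charts. -/
theorem IsLipschitzDomain.exists_chart_cover {Ω : Set (E d)} (hΩ : IsLipschitzDomain Ω) :
    ∃ (ι : Type) (_ : Fintype ι) (B : ι → Set (E d)), frontier Ω ⊆ ⋃ i, B i ∧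
      ∀ i, Bornology.IsBounded (B i) ∧
        ∃ (e : E d) (ψ : Perp e → ℝ) (K : ℝ≥0), GraphChart Ω e ψ K (B i) := by
  have hU : ∀ x ∈ frontier Ω, ∃ U : Set (E d), U ∈ 𝓝 x ∧ Bornology.IsBounded U ∧
      ∃ (e : E d) (ψ : Perp e → ℝ) (K : ℝ≥0), GraphChart Ω e ψ K U := by
    intro x hx
    obtain ⟨e, ψ, K, r, hr, h⟩ := hΩ.exists_graphChart hx
    exact ⟨Metric.ball x r, Metric.ball_mem_nhds x hr, Metric.isBounded_ball, e, ψ, K, h⟩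
  choose! U hxU hUb hUc using hU
  obtain ⟨t, ht, hcov⟩ := hΩ.isCompact_frontier.elim_nhds_subcover U hxU
  let eqv := t.equivFin
  refine ⟨Fin t.card, inferInstance, fun i ↦ U (eqv.symm i), fun x hx ↦ ?_, fun i ↦
    ⟨hUb _ (ht _ (eqv.symm i).2), hUc _ (ht _ (eqv.symm i).2)⟩⟩
  obtain ⟨y, hy, hxy⟩ := Set.mem_iUnion₂.1 (hcov hx)
  exact Set.mem_iUnion.2 ⟨eqv ⟨y, hy⟩, by simpa using hxy⟩

theorem surf_restrict_eq_self {Ω B : Set (E d)} (h : frontier Ω ⊆ B) :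
    (surf Ω).restrict B = surf Ω := by
  refine Measure.restrict_eq_self_of_ae_mem ?_
  filter_upwards [ae_restrict_mem isClosed_frontier.measurableSet] with x hx
  exact h hx

theorem ae_surf_mem_frontier (Ω : Set (E d)) : ∀ᵐ x ∂surf Ω, x ∈ frontier Ω :=
  ae_restrict_mem isClosed_frontier.measurableSet

theorem IsLipschitzDomain.isFiniteMeasure_surf {Ω : Set (E d)} (hΩ : IsLipschitzDomain Ω) :
    IsFiniteMeasure (surf Ω) := by
  obtain ⟨ι, _, B, hcov, hB⟩ := hΩ.exists_chart_cover
  refine ⟨?_⟩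
  rw [← surf_restrict_eq_self hcov, Measure.restrict_apply_univ]
  refine (measure_iUnion_le _).trans_lt ?_
  rw [tsum_fintype]
  refine ENNReal.sum_lt_top.2 fun i _ ↦ ?_
  obtain ⟨hb, e, ψ, K, h⟩ := hB i
  exact h.surf_lt_top hb

theorem IsLipschitzDomain.ae_isOuterNormal {Ω : Set (E d)} (hΩ : IsLipschitzDomain Ω) :
    ∀ᵐ x ∂surf Ω, IsOuterNormal Ω x (outerNormal Ω x) := by
  obtain ⟨ι, _, B, hcov, hB⟩ := hΩ.exists_chart_cover
  rw [← surf_restrict_eq_self hcov, ae_restrict_iUnion_iff]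
  intro i
  obtain ⟨hb, e, ψ, K, h⟩ := hB i
  exact h.ae_isOuterNormal

theorem IsLipschitzDomain.aemeasurable_outerNormal {Ω : Set (E d)} (hΩ : IsLipschitzDomain Ω) :
    AEMeasurable (outerNormal Ω) (surf Ω) := by
  obtain ⟨ι, _, B, hcov, hB⟩ := hΩ.exists_chart_cover
  rw [← surf_restrict_eq_self hcov, aemeasurable_iUnion_iff]
  intro i
  obtain ⟨hb, e, ψ, K, h⟩ := hB i
  exact h.aemeasurable_outerNormal

theorem norm_outerNormal_le (Ω : Set (E d)) (x : E d) : ‖outerNormal Ω x‖ ≤ 1 := by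
  by_cases h : ∃ n, IsOuterNormal Ω x n
  · rw [outerNormal, dif_pos h, h.choose_spec.1]
  · rw [outerNormal, dif_neg h]; simp

/-- The factor f may be unbounded, but if the difference of products is nonzero, one of the two
points lies in the compact support of χ. Expanding the difference so that f is evaluated only there
gives the constant. -/
theorem exists_lipschitzWith_mul {F : Type*} [NormedAddCommGroup F] {χ f : F → ℝ} {L C : ℝ≥0}
    (hχ : LipschitzWith L χ) (hχc : HasCompactSupport χ) (hf : LipschitzWith C f) :
    ∃ C', LipschitzWith C' fun x ↦ χ x * f x := by
  obtain ⟨M, hM⟩ := hχc.isCompact.exists_bound_of_continuousOn hf.continuous.continuousOn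
  obtain ⟨N, hN⟩ := hχ.continuous.bounded_above_of_compact_support hχc
  have key : ∀ x y, x ∈ tsupport χ →
      dist (χ x * f x) (χ y * f y) ≤ (L * |M| + |N| * C) * dist x y := by
    intro x y hx
    have h1 := hχ.dist_le_mul x y
    have h2 := hf.dist_le_mul x y
    have h3 := (hM x hx).trans (le_abs_self M)
    have h4 := (hN y).trans (le_abs_self N)
    rw [Real.dist_eq] at h1 h2 ⊢
    rw [Real.norm_eq_abs] at h3 h4
    calc |χ x * f x - χ y * f y| = |(χ x - χ y) * f x + χ y * (f x - f y)| := by ring_nf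
      _ ≤ |χ x - χ y| * |f x| + |χ y| * |f x - f y| := by
        rw [← abs_mul, ← abs_mul]; exact abs_add_le _ _
      _ ≤ (L * dist x y) * |M| + |N| * (C * dist x y) := by gcongr
      _ = _ := by ring
  refine ⟨L * ⟨|M|, abs_nonneg M⟩ + ⟨|N|, abs_nonneg N⟩ * C,
    LipschitzWith.of_dist_le_mul fun x y ↦ ?_⟩
  push_cast
  by_cases hx : x ∈ tsupport χ
  · exact key x y hx
  by_cases hy : y ∈ tsupport χ
  · rw [dist_comm, dist_comm x]; exact key y x hy
  · rw [image_eq_zero_of_notMem_tsupport hx, image_eq_zero_of_notMem_tsupport hy]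
    simp only [zero_mul, dist_self]
    change 0 ≤ ((L : ℝ) * |M| + |N| * C) * dist x y
    positivity

theorem integrable_surf_of_bound {Ω : Set (E d)} (hΩ : IsLipschitzDomain Ω) {F : E d → ℝ}
    (hF : AEStronglyMeasurable F (surf Ω)) {M : ℝ} (hM : ∀ x ∈ frontier Ω, ‖F x‖ ≤ M) :
    Integrable F (surf Ω) := by
  have := hΩ.isFiniteMeasure_surf
  refine Integrable.of_bound hF M ?_
  filter_upwards [ae_surf_mem_frontier Ω] with x hx using hM x hx

theorem IsLipschitzDomain.integrable_mul_inner_outerNormal {Ω : Set (E d)}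
    (hΩ : IsLipschitzDomain Ω) {f : E d → ℝ} (hf : Continuous f) (v : E d) :
    Integrable (fun x ↦ f x * inner ℝ v (outerNormal Ω x)) (surf Ω) := by
  obtain ⟨M, hM⟩ := hΩ.isCompact_frontier.exists_bound_of_continuousOn hf.continuousOn
  refine integrable_surf_of_bound hΩ ?_ (M := M * ‖v‖) fun x hx ↦ ?_
  · exact hf.aestronglyMeasurable.mul
      (hΩ.aemeasurable_outerNormal.const_inner (c := v)).aestronglyMeasurable
  · rw [norm_mul]
    refine mul_le_mul (hM x hx) ?_ (norm_nonneg _) ((norm_nonneg _).trans (hM x hx))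
    refine (norm_inner_le_norm _ _).trans ?_
    exact mul_le_of_le_one_right (norm_nonneg _) (norm_outerNormal_le Ω x)

/-- In the interior case both sides vanish; otherwise the chart version applies. -/
theorem IsLocalized.divergence {Ω : Set (E d)} (hΩ : IsLipschitzDomain Ω) {χ f : E d → ℝ}
    (hχ : IsLocalized Ω χ) (hχf : tsupport f ⊆ tsupport χ) {C : ℝ≥0}
    (hf : LipschitzWith C f) (hfc : HasCompactSupport f) (v : E d) :
    ∫ x in Ω, fderiv ℝ f x v = ∫ x, f x * inner ℝ v (outerNormal Ω x) ∂surf Ω := by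
  rcases hχ with h | ⟨e, ψ, K, B, h, hB⟩
  · rw [setIntegral_eq_integral_of_forall_compl_eq_zero, integral_fderiv_apply_eq_zero hf hfc]
    · symm
      refine integral_eq_zero_of_ae ?_
      filter_upwards [ae_surf_mem_frontier Ω] with x hx
      have : x ∉ tsupport f := fun h' ↦ hx.2 (by rw [hΩ.1.interior_eq]; exact h (hχf h'))
      simp [image_eq_zero_of_notMem_tsupport this]
    · intro x hx
      rw [fderiv_of_notMem_tsupport ℝ fun h' ↦ hx (h (hχf h'))]
      simp
  · exact h.divergence hΩ.1.measurableSet hf hfc (hχf.trans hB) v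

theorem exists_lipschitzWith_of_contDiff {F : Type*} [NormedAddCommGroup F] [NormedSpace ℝ F]
    {χ : F → ℝ} (h : ContDiff ℝ 1 χ) (hc : HasCompactSupport χ) : ∃ L, LipschitzWith L χ :=
  h.lipschitzWith_of_hasCompactSupport hc (by simp)

/-- The divergence theorem on a Lipschitz domain, for Lipschitz functions. -/
theorem IsLipschitzDomain.divergence {Ω : Set (E d)} (hΩ : IsLipschitzDomain Ω) {f : E d → ℝ}
    {C : ℝ≥0} (hf : LipschitzWith C f) (v : E d) :
    ∫ x in Ω, fderiv ℝ f x v = ∫ x, f x * inner ℝ v (outerNormal Ω x) ∂surf Ω := by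
  obtain ⟨ι, _, χ, hχs, hχc, -, hχ1, hχl⟩ := hΩ.exists_partition
  have hlip : ∀ i, ∃ C', LipschitzWith C' fun x ↦ χ i x * f x := fun i ↦ by
    obtain ⟨L, hL⟩ := exists_lipschitzWith_of_contDiff ((hχs i).of_le (by simp)) (hχc i)
    exact exists_lipschitzWith_mul hL (hχc i) hf
  choose C' hC' using hlip
  have hcs : ∀ i, HasCompactSupport fun x ↦ χ i x * f x := fun i ↦ (hχc i).mul_right
  have e1 : ∫ x in Ω, fderiv ℝ f x v =
      ∑ i, ∫ x in Ω, fderiv ℝ (fun x ↦ χ i x * f x) x v := by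
    rw [← integral_finsetSum _ fun i _ ↦
      (integrable_fderiv_apply (hC' i) (hcs i) v).integrableOn]
    refine setIntegral_congr_ae hΩ.1.measurableSet ?_
    filter_upwards [hf.ae_differentiableAt] with x hx hxΩ
    -- The decomposition holds in a whole neighbourhood of x, so derivatives may be compared
    -- directly and the gradients of the cut-offs never appear.
    have h1 : f =ᶠ[𝓝 x] fun y ↦ ∑ i, χ i y * f y := by
      filter_upwards [hΩ.1.mem_nhds hxΩ] with y hy
      rw [← Finset.sum_mul, hχ1 y (subset_closure hy), one_mul]
    rw [h1.fderiv_eq, fderiv_fun_sum (A := fun i y ↦ χ i y * f y) fun i _ ↦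
      (((hχs i).differentiable (by simp)).differentiableAt.mul hx)]
    simp
  have e2 : ∫ x, f x * inner ℝ v (outerNormal Ω x) ∂surf Ω =
      ∑ i, ∫ x, (χ i x * f x) * inner ℝ v (outerNormal Ω x) ∂surf Ω := by
    rw [← integral_finsetSum _ fun i _ ↦
      hΩ.integrable_mul_inner_outerNormal (hC' i).continuous v]
    refine integral_congr_ae ?_
    filter_upwards [ae_surf_mem_frontier Ω] with x hx
    rw [← Finset.sum_mul, ← Finset.sum_mul, hχ1 x (frontier_subset_closure hx), one_mul]
  rw [e1, e2]
  exact Finset.sum_congr rfl fun i _ ↦ (hχl i).divergence hΩ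
    (tsupport_mul_subset_left) (hC' i) (hcs i) v

end GlobalGreen


/-! ### Mollification in L² and weak gradients. -/

section Mollification

open ContinuousLinearMap

theorem sq_eLpNorm_two {α F : Type*} [MeasurableSpace α] [NormedAddCommGroup F] (f : α → F)
    (μ : Measure α) : eLpNorm f 2 μ ^ 2 = ∫⁻ x, ‖f x‖ₑ ^ 2 ∂μ := by
  have := eLpNorm_nnreal_pow_eq_lintegral (μ := μ) (f := f) (p := 2) (by norm_num)
  simpa using this

/-- The error η∗H - H is the average of the translation errors of H under the probability measure η
dz. Bounding the L¹ norm by the L² norm for this measure and applying Tonelli moves the estimate to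
single translations. The kernel need not be centred at the origin, which matters near the boundary.
-/
theorem eLpNorm_convolution_sub_le_of_stronglyMeasurable {X F : Type*} [NormedAddCommGroup X]
    [NormedSpace ℝ X] [FiniteDimensional ℝ X] [MeasurableSpace X] [BorelSpace X]
    {μ : Measure X} [μ.IsAddHaarMeasure] [NormedAddCommGroup F] [NormedSpace ℝ F]
    [CompleteSpace F] {η : X → ℝ} (hηc : Continuous η) (hηs : HasCompactSupport η)
    (hη0 : ∀ x, 0 ≤ η x) (hη1 : ∫ x, η x ∂μ = 1) {H : X → F} (hHm : StronglyMeasurable H)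
    (hH : MemLp H 2 μ) {ε : ℝ≥0∞}
    (hε : ∀ z ∈ tsupport η, eLpNorm (fun x ↦ H (x - z) - H x) 2 μ ≤ ε) :
    eLpNorm (fun x ↦ convolution η H (lsmul ℝ ℝ) μ x - H x) 2 μ ≤ ε := by
  have hηi : Integrable η μ := hηc.integrable_of_hasCompactSupport hηs
  set ν := μ.withDensity fun z ↦ ENNReal.ofReal (η z) with hν
  have hνp : IsProbabilityMeasure ν := ⟨by
    rw [hν, withDensity_apply _ MeasurableSet.univ, Measure.restrict_univ,
      ← ofReal_integral_eq_lintegral_ofReal hηi (.of_forall hη0), hη1, ENNReal.ofReal_one]⟩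
  have hηm : Measurable fun z ↦ ENNReal.ofReal (η z) := hηc.measurable.ennreal_ofReal
  have hm2 : StronglyMeasurable fun p : X × X ↦ H (p.1 - p.2) - H p.1 :=
    (hHm.comp_measurable (by fun_prop)).sub (hHm.comp_measurable measurable_fst)
  have hpt : ∀ x, ‖convolution η H (lsmul ℝ ℝ) μ x - H x‖ₑ ^ 2 ≤
      ∫⁻ z, ‖H (x - z) - H x‖ₑ ^ 2 ∂ν := by
    intro x
    have hmx : StronglyMeasurable fun z ↦ H (x - z) - H x :=
      hm2.comp_measurable (measurable_const.prodMk measurable_id)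
    have e1 : convolution η H (lsmul ℝ ℝ) μ x - H x = ∫ z, η z • (H (x - z) - H x) ∂μ := by
      have hce : ConvolutionExistsAt η H x (lsmul ℝ ℝ) μ :=
        hηs.convolutionExists_left _ hηc (hH.locallyIntegrable (by norm_num)) x
      have h1 : Integrable (fun z ↦ η z • H (x - z)) μ := by
        simpa [ConvolutionExistsAt] using hce
      simp_rw [smul_sub]
      rw [integral_sub h1 (hηi.smul_const _), integral_smul_const, hη1, one_smul]
      simp [convolution]
    have e2 : ‖convolution η H (lsmul ℝ ℝ) μ x - H x‖ₑ ≤ eLpNorm (fun z ↦ H (x - z) - H x) 1 ν := by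
      rw [e1, eLpNorm_one_eq_lintegral_enorm, hν,
        lintegral_withDensity_eq_lintegral_mul _ hηm hmx.enorm]
      refine (enorm_integral_le_lintegral_enorm _).trans (lintegral_mono fun z ↦ ?_)
      rw [enorm_smul, Pi.mul_apply, Real.enorm_of_nonneg (hη0 z)]
    rw [← sq_eLpNorm_two (fun z ↦ H (x - z) - H x) ν]
    gcongr
    exact e2.trans (eLpNorm_le_eLpNorm_of_exponent_le (by norm_num) hmx.aestronglyMeasurable)
  have hsq : eLpNorm (fun x ↦ convolution η H (lsmul ℝ ℝ) μ x - H x) 2 μ ^ 2 ≤ ε ^ 2 := by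
    rw [sq_eLpNorm_two]
    calc _ ≤ ∫⁻ x, ∫⁻ z, ‖H (x - z) - H x‖ₑ ^ 2 ∂ν ∂μ := lintegral_mono hpt
      _ = ∫⁻ z, ∫⁻ x, ‖H (x - z) - H x‖ₑ ^ 2 ∂μ ∂ν :=
        lintegral_lintegral_swap (hm2.enorm.pow_const 2).aemeasurable
      _ = ∫⁻ z, ENNReal.ofReal (η z) * ∫⁻ x, ‖H (x - z) - H x‖ₑ ^ 2 ∂μ ∂μ := by
        rw [hν, lintegral_withDensity_eq_lintegral_mul _ hηm
          (hm2.enorm.pow_const 2).lintegral_prod_left']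
        rfl
      _ ≤ ∫⁻ z, ENNReal.ofReal (η z) * ε ^ 2 ∂μ := by
        refine lintegral_mono fun z ↦ ?_
        by_cases hz : z ∈ tsupport η
        · rw [← sq_eLpNorm_two (fun x ↦ H (x - z) - H x) μ]
          gcongr
          exact hε z hz
        · simp [image_eq_zero_of_notMem_tsupport hz]
      _ = ε ^ 2 := by
        rw [lintegral_mul_const _ hηm,
          ← ofReal_integral_eq_lintegral_ofReal hηi (.of_forall hη0), hη1, ENNReal.ofReal_one,
          one_mul]
  exact (ENNReal.pow_le_pow_left_iff two_ne_zero).1 hsq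

theorem eLpNorm_convolution_sub_le {X F : Type*} [NormedAddCommGroup X]
    [NormedSpace ℝ X] [FiniteDimensional ℝ X] [MeasurableSpace X] [BorelSpace X]
    {μ : Measure X} [μ.IsAddHaarMeasure] [NormedAddCommGroup F] [NormedSpace ℝ F]
    [CompleteSpace F] {η : X → ℝ} (hηc : Continuous η) (hηs : HasCompactSupport η)
    (hη0 : ∀ x, 0 ≤ η x) (hη1 : ∫ x, η x ∂μ = 1) {H : X → F}
    (hH : MemLp H 2 μ) {ε : ℝ≥0∞}
    (hε : ∀ z ∈ tsupport η, eLpNorm (fun x ↦ H (x - z) - H x) 2 μ ≤ ε) :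
    eLpNorm (fun x ↦ convolution η H (lsmul ℝ ℝ) μ x - H x) 2 μ ≤ ε := by
  have hae := hH.1.ae_eq_mk
  have h1 : convolution η H (lsmul ℝ ℝ) μ = convolution η (hH.1.mk H) (lsmul ℝ ℝ) μ :=
    convolution_congr _ (ae_eq_refl _) hae
  have h2 := eLpNorm_convolution_sub_le_of_stronglyMeasurable hηc hηs hη0 hη1
    hH.1.stronglyMeasurable_mk (hH.ae_eq hae) (ε := ε) fun z hz ↦ by
      refine le_of_eq_of_le (eLpNorm_congr_ae ?_) (hε z hz)
      have := (measurePreserving_sub_right μ z).quasiMeasurePreserving.ae_eq_comp hae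
      filter_upwards [this, hae] with x hx hx'
      rw [hx']
      simp only [Function.comp] at hx
      rw [hx]
  refine le_of_eq_of_le (eLpNorm_congr_ae ?_) h2
  filter_upwards [hae] with x hx
  rw [h1, ← hx]

/-- Continuity of translations in L², as an instance of the continuity of composition with a
continuous family of measure-preserving maps. -/
theorem tendsto_eLpNorm_translate_sub {X F : Type*} [NormedAddCommGroup X]
    [NormedSpace ℝ X] [FiniteDimensional ℝ X] [MeasurableSpace X] [BorelSpace X]
    {μ : Measure X} [μ.IsAddHaarMeasure] [NormedAddCommGroup F] {H : X → F} (hH : MemLp H 2 μ) :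
    Tendsto (fun z ↦ eLpNorm (fun x ↦ H (x - z) - H x) 2 μ) (𝓝 0) (𝓝 0) := by
  let g : C(X, C(X, X)) := ContinuousMap.curry ⟨fun p : X × X ↦ p.2 - p.1, by fun_prop⟩
  have hgm : ∀ z, MeasurePreserving (g z) μ μ := fun z ↦ measurePreserving_sub_right μ z
  have hc := Continuous.compMeasurePreservingLp (f := fun _ : X ↦ hH.toLp H) (g := g)
    continuous_const g.continuous hgm (p := 2) (by norm_num)
  have h1 := (hc.tendsto 0)
  rw [tendsto_iff_edist_tendsto_0] at h1
  refine h1.congr fun z ↦ ?_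
  rw [Lp.edist_def]
  refine eLpNorm_congr_ae ?_
  have h2 : ∀ z, ⇑((Lp.compMeasurePreserving (g z) (hgm z)) (hH.toLp H)) =ᵐ[μ]
      fun x ↦ H (x - z) := fun z ↦
    (Lp.coeFn_compMeasurePreserving _ (hgm z)).trans
      ((hgm z).quasiMeasurePreserving.ae_eq_comp hH.coeFn_toLp)
  filter_upwards [h2 z, h2 0] with x hx hx'
  rw [Pi.sub_apply, hx, hx', sub_zero]

theorem integrable_mul_of_hasCompactSupport {X : Type*} [TopologicalSpace X] [MeasurableSpace X]
    [OpensMeasurableSpace X] {μ : Measure X} {c w : X → ℝ}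
    (hc : Continuous c) (hcs : HasCompactSupport c) (hw : Integrable w μ) :
    Integrable (fun x ↦ c x * w x) μ := by
  obtain ⟨M, hM⟩ := hc.bounded_above_of_compact_support hcs
  exact hw.bdd_mul hc.measurable.aestronglyMeasurable (.of_forall hM)

/-- Mollifying a cut-off of a function with a weak gradient by a kernel that only reaches into
`Ω` commutes with taking gradients. -/
theorem fderiv_convolution_eq {Ω : Set (E d)} (hΩm : MeasurableSet Ω) {w : E d → ℝ}
    {G : E d → E d} (hwG : HasWeakGradient Ω w G) (hw : IntegrableOn w Ω)
    (hG : IntegrableOn G Ω) {χ η : E d → ℝ}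
    (hχ : ContDiff ℝ ∞ χ) (hχc : HasCompactSupport χ) (hη : ContDiff ℝ ∞ η)
    (hηc : HasCompactSupport η) {x : E d}
    (hx : ∀ z ∈ tsupport η, x - z ∈ tsupport χ → x - z ∈ Ω) (v : E d) :
    fderiv ℝ (convolution η (Ω.indicator fun y ↦ χ y * w y) (lsmul ℝ ℝ) volume) x v =
      inner ℝ v (convolution η (Ω.indicator fun y ↦ χ y • G y + w y • gradient χ y)
        (lsmul ℝ ℝ) volume x) := by
  have hχi : IntegrableOn (fun y ↦ χ y * w y) Ω :=
    integrable_mul_of_hasCompactSupport hχ.continuous hχc hw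
  have hW : Integrable (Ω.indicator fun y ↦ χ y * w y) := hχi.integrable_indicator hΩm
  have hη1 : ContDiff ℝ 1 η := hη.of_le (by simp)
  have hηd : Continuous (fderiv ℝ η) := hη.continuous_fderiv (by simp)
  have hχd : Continuous (fderiv ℝ χ) := hχ.continuous_fderiv (by simp)
  rw [(hηc.hasFDerivAt_convolution_left (lsmul ℝ ℝ) hη1 hW.locallyIntegrable x).fderiv]
  -- the left-hand side
  have hl : (convolution (fderiv ℝ η) (Ω.indicator fun y ↦ χ y * w y)
      (precompL (E d) (lsmul ℝ ℝ)) volume x) v =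
        ∫ y in Ω, fderiv ℝ η (x - y) v * χ y * w y := by
    have hce : ConvolutionExistsAt (fderiv ℝ η) (Ω.indicator fun y ↦ χ y * w y) x
        (precompL (E d) (lsmul ℝ ℝ)) volume :=
      (hηc.fderiv (𝕜 := ℝ)).convolutionExists_left _ hηd hW.locallyIntegrable x
    rw [convolution_eq_swap, ContinuousLinearMap.integral_apply hce.integrable_swap,
      ← integral_indicator hΩm]
    congr 1
    ext y
    rw [precompL_apply]
    by_cases hy : y ∈ Ω
    · simp [Set.indicator_of_mem hy, mul_assoc]
    · simp [Set.indicator_of_notMem hy]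
  have hGχ : IntegrableOn (fun y ↦ χ y • G y + w y • gradient χ y) Ω := by
    obtain ⟨M, hM⟩ := hχ.continuous.bounded_above_of_compact_support hχc
    obtain ⟨N, hN⟩ := hχd.bounded_above_of_compact_support (hχc.fderiv (𝕜 := ℝ))
    have i1 : IntegrableOn (fun y ↦ χ y • G y) Ω :=
      Integrable.bdd_smul hG M hχ.continuous.measurable.aestronglyMeasurable (.of_forall hM)
    have i2 : IntegrableOn (fun y ↦ w y • gradient χ y) Ω :=
      Integrable.smul_bdd hw N
        (measurable_gradient_of_continuous χ).aestronglyMeasurable (.of_forall fun y ↦ by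
          rw [gradient, LinearIsometryEquiv.norm_map]; exact hN y)
    exact i1.add i2
  have hηs : Continuous fun y ↦ η (x - y) := hη.continuous.comp (by fun_prop)
  have hηsc : HasCompactSupport fun y ↦ η (x - y) :=
    hηc.comp_homeomorph (Homeomorph.subLeft x)
  have hr : inner ℝ v (convolution η (Ω.indicator fun y ↦ χ y • G y + w y • gradient χ y)
      (lsmul ℝ ℝ) volume x) = ∫ y in Ω, (η (x - y) * χ y * inner ℝ v (G y) +
        η (x - y) * fderiv ℝ χ y v * w y) := by
    have hce : ConvolutionExistsAt η (Ω.indicator fun y ↦ χ y • G y + w y • gradient χ y) x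
        (lsmul ℝ ℝ) volume :=
      hηc.convolutionExists_left _ hη.continuous
        (hGχ.integrable_indicator hΩm).locallyIntegrable x
    rw [convolution_eq_swap, ← integral_inner hce.integrable_swap, ← integral_indicator hΩm]
    congr 1
    ext y
    by_cases hy : y ∈ Ω
    · simp only [Set.indicator_of_mem hy, lsmul_apply]
      rw [inner_smul_right, inner_add_right, inner_smul_right, inner_smul_right,
        real_inner_comm (gradient χ y) v, inner_gradient_eq]
      ring
    · simp [Set.indicator_of_notMem hy]
  rw [hl, hr]
  -- the test function
  set ζ : E d → ℝ := fun y ↦ η (x - y) * χ y with hζ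
  have hζs : ContDiff ℝ ∞ ζ := (hη.comp (contDiff_const.sub contDiff_id)).mul hχ
  have hζc : HasCompactSupport ζ := hχc.mul_left
  -- The support condition on the kernel is what makes `ζ` an admissible test function, although χ
  -- need not vanish on ∂Ω.
  have hζΩ : tsupport ζ ⊆ Ω := by
    intro y hy
    have h1 : y ∈ tsupport χ := tsupport_mul_subset_right hy
    have h2 : x - y ∈ tsupport η := by
      have : y ∈ tsupport (fun y ↦ η (x - y)) := tsupport_mul_subset_left hy
      have hpre : tsupport (η ∘ Homeomorph.subLeft x) ⊆ Homeomorph.subLeft x ⁻¹' tsupport η :=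
        closure_minimal (fun z hz ↦ subset_tsupport _ hz)
          ((isClosed_tsupport η).preimage (Homeomorph.subLeft x).continuous)
      exact hpre this
    have := hx _ h2
    simp only [sub_sub_cancel] at this
    exact this h1
  have hζd : ∀ y, fderiv ℝ ζ y v = η (x - y) * fderiv ℝ χ y v - fderiv ℝ η (x - y) v * χ y := by
    intro y
    have h1 : HasFDerivAt (fun y : E d ↦ x - y) (-(ContinuousLinearMap.id ℝ (E d))) y :=
      (hasFDerivAt_id y).const_sub x
    have h2 : HasFDerivAt (fun y ↦ η (x - y))
        ((fderiv ℝ η (x - y)).comp (-(ContinuousLinearMap.id ℝ (E d)))) y :=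
      ((hη.differentiable (by simp)).differentiableAt.hasFDerivAt).comp y h1
    have h3 := h2.mul ((hχ.differentiable (by simp)).differentiableAt (x := y)).hasFDerivAt
    have h4 : fderiv ℝ ζ y = _ := h3.fderiv
    rw [h4]
    simp
    ring
  have hweak := congrArg (inner ℝ v) (hwG.2.2 ζ hζs hζc hζΩ)
  have hζfd : Continuous (fderiv ℝ ζ) := hζs.continuous_fderiv (by simp)
  have j1 : IntegrableOn (fun y ↦ w y • gradient ζ y) Ω := by
    obtain ⟨N, hN⟩ := hζfd.bounded_above_of_compact_support (hζc.fderiv (𝕜 := ℝ))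
    exact Integrable.smul_bdd hw N
        (measurable_gradient_of_continuous ζ).aestronglyMeasurable (.of_forall fun y ↦ by
          rw [gradient, LinearIsometryEquiv.norm_map]; exact hN y)
  have j2 : IntegrableOn (fun y ↦ ζ y • G y) Ω := by
    obtain ⟨M, hM⟩ := hζs.continuous.bounded_above_of_compact_support hζc
    exact Integrable.bdd_smul hG M hζs.continuous.measurable.aestronglyMeasurable
      (.of_forall hM)
  rw [inner_neg_right, ← integral_inner j1, ← integral_inner j2] at hweak
  have k1 : ∀ y, inner ℝ v (w y • gradient ζ y) =
      η (x - y) * fderiv ℝ χ y v * w y - fderiv ℝ η (x - y) v * χ y * w y := fun y ↦ by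
    rw [inner_smul_right, real_inner_comm, inner_gradient_eq, hζd]; ring
  have k2 : ∀ y, inner ℝ v (ζ y • G y) = η (x - y) * χ y * inner ℝ v (G y) := fun y ↦ by
    rw [inner_smul_right]
  simp only [k1, k2] at hweak
  have m1 : IntegrableOn (fun y ↦ η (x - y) * fderiv ℝ χ y v * w y) Ω := by
    refine integrable_mul_of_hasCompactSupport ?_ hηsc.mul_right hw
    exact hηs.mul (hχd.clm_apply continuous_const)
  have m2 : IntegrableOn (fun y ↦ fderiv ℝ η (x - y) v * χ y * w y) Ω := by
    refine integrable_mul_of_hasCompactSupport ?_ hχc.mul_left hw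
    exact ((hηd.comp (by fun_prop)).clm_apply continuous_const).mul hχ.continuous
  have m3 : IntegrableOn (fun y ↦ η (x - y) * χ y * inner ℝ v (G y)) Ω := by
    refine integrable_mul_of_hasCompactSupport ?_ hχc.mul_left (hG.const_inner v)
    exact hηs.mul hχ.continuous
  rw [integral_sub m1 m2] at hweak
  rw [integral_add m3 m1]
  linarith

end Mollification


/-! ### Density of C¹ functions in H¹(Ω). -/

section Density

open ContinuousLinearMap

/-- In a chart the kernel is centred at t e rather than 0. The mollified function at x ∈ Ω then
samples points x - z pushed below the graph, by enough to compensate for the sideways displacement.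
-/
theorem IsLocalized.exists_bump {Ω : Set (E d)} {χ : E d → ℝ} (hχ : IsLocalized Ω χ)
    (hχc : HasCompactSupport χ) {ρ : ℝ} (hρ : 0 < ρ) :
    ∃ (c : E d) (f : ContDiffBump c), (∀ z ∈ Metric.closedBall c f.rOut, ‖z‖ < ρ) ∧
      ∀ z ∈ Metric.closedBall c f.rOut, ∀ x ∈ Ω, x - z ∈ tsupport χ → x - z ∈ Ω := by
  rcases hχ with h | ⟨e, ψ, K, B, h, hB⟩
  · refine ⟨0, ⟨ρ / 4, ρ / 2, by linarith, by linarith⟩, fun z hz ↦ ?_, fun z _ x _ hx ↦ h hx⟩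
    rw [mem_closedBall_zero_iff] at hz
    exact hz.trans_lt (by linarith)
  · obtain ⟨δ, hδ, hδB⟩ := hχc.isCompact.exists_thickening_subset_open h.isOpen hB
    set t := min ρ δ / 4 with ht
    have hm : 0 < min ρ δ := lt_min hρ hδ
    have ht0 : 0 < t := by positivity
    -- For z within tκ of t e, the descent is at least t - tκ and the graph falls by at most K t κ.
    -- These are equal for κ = 1/(K+1), and strictness comes from x ∈ Ω.
    set κ : ℝ := ((K : ℝ) + 1)⁻¹ with hκ
    have hK : (0 : ℝ) ≤ K := K.2
    have hκ0 : 0 < κ := by positivity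
    have hκ1 : κ ≤ 1 := inv_le_one_of_one_le₀ (by linarith)
    have hκK : (K + 1) * κ = 1 := mul_inv_cancel₀ (by positivity)
    have hnorm : ∀ z ∈ Metric.closedBall (t • e) (t * κ), ‖z‖ < min ρ δ := fun z hz ↦ by
      rw [mem_closedBall_iff_norm] at hz
      have h1 := norm_le_norm_sub_add z (t • e)
      rw [norm_smul, h.1, Real.norm_of_nonneg ht0.le, mul_one] at h1
      have : t * κ ≤ t := mul_le_of_le_one_right ht0.le hκ1
      linarith
    refine ⟨t • e, ⟨t * κ / 2, t * κ, by positivity, by linarith [mul_pos ht0 hκ0]⟩,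
      fun z hz ↦ (hnorm z hz).trans_le (min_le_left _ _), fun z hz x hx hxz ↦ ?_⟩
    have hxB : x ∈ B := by
      refine hδB (Metric.mem_thickening_iff.2 ⟨x - z, hxz, ?_⟩)
      rw [dist_eq_norm, sub_sub_cancel]
      exact (hnorm z hz).trans_le (min_le_right _ _)
    rw [h.mem_iff _ (hB hxz), inner_sub_right, map_sub]
    have hx' := (h.mem_iff _ hxB).1 hx
    change z ∈ Metric.closedBall (t • e) (t * κ) at hz
    rw [mem_closedBall_iff_norm] at hz
    have h1 : ‖perpProj e z‖ ≤ t * κ := by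
      have : perpProj e z = perpProj e (z - t • e) := by
        rw [map_sub, map_smul, perpProj_self h.1, smul_zero, sub_zero]
      rw [this]
      exact (norm_perpProj_le _).trans hz
    have h2 : t - t * κ ≤ inner ℝ e z := by
      have h3 : inner ℝ e z = t + inner ℝ e (z - t • e) := by
        rw [inner_sub_right, inner_smul_right, real_inner_self_eq_norm_sq, h.1]; ring
      have h4 := (abs_le.1 (abs_real_inner_le_norm e (z - t • e))).1
      rw [h.1, one_mul] at h4
      linarith
    have h5 := h.lipschitz.dist_le_mul (perpProj e x) (perpProj e x - perpProj e z)
    rw [Real.dist_eq, dist_eq_norm, sub_sub_cancel] at h5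
    have h6 := (abs_le.1 h5).2
    have h7 : (K : ℝ) * ‖perpProj e z‖ ≤ K * (t * κ) := by gcongr
    nlinarith

theorem MemLp.continuous_compact_mul {X : Type*} [TopologicalSpace X] [MeasurableSpace X]
    [OpensMeasurableSpace X] {μ : Measure X} {F : Type*} [NormedAddCommGroup F] [NormedSpace ℝ F]
    {c : X → ℝ} {w : X → F} {p : ℝ≥0∞}
    (hc : Continuous c) (hcs : HasCompactSupport c) (hw : MemLp w p μ) :
    MemLp (fun x ↦ c x • w x) p μ := by
  obtain ⟨M, hM⟩ := hc.bounded_above_of_compact_support hcs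
  refine hw.of_le_mul (c := M) (hc.measurable.aestronglyMeasurable.smul hw.1)
    (.of_forall fun x ↦ ?_)
  rw [norm_smul]
  gcongr
  exact hM x

theorem isFiniteMeasure_restrict {Ω : Set (E d)} (hΩ : Bornology.IsBounded Ω) :
    IsFiniteMeasure (volume.restrict Ω) :=
  ⟨by rw [Measure.restrict_apply_univ]; exact hΩ.measure_lt_top⟩

theorem norm_gradient_eq {F : Type*} [NormedAddCommGroup F] [InnerProductSpace ℝ F]
    [CompleteSpace F] (f : F → ℝ) (x : F) : ‖gradient f x‖ = ‖fderiv ℝ f x‖ := by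
  rw [gradient, LinearIsometryEquiv.norm_map]

theorem continuous_gradient {F : Type*} [NormedAddCommGroup F] [InnerProductSpace ℝ F]
    [CompleteSpace F] {f : F → ℝ} (hf : ContDiff ℝ 1 f) : Continuous (gradient f) :=
  (InnerProductSpace.toDual ℝ F).symm.continuous.comp (hf.continuous_fderiv (by simp))

/-- The extensions by zero of χw and of its product-rule gradient are mollified with the same
kernel. The jump across ∂Ω does no harm: at points of Ω the kernel sees the cut-off function only
inside Ω, so mollification commutes with the gradient there. -/
theorem IsLocalized.exists_approx {Ω : Set (E d)} (hΩ : IsOpen Ω) (hΩb : Bornology.IsBounded Ω)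
    {χ : E d → ℝ} (hχl : IsLocalized Ω χ) (hχ : ContDiff ℝ ∞ χ) (hχc : HasCompactSupport χ)
    {w : E d → ℝ} {G : E d → E d} (hwG : HasWeakGradient Ω w G)
    (hw : MemLp w 2 (volume.restrict Ω)) (hG : MemLp G 2 (volume.restrict Ω)) {ε : ℝ≥0∞}
    (hε : ε ≠ 0) :
    ∃ φ : E d → ℝ, ContDiff ℝ 1 φ ∧
      eLpNorm (fun x ↦ φ x - χ x * w x) 2 (volume.restrict Ω) ≤ ε ∧
      eLpNorm (fun x ↦ gradient φ x - (χ x • G x + w x • gradient χ x)) 2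
        (volume.restrict Ω) ≤ ε := by
  have hfin := isFiniteMeasure_restrict hΩb
  have hΩm := hΩ.measurableSet
  set W := Ω.indicator fun y ↦ χ y * w y with hWdef
  set H := Ω.indicator fun y ↦ χ y • G y + w y • gradient χ y with hHdef
  have hW : MemLp W 2 volume :=
    (memLp_indicator_iff_restrict hΩm).2 (MemLp.continuous_compact_mul hχ.continuous hχc hw)
  have hH : MemLp H 2 volume := by
    refine (memLp_indicator_iff_restrict hΩm).2
      ((MemLp.continuous_compact_mul hχ.continuous hχc hG).add ?_)
    have hχd : Continuous (fderiv ℝ χ) := hχ.continuous_fderiv (by simp)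
    obtain ⟨N, hN⟩ := hχd.bounded_above_of_compact_support (hχc.fderiv (𝕜 := ℝ))
    refine hw.of_le_mul (c := N)
      (hw.1.smul (measurable_gradient_of_continuous χ).aestronglyMeasurable)
      (.of_forall fun x ↦ ?_)
    rw [norm_smul, mul_comm, norm_gradient_eq]
    gcongr
    exact hN x
  have hev := ((tendsto_eLpNorm_translate_sub hW).eventually_le_const (pos_iff_ne_zero.2 hε)).and
    ((tendsto_eLpNorm_translate_sub hH).eventually_le_const (pos_iff_ne_zero.2 hε))
  obtain ⟨ρ, hρ, hball⟩ := Metric.eventually_nhds_iff.1 hev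
  obtain ⟨c, f, hf1, hf2⟩ := hχl.exists_bump hχc hρ
  set η := f.normed (volume : Measure (E d)) with hη
  have hηs : ContDiff ℝ ∞ η := f.contDiff_normed
  have hηc : HasCompactSupport η := f.hasCompactSupport_normed
  have hts : tsupport η = Metric.closedBall c f.rOut := f.tsupport_normed_eq
  have hz : ∀ z ∈ tsupport η, dist z 0 < ρ := fun z hz ↦ by
    rw [dist_zero_right]; exact hf1 z (hts ▸ hz)
  refine ⟨convolution η W (lsmul ℝ ℝ) volume, ?_, ?_, ?_⟩
  · exact hηc.contDiff_convolution_left (n := 1) _ (hηs.of_le (by simp))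
      (hW.locallyIntegrable (by norm_num))
  · refine le_trans ?_ ((eLpNorm_mono_measure _ (Measure.restrict_le_self (s := Ω))).trans
      (eLpNorm_convolution_sub_le hηs.continuous hηc f.nonneg_normed f.integral_normed hW
        fun z h ↦ (hball (hz z h)).1))
    refine (eLpNorm_congr_ae ?_).le
    filter_upwards [ae_restrict_mem hΩm] with x hx
    rw [hWdef, Set.indicator_of_mem hx]
  · refine le_trans ?_ ((eLpNorm_mono_measure _ (Measure.restrict_le_self (s := Ω))).trans
      (eLpNorm_convolution_sub_le hηs.continuous hηc f.nonneg_normed f.integral_normed hH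
        fun z h ↦ (hball (hz z h)).2))
    refine (eLpNorm_congr_ae ?_).le
    filter_upwards [ae_restrict_mem hΩm] with x hx
    have hgrad : gradient (convolution η W (lsmul ℝ ℝ) volume) x =
        convolution η H (lsmul ℝ ℝ) volume x := by
      refine ext_inner_left ℝ fun v ↦ ?_
      rw [real_inner_comm, inner_gradient_eq]
      exact fderiv_convolution_eq hΩm hwG (hw.integrable (by norm_num))
        (hG.integrable (by norm_num)) hχ hχc hηs hηc
        (fun z hz hzχ ↦ hf2 z (hts ▸ hz) x hx hzχ) v
    rw [hgrad]
    congr 1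
    rw [hHdef, Set.indicator_of_mem hx]

theorem gradient_fun_sum {F ι : Type*} [NormedAddCommGroup F] [InnerProductSpace ℝ F]
    [CompleteSpace F] (s : Finset ι) {f : ι → F → ℝ} {x : F}
    (h : ∀ i ∈ s, DifferentiableAt ℝ (f i) x) :
    gradient (fun y ↦ ∑ i ∈ s, f i y) x = ∑ i ∈ s, gradient (f i) x := by
  simp only [gradient]
  rw [fderiv_fun_sum h, map_sum]

/-- Density of `C¹(ℝ^d)` in `H¹(Ω)` for a Lipschitz domain. -/
theorem IsLipschitzDomain.exists_approx {Ω : Set (E d)} (hΩ : IsLipschitzDomain Ω)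
    {w : E d → ℝ} {G : E d → E d} (hwG : HasWeakGradient Ω w G)
    (hw : MemLp w 2 (volume.restrict Ω)) (hG : MemLp G 2 (volume.restrict Ω)) :
    ∃ φ : ℕ → E d → ℝ, (∀ n, ContDiff ℝ 1 (φ n)) ∧
      Tendsto (fun n ↦ eLpNorm (fun x ↦ φ n x - w x) 2 (volume.restrict Ω)) atTop (𝓝 0) ∧
      Tendsto (fun n ↦ eLpNorm (fun x ↦ gradient (φ n) x - G x) 2 (volume.restrict Ω))
        atTop (𝓝 0) := by
  obtain ⟨ι, _, χ, hχs, hχc, -, hχ1, hχl⟩ := hΩ.exists_partition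
  have hex := fun (i : ι) (n : ℕ) ↦ (hχl i).exists_approx hΩ.1 hΩ.2.1 (hχs i) (hχc i) hwG hw hG
    (ε := (n : ℝ≥0∞)⁻¹) (by simp)
  choose φ hφ1 hφ2 hφ3 using hex
  have hlim : Tendsto (fun n : ℕ ↦ ∑ _i : ι, (n : ℝ≥0∞)⁻¹) atTop (𝓝 0) := by
    have := tendsto_finsetSum (Finset.univ : Finset ι)
      fun i _ ↦ ENNReal.tendsto_inv_nat_nhds_zero
    simpa using this
  have hΩm := hΩ.1.measurableSet
  have hgχ : ∀ i, AEStronglyMeasurable (gradient (χ i)) (volume.restrict Ω) :=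
    fun i ↦ (measurable_gradient_of_continuous (χ i)).aestronglyMeasurable
  refine ⟨fun n x ↦ ∑ i, φ i n x, fun n ↦ ContDiff.sum fun i _ ↦ hφ1 i n, ?_, ?_⟩
  · refine tendsto_of_tendsto_of_tendsto_of_le_of_le tendsto_const_nhds hlim
      (fun n ↦ zero_le) fun n ↦ ?_
    refine le_trans (le_of_eq (eLpNorm_congr_ae ?_)) ((eLpNorm_sum_le (s := Finset.univ)
      (f := fun i x ↦ φ i n x - χ i x * w x) (fun i _ ↦ ?_) (by norm_num)).trans
      (Finset.sum_le_sum fun i _ ↦ hφ2 i n))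
    · filter_upwards [ae_restrict_mem hΩm] with x hx
      rw [Finset.sum_apply, Finset.sum_sub_distrib, ← Finset.sum_mul,
        hχ1 x (subset_closure hx), one_mul]
    · exact (hφ1 i n).continuous.aestronglyMeasurable.sub
        ((hχs i).continuous.aestronglyMeasurable.mul hw.1)
  · refine tendsto_of_tendsto_of_tendsto_of_le_of_le tendsto_const_nhds hlim
      (fun n ↦ zero_le) fun n ↦ ?_
    refine le_trans (le_of_eq (eLpNorm_congr_ae ?_)) ((eLpNorm_sum_le (s := Finset.univ)
      (f := fun i x ↦ gradient (φ i n) x - (χ i x • G x + w x • gradient (χ i) x))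
      (fun i _ ↦ ?_) (by norm_num)).trans
      (Finset.sum_le_sum fun i _ ↦ hφ3 i n))
    · filter_upwards [ae_restrict_mem hΩm] with x hx
      -- The cut-offs sum to one near x, so the product-rule terms w ∇χᵢ cancel in the sum.
      have h0 : ∑ i, gradient (χ i) x = 0 := by
        rw [← gradient_fun_sum _ fun i _ ↦ ((hχs i).differentiable (by simp)).differentiableAt]
        have h1 : (fun y ↦ ∑ i, χ i y) =ᶠ[𝓝 x] fun _ ↦ 1 := by
          filter_upwards [hΩ.1.mem_nhds hx] with y hy using hχ1 y (subset_closure hy)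
        rw [gradient, h1.fderiv_eq]
        simp
      rw [Finset.sum_apply, Finset.sum_sub_distrib, Finset.sum_add_distrib, ← Finset.sum_smul,
        hχ1 x (subset_closure hx), one_smul, ← Finset.smul_sum, h0, smul_zero, add_zero,
        gradient_fun_sum _ fun i _ ↦ ((hφ1 i n).differentiable (by simp)).differentiableAt]
    · exact (continuous_gradient (hφ1 i n)).aestronglyMeasurable.sub
        (((hχs i).continuous.aestronglyMeasurable.smul hG.1).add (hw.1.smul (hgχ i)))

end Density


/-! ### Trace inequality, existence of traces, integration by parts in H¹. -/

section Trace

theorem sq_eLpNorm_two_eq_ofReal {α F : Type*} [MeasurableSpace α] [NormedAddCommGroup F]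
    {f : α → F} {μ : Measure α} (hf : MemLp f 2 μ) :
    eLpNorm f 2 μ ^ 2 = ENNReal.ofReal (∫ x, ‖f x‖ ^ 2 ∂μ) := by
  rw [sq_eLpNorm_two, ofReal_integral_eq_lintegral_ofReal hf.norm.integrable_sq
    (.of_forall fun x ↦ by positivity)]
  refine lintegral_congr fun x ↦ ?_
  rw [← ofReal_norm, ENNReal.ofReal_pow (norm_nonneg _)]

theorem Continuous.memLp_restrict {F : Type*} [NormedAddCommGroup F] {f : E d → F}
    {Ω : Set (E d)} (hf : Continuous f) (hΩ : IsLipschitzDomain Ω) :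
    MemLp f 2 (volume.restrict Ω) := by
  have := isFiniteMeasure_restrict hΩ.2.1
  obtain ⟨M, hM⟩ := hΩ.isCompact_closure.exists_bound_of_continuousOn hf.continuousOn
  refine MemLp.of_bound hf.aestronglyMeasurable M ?_
  filter_upwards [ae_restrict_mem hΩ.1.measurableSet] with x hx using hM x (subset_closure hx)

theorem Continuous.memLp_surf {F : Type*} [NormedAddCommGroup F] {f : E d → F}
    {Ω : Set (E d)} (hf : Continuous f) (hΩ : IsLipschitzDomain Ω) :
    MemLp f 2 (surf Ω) := by
  have := hΩ.isFiniteMeasure_surf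
  obtain ⟨M, hM⟩ := hΩ.isCompact_frontier.exists_bound_of_continuousOn hf.continuousOn
  refine MemLp.of_bound hf.aestronglyMeasurable M ?_
  filter_upwards [ae_surf_mem_frontier Ω] with x hx using hM x hx

/-- The divergence theorem is applied to χφ² in the chart direction e. As ⟨e, n⟩ ≥ 1/√(1+K²) on the
boundary, the flux controls the boundary integral, while the derivative is bounded through Young's
inequality. -/
theorem IsLocalized.integral_surf_le {Ω : Set (E d)} (hΩ : IsLipschitzDomain Ω) {χ : E d → ℝ}
    (hχl : IsLocalized Ω χ) (hχ : ContDiff ℝ ∞ χ) (hχc : HasCompactSupport χ)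
    (hχ0 : ∀ x, 0 ≤ χ x) :
    ∃ C : ℝ, 0 ≤ C ∧ ∀ φ : E d → ℝ, ContDiff ℝ 1 φ →
      ∫ x, χ x * φ x ^ 2 ∂surf Ω ≤ C * ((∫ x in Ω, ‖φ x‖ ^ 2) + ∫ x in Ω, ‖gradient φ x‖ ^ 2) := by
  rcases hχl with hi | ⟨e, ψ, K, B, h, hB⟩
  · refine ⟨0, le_rfl, fun φ _ ↦ ?_⟩
    rw [zero_mul]
    refine (integral_eq_zero_of_ae ?_).le
    filter_upwards [ae_surf_mem_frontier Ω] with x hx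
    have : x ∉ tsupport χ := fun h' ↦ hx.2 (by rw [hΩ.1.interior_eq]; exact hi h')
    simp [image_eq_zero_of_notMem_tsupport this]
  · have hχ1 : ContDiff ℝ 1 χ := hχ.of_le (by simp)
    obtain ⟨M, hM⟩ := hχ.continuous.bounded_above_of_compact_support hχc
    have hχd : Continuous (fderiv ℝ χ) := hχ.continuous_fderiv (by simp)
    obtain ⟨N, hN⟩ := hχd.bounded_above_of_compact_support (hχc.fderiv (𝕜 := ℝ))
    have hM0 : 0 ≤ M := (norm_nonneg _).trans (hM 0)
    have hN0 : 0 ≤ N := (norm_nonneg _).trans (hN 0)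
    set J := √(1 + (K : ℝ) ^ 2) with hJ
    have hJ0 : 0 < J := by positivity
    refine ⟨J * (N + M), by positivity, fun φ hφ ↦ ?_⟩
    set f : E d → ℝ := fun x ↦ χ x * φ x ^ 2 with hf
    have hfs : ContDiff ℝ 1 f := hχ1.mul (hφ.pow 2)
    have hfc : HasCompactSupport f := hχc.mul_right
    obtain ⟨L, hL⟩ := exists_lipschitzWith_of_contDiff hfs hfc
    have hdiv := hΩ.divergence hL e
    have hfderiv : ∀ x, fderiv ℝ f x e =
        φ x ^ 2 * fderiv ℝ χ x e + 2 * χ x * φ x * fderiv ℝ φ x e := fun x ↦ by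
      have h1 := (hχ1.differentiable (by simp)).differentiableAt (x := x) |>.hasFDerivAt
      have h2 := (hφ.differentiable (by simp)).differentiableAt (x := x) |>.hasFDerivAt
      have h3 : fderiv ℝ f x = _ := (h1.mul (h2.pow 2)).fderiv
      rw [h3]
      simp
      ring
    have hle : ∀ x, fderiv ℝ f x e ≤ (N + M) * (‖φ x‖ ^ 2 + ‖gradient φ x‖ ^ 2) := fun x ↦ by
      rw [hfderiv]
      have a1 : |fderiv ℝ χ x e| ≤ N := by
        have := (fderiv ℝ χ x).le_opNorm e
        rw [h.1, mul_one] at this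
        exact this.trans (hN x)
      have a2 : |χ x| ≤ M := hM x
      have a3 : |fderiv ℝ φ x e| ≤ ‖gradient φ x‖ := by
        have := (fderiv ℝ φ x).le_opNorm e
        rwa [h.1, mul_one, ← norm_gradient_eq] at this
      rw [Real.norm_eq_abs, sq_abs]
      have b1 : φ x ^ 2 * fderiv ℝ χ x e ≤ φ x ^ 2 * N := by
        gcongr; exact (le_abs_self _).trans a1
      have b2 : 2 * χ x * φ x * fderiv ℝ φ x e ≤ M * (φ x ^ 2 + ‖gradient φ x‖ ^ 2) := by
        have c1 : 2 * (φ x * fderiv ℝ φ x e) ≤ φ x ^ 2 + ‖gradient φ x‖ ^ 2 := by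
          have := sq_le_sq' (abs_le.1 a3).1 (abs_le.1 a3).2
          nlinarith [sq_nonneg (φ x - fderiv ℝ φ x e)]
        have c2 : 0 ≤ φ x ^ 2 + ‖gradient φ x‖ ^ 2 := by positivity
        calc 2 * χ x * φ x * fderiv ℝ φ x e = χ x * (2 * (φ x * fderiv ℝ φ x e)) := by ring
          _ ≤ χ x * (φ x ^ 2 + ‖gradient φ x‖ ^ 2) :=
            mul_le_mul_of_nonneg_left c1 (hχ0 x)
          _ ≤ _ := mul_le_mul_of_nonneg_right ((le_abs_self _).trans a2) c2
      have b3 : 0 ≤ N * ‖gradient φ x‖ ^ 2 := by positivity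
      linarith
    have i1 : IntegrableOn (fun x ↦ ‖φ x‖ ^ 2) Ω :=
      (Continuous.memLp_restrict hφ.continuous hΩ).norm.integrable_sq
    have i2 : IntegrableOn (fun x ↦ ‖gradient φ x‖ ^ 2) Ω :=
      (Continuous.memLp_restrict (continuous_gradient hφ) hΩ).norm.integrable_sq
    have hint : ∫ x in Ω, fderiv ℝ f x e ≤
        (N + M) * ((∫ x in Ω, ‖φ x‖ ^ 2) + ∫ x in Ω, ‖gradient φ x‖ ^ 2) := by
      rw [← integral_add i1 i2, ← integral_const_mul]
      exact integral_mono (integrable_fderiv_apply hL hfc e).integrableOn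
        ((i1.add i2).const_mul _) hle
    have hae : ∀ᵐ x ∂surf Ω, f x ≤ J * (f x * inner ℝ e (outerNormal Ω x)) := by
      have := (ae_restrict_iff' h.isOpen.measurableSet).1 h.ae_le_inner_outerNormal
      filter_upwards [this] with x hx
      by_cases hxB : x ∈ tsupport χ
      · have h1 := hx (hB hxB)
        have h2 : 0 ≤ f x := mul_nonneg (hχ0 x) (sq_nonneg _)
        have h3 : 1 ≤ J * inner ℝ e (outerNormal Ω x) := by
          have := mul_le_mul_of_nonneg_left h1 hJ0.le
          rwa [mul_inv_cancel₀ hJ0.ne'] at this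
        calc f x = f x * 1 := (mul_one _).symm
          _ ≤ f x * (J * inner ℝ e (outerNormal Ω x)) := by gcongr
          _ = _ := by ring
      · simp [hf, image_eq_zero_of_notMem_tsupport hxB]
    have hfi : Integrable f (surf Ω) := by
      have := hΩ.isFiniteMeasure_surf
      exact (Continuous.memLp_surf hfs.continuous hΩ).integrable (by norm_num)
    calc ∫ x, f x ∂surf Ω ≤ ∫ x, J * (f x * inner ℝ e (outerNormal Ω x)) ∂surf Ω :=
          integral_mono_ae hfi
            ((hΩ.integrable_mul_inner_outerNormal hfs.continuous e).const_mul J) hae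
      _ = J * ∫ x in Ω, fderiv ℝ f x e := by rw [integral_const_mul, hdiv]
      _ ≤ J * ((N + M) * ((∫ x in Ω, ‖φ x‖ ^ 2) + ∫ x in Ω, ‖gradient φ x‖ ^ 2)) := by gcongr
      _ = _ := by ring

/-- The trace inequality for `C¹` functions. -/
theorem IsLipschitzDomain.eLpNorm_surf_le {Ω : Set (E d)} (hΩ : IsLipschitzDomain Ω) :
    ∃ C : ℝ≥0∞, C ≠ ⊤ ∧ ∀ φ : E d → ℝ, ContDiff ℝ 1 φ → eLpNorm φ 2 (surf Ω) ≤
      C * (eLpNorm φ 2 (volume.restrict Ω) + eLpNorm (gradient φ) 2 (volume.restrict Ω)) := by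
  obtain ⟨ι, _, χ, hχs, hχc, hχ0, hχ1, hχl⟩ := hΩ.exists_partition
  have hex := fun i ↦ (hχl i).integral_surf_le hΩ (hχs i) (hχc i) (hχ0 i)
  choose C hC0 hC using hex
  have hfin := hΩ.isFiniteMeasure_surf
  set S := ∑ i, C i with hS
  have hS0 : 0 ≤ S := Finset.sum_nonneg fun i _ ↦ hC0 i
  -- The squared estimate has constant S, and S ≤ (S + 1)² allows the root to be taken without
  -- square roots of constants.
  refine ⟨ENNReal.ofReal (S + 1), ENNReal.ofReal_ne_top, fun φ hφ ↦ ?_⟩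
  have m1 := Continuous.memLp_restrict hφ.continuous hΩ
  have m2 := Continuous.memLp_restrict (continuous_gradient hφ) hΩ
  have m3 := Continuous.memLp_surf hφ.continuous hΩ
  have key : ∫ x, ‖φ x‖ ^ 2 ∂surf Ω ≤
      S * ((∫ x in Ω, ‖φ x‖ ^ 2) + ∫ x in Ω, ‖gradient φ x‖ ^ 2) := by
    rw [hS, Finset.sum_mul]
    refine le_trans (le_of_eq ?_) (Finset.sum_le_sum fun i _ ↦ hC i φ hφ)
    rw [← integral_finsetSum]
    · refine integral_congr_ae ?_
      filter_upwards [ae_surf_mem_frontier Ω] with x hx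
      rw [← Finset.sum_mul, hχ1 x (frontier_subset_closure hx), one_mul, Real.norm_eq_abs, sq_abs]
    · intro i _
      exact (Continuous.memLp_surf ((hχs i).continuous.mul (hφ.continuous.pow 2)) hΩ).integrable
        (by norm_num)
  have h2 : eLpNorm φ 2 (surf Ω) ^ 2 ≤ (ENNReal.ofReal (S + 1) *
      (eLpNorm φ 2 (volume.restrict Ω) + eLpNorm (gradient φ) 2 (volume.restrict Ω))) ^ 2 := by
    have hA : 0 ≤ ∫ x in Ω, ‖φ x‖ ^ 2 := integral_nonneg fun x ↦ by positivity
    have hB : 0 ≤ ∫ x in Ω, ‖gradient φ x‖ ^ 2 := integral_nonneg fun x ↦ by positivity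
    rw [sq_eLpNorm_two_eq_ofReal m3, mul_pow, ← ENNReal.ofReal_pow (by positivity)]
    calc _ ≤ ENNReal.ofReal ((S + 1) ^ 2 *
          ((∫ x in Ω, ‖φ x‖ ^ 2) + ∫ x in Ω, ‖gradient φ x‖ ^ 2)) := by
          refine ENNReal.ofReal_le_ofReal (key.trans ?_)
          gcongr
          nlinarith
      _ = ENNReal.ofReal ((S + 1) ^ 2) * (eLpNorm φ 2 (volume.restrict Ω) ^ 2 +
          eLpNorm (gradient φ) 2 (volume.restrict Ω) ^ 2) := by
          rw [ENNReal.ofReal_mul (by positivity), ENNReal.ofReal_add hA hB,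
            sq_eLpNorm_two_eq_ofReal m1, sq_eLpNorm_two_eq_ofReal m2]
      _ ≤ _ := by
          gcongr
          rw [add_sq, add_right_comm]
          exact le_self_add
  exact (ENNReal.pow_le_pow_left_iff two_ne_zero).1 h2

/-- By the trace inequality applied to differences, approximants converging in H¹(Ω) are Cauchy in
L²(∂Ω); their limit is a trace. -/
theorem hasTrace_of_memH1 {Ω : Set (E d)} (hΩ : IsLipschitzDomain Ω) {w : E d → ℝ}
    (hw : MemH1 Ω w) : ∃ γ, HasTrace Ω w γ := by
  obtain ⟨hw1, ⟨G, hG⟩, hw3⟩ := hw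
  have hwG : HasWeakGradient Ω w (weakGrad Ω w) := by
    have h : ∃ G, HasWeakGradient Ω w G := ⟨G, hG⟩
    rw [weakGrad, dif_pos h]
    exact h.choose_spec
  obtain ⟨φ, hφ, ha, hb⟩ := hΩ.exists_approx hwG hw1 hw3
  obtain ⟨C, hC, hCφ⟩ := hΩ.eLpNorm_surf_le
  set a := fun n ↦ eLpNorm (fun x ↦ φ n x - w x) 2 (volume.restrict Ω) with haDef
  set b := fun n ↦ eLpNorm (fun x ↦ gradient (φ n) x - weakGrad Ω w x) 2 (volume.restrict Ω)
    with hbDef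
  have hm : ∀ n, MemLp (φ n) 2 (surf Ω) := fun n ↦ Continuous.memLp_surf (hφ n).continuous hΩ
  have hbound : ∀ n m, eLpNorm (φ n - φ m) 2 (surf Ω) ≤ C * ((a n + a m) + (b n + b m)) := by
    intro n m
    refine (hCφ _ ((hφ n).sub (hφ m))).trans ?_
    gcongr
    · have h1 : (fun x ↦ φ n x - φ m x) = (fun x ↦ φ n x - w x) - fun x ↦ φ m x - w x := by
        ext x; simp
      rw [h1]
      exact eLpNorm_sub_le ((hφ n).continuous.aestronglyMeasurable.sub hw1.1)
        ((hφ m).continuous.aestronglyMeasurable.sub hw1.1) (by norm_num)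
    · have h1 : (gradient fun x ↦ φ n x - φ m x) = (fun x ↦ gradient (φ n) x - weakGrad Ω w x) -
          fun x ↦ gradient (φ m) x - weakGrad Ω w x := by
        ext1 x
        rw [Pi.sub_apply, sub_sub_sub_cancel_right, gradient,
          fderiv_fun_sub ((hφ n).differentiable (by simp)).differentiableAt
            ((hφ m).differentiable (by simp)).differentiableAt, map_sub]
        rfl
      rw [h1]
      exact eLpNorm_sub_le ((continuous_gradient (hφ n)).aestronglyMeasurable.sub hw3.1)
        ((continuous_gradient (hφ m)).aestronglyMeasurable.sub hw3.1) (by norm_num)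
  have hcauchy : CauchySeq fun n ↦ (hm n).toLp (φ n) := by
    rw [Lp.cauchySeq_Lp_iff_cauchySeq_eLpNorm]
    have hlim : Tendsto (fun p : ℕ × ℕ ↦ C * ((a p.1 + a p.2) + (b p.1 + b p.2))) atTop (𝓝 0) := by
      have t1 : Tendsto (Prod.fst : ℕ × ℕ → ℕ) atTop atTop := by
        rw [← prod_atTop_atTop_eq]; exact tendsto_fst
      have t2 : Tendsto (Prod.snd : ℕ × ℕ → ℕ) atTop atTop := by
        rw [← prod_atTop_atTop_eq]; exact tendsto_snd
      have := (((ha.comp t1).add (ha.comp t2)).add ((hb.comp t1).add (hb.comp t2)))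
      simp only [add_zero] at this
      have h2 := ENNReal.Tendsto.const_mul (a := C) this (Or.inr hC)
      rw [mul_zero] at h2
      exact h2
    refine tendsto_of_tendsto_of_tendsto_of_le_of_le tendsto_const_nhds hlim
      (fun n ↦ zero_le) fun p ↦ ?_
    refine le_of_eq_of_le (eLpNorm_congr_ae ?_) (hbound p.1 p.2)
    exact (hm p.1).coeFn_toLp.sub (hm p.2).coeFn_toLp
  obtain ⟨γ, hγ⟩ := cauchySeq_tendsto_of_complete hcauchy
  refine ⟨γ, Lp.memLp γ, φ, hφ, ha, hb, ?_⟩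
  rw [tendsto_iff_edist_tendsto_0] at hγ
  refine hγ.congr fun n ↦ ?_
  rw [Lp.edist_def]
  refine eLpNorm_congr_ae ?_
  filter_upwards [(hm n).coeFn_toLp] with x hx
  rw [Pi.sub_apply, hx]

theorem tendsto_integral_mul_of_eLpNorm {α : Type*} [MeasurableSpace α] {μ : Measure α}
    {f : ℕ → α → ℝ} {f₀ g : α → ℝ} (hf : ∀ n, MemLp (f n) 2 μ) (hf₀ : MemLp f₀ 2 μ)
    (hg : MemLp g 2 μ) (h : Tendsto (fun n ↦ eLpNorm (fun x ↦ f n x - f₀ x) 2 μ) atTop (𝓝 0)) :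
    Tendsto (fun n ↦ ∫ x, f n x * g x ∂μ) atTop (𝓝 (∫ x, f₀ x * g x ∂μ)) := by
  refine tendsto_integral_of_L1' _ (hf₀.1.mul hg.1)
    (.of_forall fun n ↦ (hf n).integrable_mul hg) ?_
  have hlim := ENNReal.Tendsto.mul_const (b := eLpNorm g 2 μ) h (Or.inr hg.2.ne)
  rw [zero_mul] at hlim
  refine tendsto_of_tendsto_of_tendsto_of_le_of_le tendsto_const_nhds hlim
    (fun n ↦ zero_le) fun n ↦ ?_
  have := eLpNorm_smul_le_mul_eLpNorm (p := 2) (q := 2) (r := 1) hg.1 ((hf n).1.sub hf₀.1)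
  refine le_of_eq_of_le ?_ this
  congr 1
  ext x
  simp [sub_mul]

/-- Integration by parts for a `C¹` and a Lipschitz function. -/
theorem IsLipschitzDomain.integral_mul_fderiv_add {Ω : Set (E d)} (hΩ : IsLipschitzDomain Ω)
    {φ v : E d → ℝ} (hφ : ContDiff ℝ 1 φ) {C : ℝ≥0} (hv : LipschitzWith C v) (e : E d) :
    ∫ x in Ω, (φ x * fderiv ℝ v x e + fderiv ℝ φ x e * v x) =
      ∫ x, φ x * (v x * inner ℝ e (outerNormal Ω x)) ∂surf Ω := by
  obtain ⟨ι, _, χ, hχs, hχc, -, hχ1, -⟩ := hΩ.exists_partition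
  -- A compactly supported cut-off equal to one on the closure of Ω: it makes φ globally Lipschitz
  -- without changing either side.
  set κ : E d → ℝ := fun x ↦ ∑ i, χ i x with hκ
  have hκs : ContDiff ℝ 1 fun x ↦ κ x * φ x :=
    (ContDiff.sum fun i _ ↦ (hχs i).of_le (by simp)).mul hφ
  have hκc : HasCompactSupport fun x ↦ κ x * φ x := by
    refine HasCompactSupport.mul_right (HasCompactSupport.intro
      (isCompact_iUnion fun i ↦ (hχc i).isCompact) fun x hx ↦ ?_)
    refine Finset.sum_eq_zero fun i _ ↦ image_eq_zero_of_notMem_tsupport fun h ↦ ?_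
    exact hx (Set.mem_iUnion.2 ⟨i, h⟩)
  obtain ⟨L, hL⟩ := exists_lipschitzWith_of_contDiff hκs hκc
  obtain ⟨C', hC'⟩ := exists_lipschitzWith_mul hL hκc hv
  have h1 := hΩ.divergence hC' e
  have e1 : ∫ x in Ω, (φ x * fderiv ℝ v x e + fderiv ℝ φ x e * v x) =
      ∫ x in Ω, fderiv ℝ (fun x ↦ κ x * φ x * v x) x e := by
    refine setIntegral_congr_ae hΩ.1.measurableSet ?_
    filter_upwards [hv.ae_differentiableAt] with x hx hxΩ
    have h2 : (fun x ↦ κ x * φ x * v x) =ᶠ[𝓝 x] fun x ↦ φ x * v x := by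
      filter_upwards [hΩ.1.mem_nhds hxΩ] with y hy
      rw [hκ]
      simp only
      rw [hχ1 y (subset_closure hy), one_mul]
    rw [h2.fderiv_eq]
    have h3 := (hφ.differentiable (by simp)).differentiableAt (x := x) |>.hasFDerivAt
    have h4 : fderiv ℝ (fun x ↦ φ x * v x) x = _ := (h3.mul hx.hasFDerivAt).fderiv
    rw [h4]
    simp
    ring
  rw [e1, h1]
  refine integral_congr_ae ?_
  filter_upwards [ae_surf_mem_frontier Ω] with x hx
  rw [hκ]
  simp only
  rw [hχ1 x (frontier_subset_closure hx), one_mul, mul_assoc]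

theorem memLp_fderiv_apply_of_lipschitzWith {Ω : Set (E d)} (hΩ : Bornology.IsBounded Ω)
    {v : E d → ℝ} {C : ℝ≥0} (hv : LipschitzWith C v) (e : E d) :
    MemLp (fun x ↦ fderiv ℝ v x e) 2 (volume.restrict Ω) := by
  have := isFiniteMeasure_restrict hΩ
  refine MemLp.of_bound (measurable_fderiv_apply_const ℝ v e).aestronglyMeasurable (C * ‖e‖)
    (.of_forall fun x ↦ ?_)
  exact ((fderiv ℝ v x).le_opNorm e).trans (by
    gcongr; exact norm_fderiv_le_of_lipschitz ℝ hv)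

theorem memLp_mul_inner_outerNormal {Ω : Set (E d)} (hΩ : IsLipschitzDomain Ω)
    {v : E d → ℝ} (hv : Continuous v) (e : E d) :
    MemLp (fun x ↦ v x * inner ℝ e (outerNormal Ω x)) 2 (surf Ω) := by
  refine (Continuous.memLp_surf hv hΩ).of_le_mul (c := ‖e‖) (hv.aestronglyMeasurable.mul
    (hΩ.aemeasurable_outerNormal.const_inner (c := e)).aestronglyMeasurable)
    (.of_forall fun x ↦ ?_)
  rw [norm_mul, mul_comm]
  gcongr
  exact (norm_inner_le_norm _ _).trans
    (mul_le_of_le_one_right (norm_nonneg _) (norm_outerNormal_le Ω x))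

/-- Integration by parts for an `H¹` function and a Lipschitz function. -/
theorem HasTrace.integral_mul_fderiv_add {Ω : Set (E d)} (hΩ : IsLipschitzDomain Ω)
    {w γ v : E d → ℝ} (hw : MemH1 Ω w) (hγ : HasTrace Ω w γ) {C : ℝ≥0} (hv : LipschitzWith C v)
    (e : E d) :
    ∫ x in Ω, (w x * fderiv ℝ v x e + inner ℝ (weakGrad Ω w x) e * v x) =
      ∫ x, γ x * (v x * inner ℝ e (outerNormal Ω x)) ∂surf Ω := by
  obtain ⟨hγ2, φ, hφ, ha, hb, hc⟩ := hγ
  have m1 := memLp_fderiv_apply_of_lipschitzWith hΩ.2.1 hv e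
  have m2 := Continuous.memLp_restrict hv.continuous hΩ
  have m3 := memLp_mul_inner_outerNormal hΩ hv.continuous e
  have mφ := fun n ↦ Continuous.memLp_restrict (hφ n).continuous hΩ
  have mG : ∀ n, MemLp (fun x ↦ inner ℝ (gradient (φ n) x) e) 2 (volume.restrict Ω) := fun n ↦
    Continuous.memLp_restrict ((continuous_gradient (hφ n)).inner continuous_const) hΩ
  have mW : MemLp (fun x ↦ inner ℝ (weakGrad Ω w x) e) 2 (volume.restrict Ω) :=
    hw.2.2.inner_const e
  have l1 := tendsto_integral_mul_of_eLpNorm mφ hw.1 m1 ha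
  have l2 : Tendsto (fun n ↦ ∫ x in Ω, inner ℝ (gradient (φ n) x) e * v x) atTop
      (𝓝 (∫ x in Ω, inner ℝ (weakGrad Ω w x) e * v x)) := by
    refine tendsto_integral_mul_of_eLpNorm mG mW m2 ?_
    have hlim := ENNReal.Tendsto.const_mul (a := ENNReal.ofReal ‖e‖) hb
      (Or.inr ENNReal.ofReal_ne_top)
    rw [mul_zero] at hlim
    refine tendsto_of_tendsto_of_tendsto_of_le_of_le tendsto_const_nhds hlim
      (fun n ↦ zero_le) fun n ↦ ?_
    refine eLpNorm_le_mul_eLpNorm_of_ae_le_mul (.of_forall fun x ↦ ?_) 2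
    rw [← inner_sub_left, mul_comm]
    exact norm_inner_le_norm _ _
  have l3 := tendsto_integral_mul_of_eLpNorm
    (fun n ↦ Continuous.memLp_surf (hφ n).continuous hΩ) hγ2 m3 hc
  have heq : ∀ n, (∫ x in Ω, φ n x * fderiv ℝ v x e) +
      ∫ x in Ω, inner ℝ (gradient (φ n) x) e * v x =
      ∫ x, φ n x * (v x * inner ℝ e (outerNormal Ω x)) ∂surf Ω := fun n ↦ by
    rw [← hΩ.integral_mul_fderiv_add (hφ n) hv e,
      ← integral_add (f := fun x ↦ φ n x * fderiv ℝ v x e)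
        (g := fun x ↦ inner ℝ (gradient (φ n) x) e * v x)
        ((mφ n).integrable_mul m1) ((mG n).integrable_mul m2)]
    simp only [inner_gradient_eq]
  rw [integral_add (f := fun x ↦ w x * fderiv ℝ v x e)
    (g := fun x ↦ inner ℝ (weakGrad Ω w x) e * v x)
    (hw.1.integrable_mul m1) (mW.integrable_mul m2)]
  exact tendsto_nhds_unique ((l1.add l2).congr heq) l3

end Trace


/-! ### Geometry of the mesh and Lipschitz extension of finite element functions. -/

section Mesh

/-- The polynomial function on the Euclidean space defined by a multivariate polynomial. -/
noncomputable def polyFun (p : MvPolynomial (Fin d) ℝ) (x : E d) : ℝ :=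
  MvPolynomial.eval (fun i ↦ x i) p

theorem contDiff_polyFun (p : MvPolynomial (Fin d) ℝ) {n : WithTop ℕ∞} :
    ContDiff ℝ n (polyFun p) := by
  have := AnalyticOnNhd.eval_continuousLinearMap' (𝕜 := ℝ) (B := ℝ)
    (fun i : Fin d ↦ (EuclideanSpace.proj i : E d →L[ℝ] ℝ)) p
  exact this.contDiff

theorem polyFun_add (p q : MvPolynomial (Fin d) ℝ) : polyFun (p + q) = polyFun p + polyFun q := by
  ext x; simp [polyFun]

theorem polyFun_smul (c : ℝ) (p : MvPolynomial (Fin d) ℝ) :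
    polyFun (c • p) = c • polyFun p := by
  ext x; simp [polyFun]

/-- The geometric properties of mesh elements that matter. -/
structure IsConvexCell (T : Set (E d)) : Prop where
  isCompact : IsCompact T
  convex : Convex ℝ T
  interior_nonempty : (interior T).Nonempty

theorem IsSimplex.isConvexCell {T : Set (E d)} (h : IsSimplex T) : IsConvexCell T := by
  obtain ⟨p, hp, rfl⟩ := h
  refine ⟨(Set.finite_range p).isCompact_convexHull ℝ, convex_convexHull ℝ _, ?_⟩
  rw [interior_convexHull_nonempty_iff_affineSpan_eq_top,
    hp.affineSpan_eq_top_iff_card_eq_finrank_add_one]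
  simp

theorem IsBox.isConvexCell {T : Set (E d)} (h : IsBox T) : IsConvexCell T := by
  obtain ⟨a, b, hab, rfl⟩ := h
  have heq : {x : E d | ∀ i, a i ≤ x i ∧ x i ≤ b i} =
      (EuclideanSpace.equiv (Fin d) ℝ) ⁻¹' Set.Icc a b := by
    ext x
    simp [Pi.le_def, forall_and]
  rw [heq]
  refine ⟨?_, ?_, ?_⟩
  · exact (EuclideanSpace.equiv (Fin d) ℝ).toHomeomorph.isCompact_preimage.2 isCompact_Icc
  · exact (convex_Icc a b).linear_preimage (EuclideanSpace.equiv (Fin d) ℝ).toLinearMap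
  · have hsub : (EuclideanSpace.equiv (Fin d) ℝ) ⁻¹' (Set.univ.pi fun i ↦ Set.Ioo (a i) (b i)) ⊆
        interior ((EuclideanSpace.equiv (Fin d) ℝ) ⁻¹' Set.Icc a b) := by
      refine interior_maximal (Set.preimage_mono fun x hx ↦ ?_)
        ((isOpen_set_pi Set.finite_univ fun i _ ↦ isOpen_Ioo).preimage
          (EuclideanSpace.equiv (Fin d) ℝ).continuous)
      exact ⟨fun i ↦ (hx i trivial).1.le, fun i ↦ (hx i trivial).2.le⟩
    refine Set.Nonempty.mono hsub
      ⟨(EuclideanSpace.equiv (Fin d) ℝ).symm fun i ↦ (a i + b i) / 2, fun i _ ↦ ?_⟩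
    have := hab i
    simp only [ContinuousLinearEquiv.apply_symm_apply]
    constructor <;> linarith

namespace IsConvexCell

variable {T : Set (E d)}

theorem uniqueDiffOn (h : IsConvexCell T) : UniqueDiffOn ℝ T :=
  uniqueDiffOn_convex h.convex h.interior_nonempty

/-- Derivatives within a convex set with interior are unique even at its boundary points, so the
gradient within T is that of the representing polynomial. -/
theorem gradientWithin_eq (h : IsConvexCell T) {v f : E d → ℝ} (hf : ContDiff ℝ 1 f)
    (hv : Set.EqOn v f T) {x : E d} (hx : x ∈ T) : gradientWithin v T x = gradient f x := by
  rw [gradientWithin, gradient, fderivWithin_congr hv (hv hx),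
    ((hf.differentiable (by simp)).differentiableAt).fderivWithin (h.uniqueDiffOn x hx)]

theorem isClosed (h : IsConvexCell T) : IsClosed T := h.isCompact.isClosed

theorem subset_closure_interior (h : IsConvexCell T) : T ⊆ closure (interior T) := by
  rw [h.convex.closure_interior_eq_closure_of_nonempty_interior h.interior_nonempty]
  exact subset_closure

end IsConvexCell

theorem gradient_eq_of_mem_interior {T : Set (E d)} {v f : E d → ℝ} (hv : Set.EqOn v f T)
    {x : E d} (hx : x ∈ interior T) : gradient v x = gradient f x := by
  have : v =ᶠ[𝓝 x] f := by
    filter_upwards [mem_interior_iff_mem_nhds.1 hx] with y hy using hv hy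
  rw [gradient, gradient, this.fderiv_eq]

section

variable {bg : Finset (Set (E d))} {Ω : Set (E d)}

theorem IsBackgroundMesh.isConvexCell (h : IsBackgroundMesh bg Ω) {T : Set (E d)}
    (hT : T ∈ activeMesh bg Ω) : IsConvexCell T := by
  rcases h.1 with h | h
  · exact (h T hT.1).isConvexCell
  · exact (h T hT.1).isConvexCell

theorem finite_activeMesh (bg : Finset (Set (E d))) (Ω : Set (E d)) :
    (activeMesh bg Ω).Finite := bg.finite_toSet.subset fun _ h ↦ h.1

theorem IsBackgroundMesh.subset_activeMesh (h : IsBackgroundMesh bg Ω) :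
    Ω ⊆ ⋃ T ∈ activeMesh bg Ω, T := fun x hx ↦ by
  obtain ⟨T, hT, hxT⟩ := Set.mem_iUnion₂.1 (h.2.2 hx)
  exact Set.mem_iUnion₂.2 ⟨T, ⟨hT, x, hxT, hx⟩, hxT⟩

theorem IsBackgroundMesh.closure_subset_activeMesh (h : IsBackgroundMesh bg Ω) :
    closure Ω ⊆ ⋃ T ∈ activeMesh bg Ω, T :=
  closure_minimal h.subset_activeMesh
    ((finite_activeMesh bg Ω).isClosed_biUnion fun _ hT ↦ (h.isConvexCell hT).isClosed)

/-- Almost every point of `Ω` is interior to an active element. -/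
theorem IsBackgroundMesh.ae_mem_interior (h : IsBackgroundMesh bg Ω) :
    ∀ᵐ x : E d, x ∈ Ω → ∃ T ∈ activeMesh bg Ω, x ∈ interior T := by
  have : ∀ᵐ x : E d, ∀ T ∈ activeMesh bg Ω, x ∉ frontier T :=
    (ae_ball_iff (finite_activeMesh bg Ω).countable).2 fun T hT ↦
      measure_eq_zero_iff_ae_notMem.1 ((h.isConvexCell hT).convex.addHaar_frontier volume)
  filter_upwards [this] with x hx hxΩ
  obtain ⟨T, hT, hxT⟩ := Set.mem_iUnion₂.1 (h.subset_activeMesh hxΩ)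
  refine ⟨T, hT, ?_⟩
  by_contra hi
  exact hx T hT ⟨subset_closure hxT, hi⟩

theorem exists_polyFun_eqOn {P : Submodule ℝ (MvPolynomial (Fin d) ℝ)} {v : E d → ℝ}
    (hv : v ∈ feSpace bg Ω P) {T : Set (E d)} (hT : T ∈ activeMesh bg Ω) :
    ∃ p ∈ P, Set.EqOn v (polyFun p) T := by
  obtain ⟨p, hp, h⟩ := hv.2 T hT
  exact ⟨p, hp, h⟩

end

/-- A function that is Lipschitz on each of finitely many closed pieces is Lipschitz along
segments. -/
theorem abs_sub_le_of_segment_subset {F : Type*} [NormedAddCommGroup F] [NormedSpace ℝ F]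
    {S : Set (Set F)} (hS : S.Finite) (hSc : ∀ T ∈ S, IsClosed T) {v : F → ℝ}
    (hv : ContinuousOn v (⋃ T ∈ S, T)) {M : ℝ≥0} (hM : ∀ T ∈ S, LipschitzOnWith M v T) {a b : F}
    (hab : segment ℝ a b ⊆ ⋃ T ∈ S, T) : |v a - v b| ≤ M * ‖a - b‖ := by
  have key : ∀ a b : F, segment ℝ a b ⊆ ⋃ T ∈ S, T → v b ≤ v a + M * ‖a - b‖ := by
    intro a b hab
    set γ : ℝ → F := fun t ↦ AffineMap.lineMap (k := ℝ) a b t with hγ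
    have hγc : Continuous γ := AffineMap.lineMap_continuous
    have hγm : ∀ t ∈ Set.Icc (0 : ℝ) 1, γ t ∈ ⋃ T ∈ S, T := fun t ht ↦ by
      refine hab ?_
      rw [segment_eq_image_lineMap]
      exact ⟨t, ht, rfl⟩
    have h := image_le_of_liminf_slope_right_le_deriv_boundary (f := v ∘ γ) (a := 0) (b := 1)
      (B := fun t ↦ v a + M * ‖a - b‖ * t) (B' := fun _ ↦ M * ‖a - b‖)
      (hv.comp hγc.continuousOn hγm) (by simp [hγ]) (by fun_prop)
      (fun t _ ↦ by
        have := ((hasDerivAt_id t).const_mul (M * ‖a - b‖)).const_add (v a)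
        simpa using this.hasDerivWithinAt)
      (fun t ht r hr ↦ ?_)
    · simpa [hγ] using h (Set.right_mem_Icc.2 zero_le_one)
    · refine Eventually.frequently ?_
      -- There are finitely many closed pieces, so just after time t the path meets only pieces that
      -- already contain γ t. The Lipschitz bound of such a piece controls the right slopes.
      have h1 : ∀ᶠ z in 𝓝[>] t, ∀ T ∈ S, γ z ∈ T → γ t ∈ T := by
        rw [eventually_all_finite hS]
        intro T hT
        by_cases htT : γ t ∈ T
        · exact .of_forall fun _ _ ↦ htT
        · have := (hγc.tendsto t).mono_left (nhdsWithin_le_nhds (s := Set.Ioi t))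
          filter_upwards [this ((hSc T hT).isOpen_compl.mem_nhds htT)] with z hz hz'
          exact absurd hz' hz
      have h2 : ∀ᶠ z in 𝓝[>] t, z < 1 := by
        filter_upwards [mem_nhdsWithin_of_mem_nhds (Iio_mem_nhds ht.2)] with z hz using hz
      filter_upwards [h1, h2, self_mem_nhdsWithin] with z hz hz1 hzt
      have hzt' : t < z := hzt
      obtain ⟨T, hT, hzT⟩ := Set.mem_iUnion₂.1 (hγm z ⟨ht.1.trans hzt'.le, hz1.le⟩)
      have h3 := (hM T hT).dist_le_mul _ hzT _ (hz T hT hzT)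
      rw [hγ, dist_lineMap_lineMap, Real.dist_eq, Real.dist_eq, abs_of_pos (sub_pos.2 hzt'),
        dist_eq_norm] at h3
      have h4 := (abs_le.1 h3).2
      refine lt_of_le_of_lt ?_ hr
      rw [slope_def_field, div_le_iff₀ (sub_pos.2 hzt')]
      simp only [Function.comp_apply]
      calc _ ≤ _ := h4
        _ = _ := by ring
  rw [abs_le]
  have h1 := key a b hab
  have h2 := key b a (by rwa [segment_symm])
  rw [norm_sub_rev] at h2
  constructor <;> linarith

/-- Near the boundary the segment from y to z may leave Ω. The path that descends along -e, crosses,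
and climbs again stays in Ω and has length comparable to ‖y - z‖, so the bound along segments
applies three times. -/
theorem exists_lipschitzOnWith_inter_ball {Ω : Set (E d)} (hΩ : IsLipschitzDomain Ω)
    {S : Set (Set (E d))} (hS : S.Finite) (hSc : ∀ T ∈ S, IsClosed T) {v : E d → ℝ}
    (hv : ContinuousOn v (⋃ T ∈ S, T)) {M : ℝ≥0} (hM : ∀ T ∈ S, LipschitzOnWith M v T)
    (hΩS : Ω ⊆ ⋃ T ∈ S, T) {x : E d} (hx : x ∈ closure Ω) :
    ∃ (C : ℝ≥0) (ρ : ℝ), 0 < ρ ∧ LipschitzOnWith C v (Ω ∩ Metric.ball x ρ) := by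
  have hseg : ∀ a b, segment ℝ a b ⊆ Ω → |v a - v b| ≤ M * ‖a - b‖ := fun a b h ↦
    abs_sub_le_of_segment_subset hS hSc hv hM (h.trans hΩS)
  by_cases hxf : x ∈ frontier Ω
  · obtain ⟨e, ψ, K, R, hR, h⟩ := hΩ.exists_graphChart hxf
    set κ : ℝ := (K : ℝ) + 1 with hκ
    have hκ0 : 0 < κ := by positivity
    refine ⟨M * (2 * (K + 1) + 1), R / (2 * κ + 2), by positivity,
      LipschitzOnWith.of_dist_le_mul fun y hy z hz ↦ ?_⟩
    set ρ := R / (2 * κ + 2) with hρ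
    have hρ0 : 0 < ρ := by positivity
    have hρR : ρ + κ * (2 * ρ) < R := by
      have : ρ * (2 * κ + 2) = R := by rw [hρ]; field_simp
      nlinarith
    -- During the crossing the height rises by at most ‖y - z‖ and the graph falls by at most K‖y -
    -- z‖. A descent of (K+1)‖y - z‖ absorbs both, and the choice of `ρ` keeps the path in the
    -- chart.
    set s := κ * ‖y - z‖ with hs
    have hs0 : 0 ≤ s := by positivity
    have hyx : ‖y - x‖ < ρ := by have := hy.2; rwa [mem_ball_iff_norm] at this
    have hzx : ‖z - x‖ < ρ := by have := hz.2; rwa [mem_ball_iff_norm] at this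
    have hyz : ‖y - z‖ ≤ 2 * ρ := by
      have := norm_sub_le_norm_sub_add_norm_sub y x z
      rw [norm_sub_rev x z] at this
      linarith
    have hsρ : ρ + s < R := by
      have : s ≤ κ * (2 * ρ) := by rw [hs]; gcongr
      linarith
    have hball : ∀ p : E d, ∀ t : ℝ, ‖p - x‖ < ρ → 0 ≤ t → t ≤ s → p - t • e ∈ Metric.ball x R := by
      intro p t hp ht0 hts
      rw [mem_ball_iff_norm, sub_right_comm]
      refine (norm_sub_le _ _).trans_lt ?_
      rw [norm_smul, h.1, Real.norm_of_nonneg ht0]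
      linarith
    have hproj : ∀ (p : E d) (t : ℝ), perpProj e (p - t • e) = perpProj e p := fun p t ↦ by
      rw [map_sub, map_smul, perpProj_self h.1, smul_zero, sub_zero]
    have hinn : ∀ (p : E d) (t : ℝ), inner ℝ e (p - t • e) = inner ℝ e p - t := fun p t ↦ by
      rw [inner_sub_right, inner_smul_right, real_inner_self_eq_norm_sq, h.1]; ring
    have hdown : ∀ p ∈ Ω, ‖p - x‖ < ρ → segment ℝ p (p - s • e) ⊆ Ω := by
      intro p hpΩ hp q hq
      rw [segment_eq_image'] at hq
      obtain ⟨θ, hθ, rfl⟩ := hq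
      have heq : p + θ • (p - s • e - p) = p - (θ * s) • e := by
        have h0 : p - s • e - p = -(s • e) := by abel
        rw [h0, smul_neg, ← mul_smul, ← sub_eq_add_neg]
      simp only
      rw [heq]
      have hts : θ * s ≤ s := mul_le_of_le_one_left hs0 hθ.2
      have ht0 : 0 ≤ θ * s := mul_nonneg hθ.1 hs0
      rw [h.mem_iff _ (hball p _ hp ht0 hts), hproj, hinn]
      have hp0 := hball p 0 hp le_rfl hs0
      rw [zero_smul, sub_zero] at hp0
      have := (h.mem_iff p hp0).1 hpΩ
      linarith
    have hacross : segment ℝ (y - s • e) (z - s • e) ⊆ Ω := by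
      intro q hq
      rw [segment_eq_image'] at hq
      obtain ⟨θ, hθ, rfl⟩ := hq
      have heq : (y - s • e) + θ • (z - s • e - (y - s • e)) = (y + θ • (z - y)) - s • e := by
        rw [sub_sub_sub_cancel_right]; abel
      simp only
      rw [heq]
      have hpx : ‖y + θ • (z - y) - x‖ < ρ := by
        have hc := (convex_ball x ρ).segment_subset hy.2 hz.2
        have : y + θ • (z - y) ∈ Metric.ball x ρ := hc (by
          rw [segment_eq_image']; exact ⟨θ, hθ, rfl⟩)
        rwa [mem_ball_iff_norm] at this
      rw [h.mem_iff _ (hball _ s hpx hs0 le_rfl), hproj, hinn]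
      have hy0 := hball y 0 hyx le_rfl hs0
      rw [zero_smul, sub_zero] at hy0
      have h1 := (h.mem_iff y hy0).1 hy.1
      have h2 := h.lipschitz.dist_le_mul (perpProj e y) (perpProj e (y + θ • (z - y)))
      rw [Real.dist_eq, dist_eq_norm, ← map_sub] at h2
      have h3 : ‖y - (y + θ • (z - y))‖ ≤ ‖y - z‖ := by
        rw [sub_add_cancel_left, norm_neg, norm_smul, Real.norm_of_nonneg hθ.1, norm_sub_rev z y]
        exact mul_le_of_le_one_left (norm_nonneg _) hθ.2
      have h4 : (K : ℝ) * ‖perpProj e (y - (y + θ • (z - y)))‖ ≤ K * ‖y - z‖ := by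
        gcongr; exact (norm_perpProj_le _).trans h3
      have h5 := (abs_le.1 h2).2
      have h6 := (abs_le.1 (abs_real_inner_le_norm e (θ • (z - y)))).2
      have h7 : ‖θ • (z - y)‖ ≤ ‖y - z‖ := by rwa [sub_add_cancel_left, norm_neg] at h3
      rw [h.1, one_mul] at h6
      rw [inner_add_right]
      have h8 : s = K * ‖y - z‖ + ‖y - z‖ := by rw [hs, hκ]; ring
      linarith
    have e1 := hseg _ _ (hdown y hy.1 hyx)
    have e2 := hseg _ _ hacross
    have e3 := hseg _ _ (hdown z hz.1 hzx)
    have hn : ∀ p : E d, ‖p - (p - s • e)‖ = s := fun p ↦ by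
      rw [sub_sub_cancel, norm_smul, h.1, Real.norm_of_nonneg hs0, mul_one]
    rw [hn] at e1 e3
    rw [sub_sub_sub_cancel_right] at e2
    rw [Real.dist_eq, dist_eq_norm]
    have tri : |v y - v z| ≤ |v y - v (y - s • e)| + |v (y - s • e) - v (z - s • e)| +
        |v z - v (z - s • e)| := by
      rw [abs_sub_comm (v z)]
      calc |v y - v z| = |(v y - v (y - s • e)) + (v (y - s • e) - v (z - s • e)) +
            (v (z - s • e) - v z)| := by ring_nf
        _ ≤ _ := (abs_add_le _ _).trans (add_le_add (abs_add_le _ _) le_rfl)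
    push_cast
    calc |v y - v z| ≤ M * s + M * ‖y - z‖ + M * s := by linarith
      _ = _ := by rw [hs, hκ]; ring
  · have hxΩ : x ∈ Ω := by
      by_contra h
      exact hxf ⟨hx, fun hi ↦ h (interior_subset hi)⟩
    obtain ⟨ρ, hρ, hb⟩ := Metric.isOpen_iff.1 hΩ.1 x hxΩ
    refine ⟨M, ρ, hρ, LipschitzOnWith.of_dist_le_mul fun y hy z hz ↦ ?_⟩
    rw [Real.dist_eq, dist_eq_norm]
    exact hseg y z (((convex_ball x ρ).segment_subset hy.2 hz.2).trans hb)

/-- Finite element functions are restrictions of Lipschitz functions. -/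
theorem exists_lipschitz_extension {Ω : Set (E d)} (hΩ : IsLipschitzDomain Ω)
    {bg : Finset (Set (E d))} (hbg : IsBackgroundMesh bg Ω)
    {P : Submodule ℝ (MvPolynomial (Fin d) ℝ)} {v : E d → ℝ} (hv : v ∈ feSpace bg Ω P) :
    ∃ (C : ℝ≥0) (g : E d → ℝ), LipschitzWith C g ∧ Set.EqOn v g (closure Ω) := by
  have hS := finite_activeMesh bg Ω
  have hlip : ∀ T ∈ activeMesh bg Ω, ∃ M : ℝ≥0, LipschitzOnWith M v T := by
    intro T hT
    have hc := hbg.isConvexCell hT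
    obtain ⟨p, -, hp⟩ := exists_polyFun_eqOn hv hT
    have hd : ContDiff ℝ 1 (polyFun p) := contDiff_polyFun p
    obtain ⟨N, hN⟩ := hc.isCompact.exists_bound_of_continuousOn
      (hd.continuous_fderiv (by simp)).continuousOn
    refine ⟨N.toNNReal, ?_⟩
    have h1 : LipschitzOnWith N.toNNReal (polyFun p) T :=
      hc.convex.lipschitzOnWith_of_nnnorm_fderiv_le
        (fun x _ ↦ (hd.differentiable (by simp)).differentiableAt)
        fun x hx ↦ NNReal.le_toNNReal_of_coe_le (hN x hx)
    intro x hx y hy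
    rw [hp hx, hp hy]
    exact h1 hx hy
  choose! M hM using hlip
  have hlip2 : ∀ T ∈ activeMesh bg Ω, LipschitzOnWith (∑ T ∈ hS.toFinset, M T) v T :=
    fun T hT ↦ (hM T hT).weaken
      (Finset.single_le_sum (f := M) (fun _ _ ↦ zero_le) (hS.mem_toFinset.2 hT))
  have hvc : ContinuousOn v (closure Ω) := hv.1.mono hbg.closure_subset_activeMesh
  have hloc : LocallyLipschitzOn (closure Ω) v := by
    intro x hx
    obtain ⟨C, ρ, hρ, h⟩ := exists_lipschitzOnWith_inter_ball hΩ hS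
      (fun T hT ↦ (hbg.isConvexCell hT).isClosed) hv.1 hlip2 hbg.subset_activeMesh hx
    refine ⟨C, closure Ω ∩ Metric.ball x ρ,
      inter_mem_nhdsWithin _ (Metric.ball_mem_nhds x hρ), ?_⟩
    -- Continuity of v carries the bound from Ω to boundary points; compactness then makes it
    -- global, and a real-valued Lipschitz function extends to the whole space.
    have h2 : LipschitzOnWith C v (closure (Ω ∩ Metric.ball x ρ)) :=
      h.closure (hvc.mono (closure_mono Set.inter_subset_left))
    exact h2.mono Metric.isOpen_ball.closure_inter
  obtain ⟨C, hC⟩ := hloc.exists_lipschitzOnWith_of_compact hΩ.isCompact_closure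
  obtain ⟨g, hg, hvg⟩ := hC.extend_real
  exact ⟨C, g, hg, hvg⟩

end Mesh

/-! ### Green's identity for H² functions and Lipschitz test functions. -/

section Green

theorem trace_spec {Ω : Set (E d)} (hΩ : IsLipschitzDomain Ω) {w : E d → ℝ}
    (hw : MemH1 Ω w) : HasTrace Ω w (trace Ω w) := by
  have h := hasTrace_of_memH1 hΩ hw
  rw [trace, dif_pos h]
  exact h.choose_spec

theorem memLp_trace (Ω : Set (E d)) (w : E d → ℝ) : MemLp (trace Ω w) 2 (surf Ω) := by
  by_cases h : ∃ γ, HasTrace Ω w γ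
  · rw [trace, dif_pos h]
    exact h.choose_spec.1
  · rw [trace, dif_neg h]
    exact MemLp.zero

theorem memLp_normalDeriv {Ω : Set (E d)} (hΩ : IsLipschitzDomain Ω) (u : E d → ℝ) :
    MemLp (normalDeriv Ω u) 2 (surf Ω) := by
  unfold normalDeriv
  refine memLp_finsetSum _ fun i _ ↦ ?_
  have hm : AEMeasurable (fun x ↦ outerNormal Ω x i) (surf Ω) := by
    have : Measurable fun y : E d ↦ y i := (EuclideanSpace.proj (𝕜 := ℝ) i).continuous.measurable
    exact this.comp_aemeasurable hΩ.aemeasurable_outerNormal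
  refine (memLp_trace Ω (weakPartial Ω i u)).of_le
    ((memLp_trace Ω _).1.mul hm.aestronglyMeasurable) (.of_forall fun x ↦ ?_)
  rw [norm_mul]
  exact mul_le_of_le_one_right (norm_nonneg _)
    ((PiLp.norm_apply_le _ i).trans (norm_outerNormal_le Ω x))

/-- Green's identity for `u ∈ H²(Ω)` and a Lipschitz test function. -/
theorem MemH2.green {Ω : Set (E d)} (hΩ : IsLipschitzDomain Ω) {u v : E d → ℝ}
    (hu : MemH2 Ω u) {C : ℝ≥0} (hv : LipschitzWith C v) :
    (∫ x in Ω, inner ℝ (weakGrad Ω u x) (gradient v x)) + ∫ x in Ω, laplacian Ω u x * v x =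
      ∫ x, normalDeriv Ω u x * v x ∂surf Ω := by
  set b : Fin d → E d := fun i ↦ EuclideanSpace.single i 1 with hb
  have hib : ∀ (x : E d) i, inner ℝ x (b i) = x i := fun x i ↦ by
    simp [hb, EuclideanSpace.inner_single_right]
  have hib' : ∀ (x : E d) i, inner ℝ (b i) x = x i := fun x i ↦ by
    rw [real_inner_comm]; exact hib x i
  -- Integration by parts for ∂ᵢu ∈ H¹ in the i-th direction; the sum over i is Green's identity.
  have key : ∀ i, (∫ x in Ω, weakPartial Ω i u x * fderiv ℝ v x (b i)) +
      ∫ x in Ω, weakPartial Ω i (weakPartial Ω i u) x * v x =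
      ∫ x, trace Ω (weakPartial Ω i u) x * (v x * outerNormal Ω x i) ∂surf Ω := by
    intro i
    have h1 := (trace_spec hΩ (hu.2 i)).integral_mul_fderiv_add hΩ (hu.2 i) hv (b i)
    have m1 := memLp_fderiv_apply_of_lipschitzWith hΩ.2.1 hv (b i)
    have m2 := Continuous.memLp_restrict hv.continuous hΩ
    have m3 : MemLp (fun x ↦ inner ℝ (weakGrad Ω (weakPartial Ω i u) x) (b i)) 2
      (volume.restrict Ω) := (hu.2 i).2.2.inner_const (b i)
    rw [integral_add (f := fun x ↦ weakPartial Ω i u x * fderiv ℝ v x (b i))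
      (g := fun x ↦ inner ℝ (weakGrad Ω (weakPartial Ω i u) x) (b i) * v x)
      ((hu.2 i).1.integrable_mul m1) (m3.integrable_mul m2)] at h1
    simp only [hib, hib'] at h1
    exact h1
  have m2 := Continuous.memLp_restrict hv.continuous hΩ
  have hsum := Finset.sum_congr (rfl : (Finset.univ : Finset (Fin d)) = Finset.univ)
    fun i _ ↦ key i
  rw [Finset.sum_add_distrib] at hsum
  rw [← integral_finsetSum, ← integral_finsetSum, ← integral_finsetSum] at hsum
  · have e1 : (fun x ↦ inner ℝ (weakGrad Ω u x) (gradient v x)) =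
        fun x ↦ ∑ i, weakPartial Ω i u x * fderiv ℝ v x (b i) := by
      funext x
      rw [PiLp.inner_apply]
      refine Finset.sum_congr rfl fun i _ ↦ ?_
      rw [← inner_gradient_eq, hib]
      simp [weakPartial, mul_comm]
    have e2 : (fun x ↦ laplacian Ω u x * v x) =
        fun x ↦ ∑ i, weakPartial Ω i (weakPartial Ω i u) x * v x := by
      funext x
      rw [laplacian, Finset.sum_mul]
    have e3 : (fun x ↦ normalDeriv Ω u x * v x) =
        fun x ↦ ∑ i, trace Ω (weakPartial Ω i u) x * (v x * outerNormal Ω x i) := by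
      funext x
      rw [normalDeriv, Finset.sum_mul]
      exact Finset.sum_congr rfl fun i _ ↦ by ring
    rw [e1, e2, e3]
    exact hsum
  · intro i _
    have := memLp_mul_inner_outerNormal hΩ hv.continuous (b i)
    simp only [hib'] at this
    exact (memLp_trace Ω (weakPartial Ω i u)).integrable_mul this
  · intro i _
    have m3 : MemLp (fun x ↦ inner ℝ (weakGrad Ω (weakPartial Ω i u) x) (b i)) 2
      (volume.restrict Ω) := (hu.2 i).2.2.inner_const (b i)
    simp only [hib] at m3
    exact m3.integrable_mul m2
  · intro i _
    exact (hu.2 i).1.integrable_mul (memLp_fderiv_apply_of_lipschitzWith hΩ.2.1 hv (b i))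

end Green


/-! ### Maximal Rayleigh quotients, polynomial functions, operations on the finite element space. -/

section Eigenproblem

/-- The generalised eigenvalue problem for a positive definite and a positive semidefinite form
on a finite-dimensional space has a largest eigenvalue, and it is the maximum of the Rayleigh
quotient. -/
theorem exists_max_eigenvector {W : Type*} [AddCommGroup W] [Module ℝ W] [FiniteDimensional ℝ W]
    [Nontrivial W] (A B : W →ₗ[ℝ] W →ₗ[ℝ] ℝ) (hAs : ∀ x y, A x y = A y x)
    (hBs : ∀ x y, B x y = B y x) (hA : ∀ x, x ≠ 0 → 0 < A x x) :
    ∃ w ≠ 0, ∃ μ : ℝ, (∀ v, B w v = μ * A w v) ∧ ∀ v, B v v ≤ μ * A v v := by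
  set n := Module.finrank ℝ W with hn
  let e : W ≃ₗ[ℝ] EuclideanSpace ℝ (Fin n) :=
    LinearEquiv.ofFinrankEq _ _ (by simp [hn])
  have hcont : ∀ D : W →ₗ[ℝ] W →ₗ[ℝ] ℝ, Continuous fun x ↦ D (e.symm x) (e.symm x) := by
    intro D
    let D' : EuclideanSpace ℝ (Fin n) →ₗ[ℝ] (EuclideanSpace ℝ (Fin n) →L[ℝ] ℝ) :=
      LinearMap.toContinuousLinearMap.toLinearMap ∘ₗ (D.compl₁₂ e.symm.toLinearMap e.symm.toLinearMap)
    have h1 : Continuous D' := D'.continuous_of_finiteDimensional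
    exact h1.clm_apply continuous_id
  have hne : (Metric.sphere (0 : EuclideanSpace ℝ (Fin n)) 1).Nonempty := by
    have : Nontrivial (EuclideanSpace ℝ (Fin n)) := e.symm.toEquiv.nontrivial
    exact NormedSpace.sphere_nonempty.2 zero_le_one
  have hs0 : ∀ x ∈ Metric.sphere (0 : EuclideanSpace ℝ (Fin n)) 1, e.symm x ≠ 0 := by
    intro x hx h
    rw [map_eq_zero_iff _ e.symm.injective] at h
    simp [h] at hx
  obtain ⟨x₀, hx₀, hmax⟩ := (isCompact_sphere (0 : EuclideanSpace ℝ (Fin n)) 1).exists_isMaxOn hne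
    (f := fun x ↦ B (e.symm x) (e.symm x) / A (e.symm x) (e.symm x))
    ((hcont B).continuousOn.div (hcont A).continuousOn fun x hx ↦ (hA _ (hs0 x hx)).ne')
  set w := e.symm x₀ with hw
  set μ := B w w / A w w with hμ
  have hw0 : w ≠ 0 := hs0 x₀ hx₀
  have hle : ∀ v, B v v ≤ μ * A v v := by
    intro v
    by_cases hv : v = 0
    · simp [hv]
    have hev : e v ≠ 0 := (map_ne_zero_iff _ e.injective).2 hv
    have hmem : ‖e v‖⁻¹ • e v ∈ Metric.sphere (0 : EuclideanSpace ℝ (Fin n)) 1 := by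
      simp [norm_smul, hev]
    have h := hmax hmem
    simp only [Set.mem_ofPred_eq, map_smul, LinearEquiv.symm_apply_apply, LinearMap.smul_apply,
      smul_eq_mul] at h
    have hr : ‖e v‖⁻¹ ≠ 0 := inv_ne_zero (norm_ne_zero_iff.2 hev)
    rw [mul_div_mul_left _ _ hr, mul_div_mul_left _ _ hr] at h
    exact (div_le_iff₀ (hA v hv)).1 h
  have hww : B w w = μ * A w w := by rw [hμ, div_mul_cancel₀ _ (hA w hw0).ne']
  refine ⟨w, hw0, μ, fun v ↦ ?_, hle⟩
  set c := μ * A w v - B w v with hc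
  -- First-order optimality at the maximiser: a nonnegative quadratic in t without constant term has
  -- no linear term either, which is the eigenvalue equation tested with v.
  have hQ : ∀ t : ℝ, 0 ≤ (μ * A v v - B v v) * (t * t) + 2 * c * t + 0 := by
    intro t
    have h := hle (w + t • v)
    simp only [map_add, map_smul, LinearMap.add_apply, LinearMap.smul_apply, smul_eq_mul] at h
    rw [hAs v w, hBs v w, hww] at h
    rw [hc]
    linarith
  have hdis := discrim_le_zero hQ
  rw [discrim] at hdis
  have : c = 0 := by
    have : c ^ 2 ≤ 0 := by linarith
    exact pow_eq_zero_iff (two_ne_zero) |>.1 (le_antisymm this (sq_nonneg c))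
  rw [hc] at this
  linarith

theorem gradient_add {F : Type*} [NormedAddCommGroup F] [InnerProductSpace ℝ F]
    [CompleteSpace F] {f g : F → ℝ} {x : F} (hf : DifferentiableAt ℝ f x)
    (hg : DifferentiableAt ℝ g x) : gradient (f + g) x = gradient f x + gradient g x := by
  simp only [gradient, fderiv_add hf hg, map_add]

theorem gradient_sub {F : Type*} [NormedAddCommGroup F] [InnerProductSpace ℝ F]
    [CompleteSpace F] {f g : F → ℝ} {x : F} (hf : DifferentiableAt ℝ f x)
    (hg : DifferentiableAt ℝ g x) : gradient (f - g) x = gradient f x - gradient g x := by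
  simp only [gradient, fderiv_sub hf hg, map_sub]

theorem gradient_const_smul {F : Type*} [NormedAddCommGroup F] [InnerProductSpace ℝ F]
    [CompleteSpace F] {f : F → ℝ} {x : F} (c : ℝ) (hf : DifferentiableAt ℝ f x) :
    gradient (c • f) x = c • gradient f x := by
  simp only [gradient, fderiv_const_smul hf, map_smul]

/-- A polynomial whose gradient vanishes on a nonempty open set is constant. -/
theorem polyFun_eq_const_of_gradient_eq_zero (p : MvPolynomial (Fin d) ℝ) {U : Set (E d)}
    (hU : IsOpen U) (hne : U.Nonempty) (h : ∀ x ∈ U, gradient (polyFun p) x = 0) (x y : E d) :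
    polyFun p x = polyFun p y := by
  have han : AnalyticOnNhd ℝ (polyFun p) Set.univ :=
    AnalyticOnNhd.eval_continuousLinearMap' (𝕜 := ℝ) (B := ℝ)
      (fun i : Fin d ↦ (EuclideanSpace.proj i : E d →L[ℝ] ℝ)) p
  obtain ⟨z, hz⟩ := hne
  have h0 : fderiv ℝ (polyFun p) = fun _ ↦ 0 := by
    refine han.fderiv.eq_of_eventuallyEq (z₀ := z) (fun _ _ ↦ analyticAt_const) ?_
    filter_upwards [hU.mem_nhds hz] with w hw
    rw [← norm_eq_zero, ← norm_gradient_eq, h w hw, norm_zero]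
  exact is_const_of_fderiv_eq_zero ((contDiff_polyFun p (n := 1)).differentiable (by simp))
    (fun w ↦ congrFun h0 w) x y

theorem polyFun_eq_zero_of_eqOn (p : MvPolynomial (Fin d) ℝ) {T : Set (E d)}
    (hT : IsConvexCell T) (h : ∀ x ∈ T, polyFun p x = 0) : polyFun p = 0 := by
  obtain ⟨z, hz⟩ := hT.interior_nonempty
  funext x
  rw [polyFun_eq_const_of_gradient_eq_zero p isOpen_interior hT.interior_nonempty
    (fun x hx ↦ ?_) x z]
  · exact h z (interior_subset hz)
  · rw [gradient_eq_of_mem_interior (T := T) (f := fun _ ↦ 0) (fun y hy ↦ h y hy) hx]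
    simp [gradient]

section FESpace

variable {bg : Finset (Set (E d))} {Ω : Set (E d)} {P : Submodule ℝ (MvPolynomial (Fin d) ℝ)}

theorem feSpace_add {v w : E d → ℝ} (hv : v ∈ feSpace bg Ω P) (hw : w ∈ feSpace bg Ω P) :
    v + w ∈ feSpace bg Ω P := by
  refine ⟨hv.1.add hw.1, fun T hT ↦ ?_⟩
  obtain ⟨p, hp, hpe⟩ := hv.2 T hT
  obtain ⟨q, hq, hqe⟩ := hw.2 T hT
  exact ⟨p + q, P.add_mem hp hq, fun x hx ↦ by simp [hpe x hx, hqe x hx]⟩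

theorem feSpace_smul {v : E d → ℝ} (c : ℝ) (hv : v ∈ feSpace bg Ω P) :
    c • v ∈ feSpace bg Ω P := by
  refine ⟨hv.1.const_smul c, fun T hT ↦ ?_⟩
  obtain ⟨p, hp, hpe⟩ := hv.2 T hT
  exact ⟨c • p, P.smul_mem c hp, fun x hx ↦ by simp [hpe x hx]⟩

theorem feSpace_sub {v w : E d → ℝ} (hv : v ∈ feSpace bg Ω P) (hw : w ∈ feSpace bg Ω P) :
    v - w ∈ feSpace bg Ω P := by
  rw [sub_eq_add_neg, ← neg_one_smul ℝ w]
  exact feSpace_add hv (feSpace_smul _ hw)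

theorem polyFun_mem_feSpace {p : MvPolynomial (Fin d) ℝ} (hp : p ∈ P) :
    polyFun p ∈ feSpace bg Ω P :=
  ⟨(contDiff_polyFun p (n := 0)).continuous.continuousOn, fun _ _ ↦ ⟨p, hp, fun _ _ ↦ rfl⟩⟩

variable {k : ℕ}

theorem IsLocalPolySpace.restrictTotalDegree_le (hP : IsLocalPolySpace bg k P) :
    MvPolynomial.restrictTotalDegree (Fin d) ℝ k ≤ P := by
  rcases hP with rfl | ⟨-, rfl⟩
  · exact le_rfl
  · exact MvPolynomial.restrictTotalDegree_le_restrictDegree _ _ k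

theorem IsLocalPolySpace.finiteDimensional (hP : IsLocalPolySpace bg k P) :
    FiniteDimensional ℝ P := by
  rcases hP with rfl | ⟨-, rfl⟩ <;> infer_instance

theorem IsLocalPolySpace.C_mem (hP : IsLocalPolySpace bg k P) (c : ℝ) : MvPolynomial.C c ∈ P :=
  hP.restrictTotalDegree_le (by simp [MvPolynomial.mem_restrictTotalDegree])

theorem IsLocalPolySpace.X_mem (hP : IsLocalPolySpace bg k P) (hk : 1 ≤ k) (i : Fin d) :
    MvPolynomial.X i ∈ P :=
  hP.restrictTotalDegree_le (by simpa [MvPolynomial.mem_restrictTotalDegree] using hk)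

end FESpace

end Eigenproblem


/-! ### The local eigenvalue problem on polynomials. -/

section LocalEigenproblem

variable {bg : Finset (Set (E d))} {Ω : Set (E d)} {P : Submodule ℝ (MvPolynomial (Fin d) ℝ)}
  {T : Set (E d)}

/-- The polynomial functions of mean zero on `T` that agree on `T` with a finite element
function. -/
def localPolySpace (bg : Finset (Set (E d))) (Ω : Set (E d))
    (P : Submodule ℝ (MvPolynomial (Fin d) ℝ)) (T : Set (E d)) (hT : IsCompact T) :
    Submodule ℝ (E d → ℝ) where
  carrier := {f | (∃ p ∈ P, f = polyFun p) ∧ (∃ v ∈ feSpace bg Ω P, Set.EqOn v f T) ∧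
    ∫ x in T, f x = 0}
  zero_mem' := ⟨⟨0, P.zero_mem, by ext x; simp [polyFun]⟩,
    ⟨polyFun 0, polyFun_mem_feSpace P.zero_mem, fun x _ ↦ by simp [polyFun]⟩, by simp⟩
  add_mem' := by
    rintro _ _ ⟨⟨p, hp, rfl⟩, ⟨v, hv, hvp⟩, h1⟩ ⟨⟨q, hq, rfl⟩, ⟨w, hw, hwq⟩, h2⟩
    refine ⟨⟨p + q, P.add_mem hp hq, (polyFun_add p q).symm⟩,
      ⟨v + w, feSpace_add hv hw, fun x hx ↦ by simp [hvp hx, hwq hx]⟩, ?_⟩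
    have hi : ∀ p : MvPolynomial (Fin d) ℝ, IntegrableOn (polyFun p) T := fun p ↦
      (contDiff_polyFun p (n := 0)).continuous.continuousOn.integrableOn_compact hT
    simp only [Pi.add_apply]
    rw [integral_add (hi p) (hi q), h1, h2, add_zero]
  smul_mem' := by
    rintro c _ ⟨⟨p, hp, rfl⟩, ⟨v, hv, hvp⟩, h1⟩
    refine ⟨⟨c • p, P.smul_mem c hp, (polyFun_smul c p).symm⟩,
      ⟨c • v, feSpace_smul c hv, fun x hx ↦ by simp [hvp hx]⟩, ?_⟩
    simp only [Pi.smul_apply]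
    rw [integral_smul, h1, smul_zero]

theorem localPolySpace_contDiff {hT : IsCompact T} (f : localPolySpace bg Ω P T hT) :
    ContDiff ℝ 1 (f : E d → ℝ) := by
  obtain ⟨⟨p, -, hp⟩, -⟩ := f.2
  rw [hp]
  exact contDiff_polyFun p

theorem localPolySpace_finiteDimensional (hT : IsCompact T) [FiniteDimensional ℝ P] :
    FiniteDimensional ℝ (localPolySpace bg Ω P T hT) := by
  let φ : P →ₗ[ℝ] (E d → ℝ) :=
    { toFun := fun p ↦ polyFun p
      map_add' := fun p q ↦ polyFun_add _ _
      map_smul' := fun c p ↦ polyFun_smul _ _ }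
  refine Submodule.finiteDimensional_of_le (S₂ := LinearMap.range φ) ?_
  rintro f ⟨⟨p, hp, rfl⟩, -⟩
  exact ⟨⟨p, hp⟩, rfl⟩

theorem nonempty_interior_inter (hΩ : IsOpen Ω) (hT : IsConvexCell T) (h : (T ∩ Ω).Nonempty) :
    (Ω ∩ interior T).Nonempty := by
  obtain ⟨x, hxT, hxΩ⟩ := h
  exact mem_closure_iff.1 (hT.subset_closure_interior hxT) Ω hΩ hxΩ

theorem integrableOn_inner_gradient (hT : IsCompact T) (Ω : Set (E d)) {f g : E d → ℝ}
    (hf : ContDiff ℝ 1 f) (hg : ContDiff ℝ 1 g) :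
    IntegrableOn (fun x ↦ inner ℝ (gradient f x) (gradient g x)) (Ω ∩ T) :=
  (((continuous_gradient hf).inner (continuous_gradient hg)).continuousOn.integrableOn_compact
    hT).mono_set Set.inter_subset_right

theorem integrable_normal_mul_normal (hΩ : IsLipschitzDomain Ω) {F G : E d → E d}
    (hF : Continuous F) (hG : Continuous G) :
    Integrable (fun x ↦ inner ℝ (F x) (outerNormal Ω x) * inner ℝ (G x) (outerNormal Ω x))
      (surf Ω) := by
  obtain ⟨M, hM⟩ := hΩ.isCompact_frontier.exists_bound_of_continuousOn hF.continuousOn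
  obtain ⟨N, hN⟩ := hΩ.isCompact_frontier.exists_bound_of_continuousOn hG.continuousOn
  have hn : ∀ {F : E d → E d} {M : ℝ}, (∀ x ∈ frontier Ω, ‖F x‖ ≤ M) → ∀ x ∈ frontier Ω,
      ‖inner ℝ (F x) (outerNormal Ω x)‖ ≤ M := fun h x hx ↦
    (norm_inner_le_norm _ _).trans ((mul_le_of_le_one_right (norm_nonneg _)
      (norm_outerNormal_le Ω x)).trans (h x hx))
  refine integrable_surf_of_bound hΩ (AEStronglyMeasurable.mul ?_ ?_) (M := M * N) fun x hx ↦ ?_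
  · exact (hF.aestronglyMeasurable (μ := surf Ω)).inner
      hΩ.aemeasurable_outerNormal.aestronglyMeasurable
  · exact (hG.aestronglyMeasurable (μ := surf Ω)).inner
      hΩ.aemeasurable_outerNormal.aestronglyMeasurable
  · rw [norm_mul]
    exact mul_le_mul (hn hM x hx) (hn hN x hx) (norm_nonneg _)
      ((norm_nonneg _).trans (hM x hx))

/-- The Dirichlet form on the cut element. -/
noncomputable def volumeForm {hT : IsCompact T} :
    localPolySpace bg Ω P T hT →ₗ[ℝ] localPolySpace bg Ω P T hT →ₗ[ℝ] ℝ :=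
  have hd : ∀ (f : localPolySpace bg Ω P T hT) (x), DifferentiableAt ℝ (f : E d → ℝ) x :=
    fun f x ↦ (localPolySpace_contDiff f).differentiable (by simp) x
  have hi : ∀ f g : localPolySpace bg Ω P T hT, IntegrableOn
      (fun x ↦ inner ℝ (gradient (f : E d → ℝ) x) (gradient (g : E d → ℝ) x)) (Ω ∩ T) :=
    fun f g ↦ integrableOn_inner_gradient hT Ω (localPolySpace_contDiff f)
      (localPolySpace_contDiff g)
  LinearMap.mk₂ ℝ
    (fun f g ↦ ∫ x in Ω ∩ T, inner ℝ (gradient (f : E d → ℝ) x) (gradient (g : E d → ℝ) x))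
    (fun f f' g ↦ by
      rw [← integral_add (hi f g) (hi f' g)]
      refine integral_congr_ae (.of_forall fun x ↦ ?_)
      simp only [Submodule.coe_add]
      rw [gradient_add (hd f x) (hd f' x), inner_add_left])
    (fun c f g ↦ by
      rw [smul_eq_mul, ← integral_const_mul]
      refine integral_congr_ae (.of_forall fun x ↦ ?_)
      simp only [Submodule.coe_smul]
      rw [gradient_const_smul c (hd f x), real_inner_smul_left])
    (fun f g g' ↦ by
      rw [← integral_add (hi f g) (hi f g')]
      refine integral_congr_ae (.of_forall fun x ↦ ?_)
      simp only [Submodule.coe_add]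
      rw [gradient_add (hd g x) (hd g' x), inner_add_right])
    (fun c f g ↦ by
      rw [smul_eq_mul, ← integral_const_mul]
      refine integral_congr_ae (.of_forall fun x ↦ ?_)
      simp only [Submodule.coe_smul]
      rw [gradient_const_smul c (hd g x), real_inner_smul_right])

/-- The form given by the normal derivatives on the boundary inside the element. -/
noncomputable def boundaryForm {hT : IsCompact T} (hΩ : IsLipschitzDomain Ω) :
    localPolySpace bg Ω P T hT →ₗ[ℝ] localPolySpace bg Ω P T hT →ₗ[ℝ] ℝ :=
  have hd : ∀ (f : localPolySpace bg Ω P T hT) (x), DifferentiableAt ℝ (f : E d → ℝ) x :=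
    fun f x ↦ (localPolySpace_contDiff f).differentiable (by simp) x
  have hi : ∀ f g : localPolySpace bg Ω P T hT, IntegrableOn
      (fun x ↦ inner ℝ (gradient (f : E d → ℝ) x) (outerNormal Ω x) *
        inner ℝ (gradient (g : E d → ℝ) x) (outerNormal Ω x)) T (surf Ω) :=
    fun f g ↦ (integrable_normal_mul_normal hΩ (continuous_gradient (localPolySpace_contDiff f))
      (continuous_gradient (localPolySpace_contDiff g))).integrableOn
  LinearMap.mk₂ ℝ
    (fun f g ↦ ∫ x in T, inner ℝ (gradient (f : E d → ℝ) x) (outerNormal Ω x) *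
        inner ℝ (gradient (g : E d → ℝ) x) (outerNormal Ω x) ∂surf Ω)
    (fun f f' g ↦ by
      rw [← integral_add (hi f g) (hi f' g)]
      refine integral_congr_ae (.of_forall fun x ↦ ?_)
      simp only [Submodule.coe_add]
      rw [gradient_add (hd f x) (hd f' x), inner_add_left, add_mul])
    (fun c f g ↦ by
      rw [smul_eq_mul, ← integral_const_mul]
      refine integral_congr_ae (.of_forall fun x ↦ ?_)
      simp only [Submodule.coe_smul]
      rw [gradient_const_smul c (hd f x), real_inner_smul_left, mul_assoc])
    (fun f g g' ↦ by
      rw [← integral_add (hi f g) (hi f g')]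
      refine integral_congr_ae (.of_forall fun x ↦ ?_)
      simp only [Submodule.coe_add]
      rw [gradient_add (hd g x) (hd g' x), inner_add_left, mul_add])
    (fun c f g ↦ by
      rw [smul_eq_mul, ← integral_const_mul]
      refine integral_congr_ae (.of_forall fun x ↦ ?_)
      simp only [Submodule.coe_smul]
      rw [gradient_const_smul c (hd g x), real_inner_smul_left, mul_left_comm])

/-- If the form vanishes at f, then ∇f = 0 on the nonempty open set Ω ∩ int T, so the polynomial f
is constant, and mean zero on T makes it zero. -/
theorem volumeForm_pos {hT : IsCompact T} (hΩ : IsLipschitzDomain Ω) (hTc : IsConvexCell T)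
    (hne : (T ∩ Ω).Nonempty) (f : localPolySpace bg Ω P T hT) (hf : f ≠ 0) :
    0 < volumeForm f f := by
  have hc := localPolySpace_contDiff f
  have h0 : 0 ≤ volumeForm f f := integral_nonneg fun x ↦ real_inner_self_nonneg
  refine h0.lt_of_ne fun h ↦ hf ?_
  have h1 : (fun x ↦ inner ℝ (gradient (f : E d → ℝ) x) (gradient (f : E d → ℝ) x))
      =ᵐ[volume.restrict (Ω ∩ T)] 0 :=
    (integral_eq_zero_iff_of_nonneg (fun x ↦ real_inner_self_nonneg)
      (integrableOn_inner_gradient hT Ω hc hc)).1 h.symm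
  have hU : IsOpen (Ω ∩ interior T) := hΩ.1.inter isOpen_interior
  have hgc := (continuous_gradient hc).inner (continuous_gradient hc) (𝕜 := ℝ)
  have h2 : Set.EqOn (fun x ↦ inner ℝ (gradient (f : E d → ℝ) x) (gradient (f : E d → ℝ) x))
      0 (Ω ∩ interior T) :=
    Measure.eqOn_open_of_ae_eq
      (ae_restrict_of_ae_restrict_of_subset
        (Set.inter_subset_inter_right _ interior_subset) h1) hU hgc.continuousOn
      continuousOn_const
  obtain ⟨⟨p, -, hp⟩, -, hint⟩ := f.2
  have hne' := nonempty_interior_inter hΩ.1 hTc hne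
  have hconst := polyFun_eq_const_of_gradient_eq_zero p hU hne' fun x hx ↦ by
    rw [← hp]
    exact inner_self_eq_zero.1 (h2 hx)
  ext x
  have hcx : ∀ y, (f : E d → ℝ) y = (f : E d → ℝ) x := fun y ↦ by rw [hp]; exact hconst y x
  simp only [hcx, setIntegral_const, smul_eq_mul] at hint
  rcases mul_eq_zero.1 hint with h3 | h3
  · exfalso
    have : 0 < volume.real T := by
      refine ENNReal.toReal_pos ?_ hT.measure_lt_top.ne
      exact (Measure.measure_pos_of_nonempty_interior volume hTc.interior_nonempty).ne'
    exact this.ne' h3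
  · exact h3

/-- Functions of V_h carry irrelevant values off T. Passing to the polynomial on T removes this
ambiguity and leads to a finite-dimensional vector space. -/
theorem exists_localPolySpace_eqOn (hTc : IsConvexCell T) (hTm : T ∈ activeMesh bg Ω)
    {v : E d → ℝ} (hv : v ∈ localSpace (feSpace bg Ω P) T) :
    ∃ f : localPolySpace bg Ω P T hTc.isCompact, Set.EqOn v f T := by
  obtain ⟨p, hp, hvp⟩ := exists_polyFun_eqOn hv.1 hTm
  refine ⟨⟨polyFun p, ⟨p, hp, rfl⟩, ⟨v, hv.1, hvp⟩, ?_⟩, hvp⟩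
  rw [← setIntegral_congr_fun hTc.isClosed.measurableSet hvp]
  exact hv.2

theorem exists_localSpace_eqOn (hTc : IsConvexCell T)
    (f : localPolySpace bg Ω P T hTc.isCompact) :
    ∃ v ∈ localSpace (feSpace bg Ω P) T, Set.EqOn v f T := by
  obtain ⟨-, ⟨v, hv, hvf⟩, h⟩ := f.2
  refine ⟨v, ⟨hv, ?_⟩, hvf⟩
  rw [setIntegral_congr_fun hTc.isClosed.measurableSet hvf]
  exact h

theorem volumeForm_eq (hTc : IsConvexCell T) (hΩ : IsLipschitzDomain Ω) {v w : E d → ℝ}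
    {f g : localPolySpace bg Ω P T hTc.isCompact} (hv : Set.EqOn v f T) (hw : Set.EqOn w g T) :
    ∫ x in Ω ∩ T, inner ℝ (gradientWithin v T x) (gradientWithin w T x) = volumeForm f g := by
  refine setIntegral_congr_fun (hΩ.1.measurableSet.inter hTc.isClosed.measurableSet) fun x hx ↦ ?_
  rw [hTc.gradientWithin_eq (localPolySpace_contDiff f) hv hx.2,
    hTc.gradientWithin_eq (localPolySpace_contDiff g) hw hx.2]

theorem boundaryForm_eq (hTc : IsConvexCell T) (hΩ : IsLipschitzDomain Ω) {v w : E d → ℝ}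
    {f g : localPolySpace bg Ω P T hTc.isCompact} (hv : Set.EqOn v f T) (hw : Set.EqOn w g T) :
    ∫ x in T, elemNormalDeriv Ω T v x * elemNormalDeriv Ω T w x ∂surf Ω =
      boundaryForm hΩ f g := by
  refine setIntegral_congr_fun hTc.isClosed.measurableSet fun x hx ↦ ?_
  simp only [elemNormalDeriv]
  rw [hTc.gradientWithin_eq (localPolySpace_contDiff f) hv hx,
    hTc.gradientWithin_eq (localPolySpace_contDiff g) hw hx]

/-- Removing the mean over `T` from a function of `V_h` leads to the local space. -/
theorem exists_localSpace_sub_const {k : ℕ} (hP : IsLocalPolySpace bg k P)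
    (hTc : IsConvexCell T) {v : E d → ℝ} (hv : v ∈ feSpace bg Ω P)
    (hvT : ContinuousOn v T) :
    ∃ c : ℝ, (v - fun _ ↦ c) ∈ localSpace (feSpace bg Ω P) T := by
  have hpos : 0 < volume.real T :=
    ENNReal.toReal_pos
      (Measure.measure_pos_of_nonempty_interior volume hTc.interior_nonempty).ne'
      hTc.isCompact.measure_lt_top.ne
  refine ⟨(∫ x in T, v x) / volume.real T, ?_, ?_⟩
  · have : (fun _ : E d ↦ (∫ x in T, v x) / volume.real T) =
        polyFun (MvPolynomial.C ((∫ x in T, v x) / volume.real T)) := by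
      ext x; simp [polyFun]
    rw [this]
    exact feSpace_sub hv (polyFun_mem_feSpace (hP.C_mem _))
  · simp only [Pi.sub_apply]
    rw [integral_sub (hvT.integrableOn_compact hTc.isCompact)
      (integrableOn_const hTc.isCompact.measure_lt_top.ne), setIntegral_const, smul_eq_mul,
      mul_div_cancel₀ _ hpos.ne', sub_self]

end LocalEigenproblem


/-! ### Existence, sign and inverse inequality of the stabilisation parameter. -/

section StabParam

variable {bg : Finset (Set (E d))} {Ω : Set (E d)} {P : Submodule ℝ (MvPolynomial (Fin d) ℝ)}
  {T : Set (E d)} {k : ℕ}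

/-- The coordinate functions minus their means, available because k ≥ 1. They show that the local
space is nontrivial and detect every normal direction. -/
theorem exists_coordinate_localPolySpace (hP : IsLocalPolySpace bg k P) (hk : 1 ≤ k)
    (hTc : IsConvexCell T) (i : Fin d) :
    ∃ f : localPolySpace bg Ω P T hTc.isCompact,
      ∀ x, gradient (f : E d → ℝ) x = EuclideanSpace.single i 1 := by
  have hX : polyFun (MvPolynomial.X i) ∈ feSpace bg Ω P := polyFun_mem_feSpace (hP.X_mem hk i)
  obtain ⟨c, hc, hc0⟩ := exists_localSpace_sub_const (bg := bg) (Ω := Ω) hP hTc hX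
    (contDiff_polyFun _ (n := 0)).continuous.continuousOn
  have heq : (polyFun (MvPolynomial.X i) - fun _ : E d ↦ c) =
      polyFun (MvPolynomial.X i - MvPolynomial.C c) := by
    ext x; simp [polyFun]
  rw [heq] at hc hc0
  refine ⟨⟨_, ⟨_, P.sub_mem (hP.X_mem hk i) (hP.C_mem c), rfl⟩, ⟨_, hc, fun _ _ ↦ rfl⟩, hc0⟩,
    fun x ↦ ext_inner_right ℝ fun v ↦ ?_⟩
  rw [inner_gradient_eq]
  have h1 : polyFun (MvPolynomial.X i - MvPolynomial.C c) =
      fun x : E d ↦ (EuclideanSpace.proj i : E d →L[ℝ] ℝ) x - c := by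
    ext x; simp [polyFun]
  simp only [h1]
  rw [fderiv_sub_const, ContinuousLinearMap.fderiv, EuclideanSpace.inner_single_left]
  simp

/-- This makes the supremum in `stabParam` a maximum, equal to the best constant in the inverse
inequality. -/
theorem exists_greatest_localEigenvalue (hd : 1 ≤ d) (hΩ : IsLipschitzDomain Ω)
    (hP : IsLocalPolySpace bg k P) (hk : 1 ≤ k) (hTc : IsConvexCell T)
    (hTm : T ∈ activeMesh bg Ω) :
    ∃ μ, IsGreatest {μ | IsLocalEigenvalue Ω (feSpace bg Ω P) T μ} μ ∧
      ∀ f : localPolySpace bg Ω P T hTc.isCompact,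
        boundaryForm hΩ f f ≤ μ * volumeForm f f := by
  have hfin := hP.finiteDimensional
  have hfin' := localPolySpace_finiteDimensional (bg := bg) (Ω := Ω) (P := P) hTc.isCompact
  have hnt : Nontrivial (localPolySpace bg Ω P T hTc.isCompact) := by
    obtain ⟨f, hf⟩ := exists_coordinate_localPolySpace (Ω := Ω) hP hk hTc ⟨0, hd⟩
    refine ⟨f, 0, fun h ↦ ?_⟩
    have := hf 0
    rw [h] at this
    have h2 := congrArg (fun y : E d ↦ y ⟨0, hd⟩) this
    simp [gradient] at h2
  have hApos := volumeForm_pos (bg := bg) (P := P) (hT := hTc.isCompact) hΩ hTc hTm.2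
  obtain ⟨w, hw0, μ, hw, hle⟩ := exists_max_eigenvector
    (volumeForm (bg := bg) (Ω := Ω) (P := P) (hT := hTc.isCompact))
    (boundaryForm (bg := bg) (P := P) (hT := hTc.isCompact) hΩ)
    (fun f g ↦ integral_congr_ae (.of_forall fun x ↦ real_inner_comm _ _))
    (fun f g ↦ integral_congr_ae (.of_forall fun x ↦ mul_comm _ _)) hApos
  refine ⟨μ, ⟨?_, ?_⟩, hle⟩
  · obtain ⟨v, hv, hvw⟩ := exists_localSpace_eqOn hTc w
    refine ⟨v, hv, ?_, fun z hz ↦ ?_⟩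
    -- The eigenfunction must be nonzero at a point of T; a polynomial vanishing on T vanishes
    -- everywhere, since T has interior points.
    · by_contra! h
      refine hw0 ?_
      obtain ⟨p, -, hp⟩ := w.2.1
      ext x
      rw [hp, polyFun_eq_zero_of_eqOn p hTc fun y hy ↦ by rw [← hp, ← hvw hy, h y hy]]
      rfl
    · obtain ⟨g, hg⟩ := exists_localPolySpace_eqOn hTc hTm hz
      rw [boundaryForm_eq hTc hΩ hvw hg, volumeForm_eq hTc hΩ hvw hg, hw g]
  · rintro ν ⟨v, hv, ⟨x, hx, hvx⟩, h⟩
    obtain ⟨f, hf⟩ := exists_localPolySpace_eqOn hTc hTm hv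
    have hf0 : f ≠ 0 := by
      rintro rfl
      exact hvx (hf hx)
    have h1 := h v hv
    rw [boundaryForm_eq hTc hΩ hf hf, volumeForm_eq hTc hΩ hf hf] at h1
    have h2 := hle f
    rw [h1] at h2
    exact le_of_mul_le_mul_right h2 (hApos f hf0)

/-- The inverse inequality that the stabilisation parameter encodes. -/
theorem two_mul_boundaryForm_le (hd : 1 ≤ d) (hΩ : IsLipschitzDomain Ω)
    (hP : IsLocalPolySpace bg k P) (hk : 1 ≤ k) (hTc : IsConvexCell T)
    (hTm : T ∈ activeMesh bg Ω) (f : localPolySpace bg Ω P T hTc.isCompact) :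
    2 * boundaryForm hΩ f f ≤ stabParam Ω (feSpace bg Ω P) T * volumeForm f f := by
  obtain ⟨μ, hμ, hle⟩ := exists_greatest_localEigenvalue hd hΩ hP hk hTc hTm
  rw [stabParam, hμ.csSup_eq]
  linarith [hle f]

theorem volumeForm_self_nonneg {hT : IsCompact T} (f : localPolySpace bg Ω P T hT) :
    0 ≤ volumeForm f f :=
  integral_nonneg fun _ ↦ real_inner_self_nonneg

/-- Summed over the coordinate functions, the boundary form gives ∫ |n|² = surf(T) > 0. With a
nonpositive parameter the inverse inequality would make every summand nonpositive. -/
theorem stabParam_pos (hd : 1 ≤ d) (hΩ : IsLipschitzDomain Ω)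
    (hP : IsLocalPolySpace bg k P) (hk : 1 ≤ k) (hTc : IsConvexCell T)
    (hTm : T ∈ activeMesh bg Ω) (hT : surf Ω T ≠ 0) :
    0 < stabParam Ω (feSpace bg Ω P) T := by
  have hfinm := hΩ.isFiniteMeasure_surf
  by_contra! h0
  choose f hf using exists_coordinate_localPolySpace (bg := bg) (Ω := Ω) hP hk hTc
  have h1 : ∀ i, boundaryForm hΩ (f i) (f i) ≤ 0 := fun i ↦ by
    have := two_mul_boundaryForm_le hd hΩ hP hk hTc hTm (f i)
    have h2 := mul_nonpos_of_nonpos_of_nonneg h0 (volumeForm_self_nonneg (f i))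
    linarith
  have h2 : ∑ i, boundaryForm hΩ (f i) (f i) = (surf Ω).real T := by
    change ∑ i, (∫ x in T, inner ℝ (gradient (f i : E d → ℝ) x) (outerNormal Ω x) *
        inner ℝ (gradient (f i : E d → ℝ) x) (outerNormal Ω x) ∂surf Ω) = _
    rw [← integral_finsetSum]
    · have : ∀ᵐ x ∂(surf Ω).restrict T,
          ∑ i, inner ℝ (gradient (f i : E d → ℝ) x) (outerNormal Ω x) *
            inner ℝ (gradient (f i : E d → ℝ) x) (outerNormal Ω x) = (1 : ℝ) := by
        filter_upwards [ae_restrict_of_ae hΩ.ae_isOuterNormal] with x hx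
        simp only [hf, EuclideanSpace.inner_single_left]
        have h3 := hx.1
        rw [EuclideanSpace.norm_eq, Real.sqrt_eq_one] at h3
        refine Eq.trans (Finset.sum_congr rfl fun i _ ↦ ?_) h3
        simp [sq]
      rw [integral_congr_ae this]
      simp
    · intro i _
      exact (integrable_normal_mul_normal hΩ
        (continuous_gradient (localPolySpace_contDiff (f i)))
        (continuous_gradient (localPolySpace_contDiff (f i)))).integrableOn
  have h3 : 0 < (surf Ω).real T := ENNReal.toReal_pos hT (measure_ne_top _ _)
  have h4 := Finset.sum_nonpos fun i (_ : i ∈ Finset.univ) ↦ h1 i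
  rw [h2] at h4
  exact h4.not_gt h3

theorem stabParam_nonneg (hd : 1 ≤ d) (hΩ : IsLipschitzDomain Ω)
    (hP : IsLocalPolySpace bg k P) (hk : 1 ≤ k) (hTc : IsConvexCell T)
    (hTm : T ∈ activeMesh bg Ω) : 0 ≤ stabParam Ω (feSpace bg Ω P) T := by
  have hne : ∃ f : localPolySpace bg Ω P T hTc.isCompact, f ≠ 0 := by
    obtain ⟨f, hf⟩ := exists_coordinate_localPolySpace (Ω := Ω) hP hk hTc ⟨0, hd⟩
    refine ⟨f, fun h ↦ ?_⟩
    have := hf 0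
    rw [h] at this
    have h2 := congrArg (fun y : E d ↦ y ⟨0, hd⟩) this
    simp [gradient] at h2
  obtain ⟨f, hf⟩ := hne
  have h1 := two_mul_boundaryForm_le hd hΩ hP hk hTc hTm f
  have h2 : 0 ≤ boundaryForm hΩ f f := integral_nonneg fun _ ↦ mul_self_nonneg _
  exact nonneg_of_mul_nonneg_left (by linarith) (volumeForm_pos hΩ hTc hTm.2 f hf)

/-- The inverse inequality on one element, for all functions of `V_h`. -/
theorem setIntegral_sq_elemNormalDeriv_le (hd : 1 ≤ d) (hΩ : IsLipschitzDomain Ω)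
    (hP : IsLocalPolySpace bg k P) (hk : 1 ≤ k) (hTc : IsConvexCell T)
    (hTm : T ∈ activeMesh bg Ω) {v : E d → ℝ} (hv : v ∈ feSpace bg Ω P) :
    2 * ∫ x in T, elemNormalDeriv Ω T v x ^ 2 ∂surf Ω ≤
      stabParam Ω (feSpace bg Ω P) T * ∫ x in Ω ∩ T, ‖gradientWithin v T x‖ ^ 2 := by
  have hvT : ContinuousOn v T := hv.1.mono (Set.subset_biUnion_of_mem (u := fun S ↦ S) hTm)
  obtain ⟨c, hc⟩ := exists_localSpace_sub_const hP hTc hv hvT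
  obtain ⟨f, hf⟩ := exists_localPolySpace_eqOn hTc hTm hc
  have hgr : ∀ x, gradientWithin (v - fun _ ↦ c) T x = gradientWithin v T x := fun x ↦ by
    have : (v - fun _ ↦ c) = fun y ↦ v y - c := rfl
    rw [gradientWithin, gradientWithin, this, fderivWithin_sub_const]
  have h := two_mul_boundaryForm_le hd hΩ hP hk hTc hTm f
  rw [← boundaryForm_eq hTc hΩ hf hf, ← volumeForm_eq hTc hΩ hf hf] at h
  simp only [elemNormalDeriv, hgr, real_inner_self_eq_norm_sq, ← sq] at h
  exact h

end StabParam


/-! ### Abstract coercivity, continuity and the constant 11. -/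

section QuasiOptimality

/-- The difference of the two sides is 4G² - 10qb + 4b² - q², at least 7q² - 10qb + 4b² by
hypothesis; this is positive definite because 25 < 28. The factor two in λ_T provides the
hypothesis. -/
theorem form_coercive {G q b : ℝ} (h : 2 * q ^ 2 ≤ G ^ 2) :
    G ^ 2 + q ^ 2 + b ^ 2 ≤ 5 * (G ^ 2 - 2 * (q * b) + b ^ 2) := by
  nlinarith [sq_nonneg (9 * q - 5 * b), sq_nonneg (7 * q - 5 * b), sq_nonneg (q - b),
    sq_nonneg (5 * q - 4 * b)]

/-- Cauchy-Schwarz for (G, q, b) and the permuted triple (G', b', q') bounds the first three terms;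
the last product is bounded separately, whence the factor 2. -/
theorem form_continuous (G q b G' q' b' : ℝ) :
    G * G' + q * b' + q' * b + b * b' ≤
      2 * (√(G ^ 2 + q ^ 2 + b ^ 2) * √(G' ^ 2 + q' ^ 2 + b' ^ 2)) := by
  rw [← Real.sqrt_mul (by positivity)]
  have h1 : G * G' + q * b' + q' * b ≤
      √((G ^ 2 + q ^ 2 + b ^ 2) * (G' ^ 2 + q' ^ 2 + b' ^ 2)) := by
    refine Real.le_sqrt_of_sq_le ?_
    nlinarith [sq_nonneg (G * q' - b' * b), sq_nonneg (G * b' - q * G'),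
      sq_nonneg (G * q' - b * G'), sq_nonneg (q * q' - b * b')]
  have h2 : b * b' ≤ √((G ^ 2 + q ^ 2 + b ^ 2) * (G' ^ 2 + q' ^ 2 + b' ^ 2)) := by
    refine Real.le_sqrt_of_sq_le ?_
    rw [mul_pow]
    refine mul_le_mul ?_ ?_ (by positivity) (by positivity) <;> nlinarith
  linarith

variable {X Y : Type*} [NormedAddCommGroup X] [NormedAddCommGroup Y]

/-- The abstract energy norm of a triple. -/
noncomputable def tripleNorm (G : X) (q b : Y) : ℝ := √(‖G‖ ^ 2 + ‖q‖ ^ 2 + ‖b‖ ^ 2)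

theorem tripleNorm_sub_le (G G' : X) (q q' b b' : Y) :
    tripleNorm (G - G') (q - q') (b - b') ≤ tripleNorm G q b + tripleNorm G' q' b' := by
  have key : ∀ (G : X) (q b : Y),
      tripleNorm G q b = ‖WithLp.toLp 2 (G, WithLp.toLp 2 (q, b))‖ := fun G q b ↦ by
    rw [tripleNorm, ← Real.sqrt_sq (norm_nonneg (WithLp.toLp 2 (G, WithLp.toLp 2 (q, b)))),
      WithLp.prod_norm_sq_eq_of_L2]
    rw [WithLp.prod_norm_sq_eq_of_L2, add_assoc]
    rfl
  rw [key, key, key]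
  refine le_trans (le_of_eq ?_) (norm_sub_le _ _)
  rfl

variable [InnerProductSpace ℝ X] [InnerProductSpace ℝ Y]

/-- The quasi-optimality estimate that follows from coercivity and continuity of the form. -/
theorem tripleNorm_sub_le_of_orthogonal (G G' : X) (q q' b b' : Y)
    (hinv : 2 * ‖q'‖ ^ 2 ≤ ‖G'‖ ^ 2)
    (horth : inner ℝ G G' - inner ℝ q b' - inner ℝ q' b + inner ℝ b b' =
      inner ℝ G' G' - inner ℝ q' b' - inner ℝ q' b' + inner ℝ b' b') :
    tripleNorm (G - G') (q - q') (b - b') ≤ 11 * tripleNorm G q b := by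
  have hcoer := form_coercive (b := ‖b'‖) hinv
  have hcont := form_continuous ‖G‖ ‖q‖ ‖b‖ ‖G'‖ ‖q'‖ ‖b'‖
  change _ ≤ 2 * (tripleNorm G q b * tripleNorm G' q' b') at hcont
  have e1 := real_inner_le_norm q' b'
  have e2 := real_inner_le_norm G G'
  have e3 := (abs_le.1 (abs_real_inner_le_norm q b')).1
  have e4 := (abs_le.1 (abs_real_inner_le_norm q' b)).1
  have e5 := real_inner_le_norm b b'
  rw [real_inner_self_eq_norm_sq, real_inner_self_eq_norm_sq] at horth
  have hN : tripleNorm G' q' b' ^ 2 = ‖G'‖ ^ 2 + ‖q'‖ ^ 2 + ‖b'‖ ^ 2 :=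
    Real.sq_sqrt (by positivity)
  have hN0 : 0 ≤ tripleNorm G' q' b' := Real.sqrt_nonneg _
  have hM0 : 0 ≤ tripleNorm G q b := Real.sqrt_nonneg _
  -- Here 10 = 5 · 2 from coercivity and continuity; the triangle inequality below adds one more.
  have hle : tripleNorm G' q' b' ^ 2 ≤ 10 * tripleNorm G q b * tripleNorm G' q' b' := by
    rw [hN]
    linarith
  have hle' : tripleNorm G' q' b' ≤ 10 * tripleNorm G q b := by
    rcases hN0.eq_or_lt with h | h
    · rw [← h]; positivity
    · exact le_of_mul_le_mul_right (by rwa [← sq]) h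
  linarith [tripleNorm_sub_le G G' q q' b b']

end QuasiOptimality

/-! ### Integrability of discrete quantities and the global inverse inequality. -/

section Assignment

variable {bg : Finset (Set (E d))} {Ω : Set (E d)} {P : Submodule ℝ (MvPolynomial (Fin d) ℝ)}
  {el : E d → Set (E d)} {k : ℕ}

theorem IsElementAssignment.aestronglyMeasurable (hel : IsElementAssignment bg Ω el)
    {F : Set (E d) → E d → ℝ}
    (hF : ∀ T ∈ activeMesh bg Ω, AEStronglyMeasurable (F T) (surf Ω)) :
    AEStronglyMeasurable (fun x ↦ F (el x) x) (surf Ω) := by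
  classical
  have hS := finite_activeMesh bg Ω
  have h1 : AEStronglyMeasurable (fun x ↦ ∑ T ∈ hS.toFinset,
      {x | x ∈ frontier Ω ∧ el x = T}.indicator (F T) x) (surf Ω) :=
    Finset.aestronglyMeasurable_fun_sum _ fun T hT ↦
      (hF T (hS.mem_toFinset.1 hT)).indicator (hel.2 T (hS.mem_toFinset.1 hT))
  refine h1.congr ?_
  filter_upwards [ae_surf_mem_frontier Ω] with x hx
  rw [Finset.sum_eq_single (el x)]
  · exact Set.indicator_of_mem (s := {y | y ∈ frontier Ω ∧ el y = el x}) ⟨hx, rfl⟩ _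
  · intro T _ hT
    exact Set.indicator_of_notMem (fun h ↦ hT h.2.symm) _
  · intro h
    exact absurd (hS.mem_toFinset.2 (hel.1 x hx).1) h

theorem IsElementAssignment.memLp_mul (hel : IsElementAssignment bg Ω el)
    (c : Set (E d) → ℝ) {q : E d → ℝ} (hq : MemLp q 2 (surf Ω)) :
    MemLp (fun x ↦ c (el x) * q x) 2 (surf Ω) := by
  have hS := finite_activeMesh bg Ω
  have hm : AEStronglyMeasurable (fun x ↦ c (el x)) (surf Ω) :=
    hel.aestronglyMeasurable (F := fun T _ ↦ c T) fun _ _ ↦ aestronglyMeasurable_const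
  refine MemLp.of_le_mul (c := ∑ T ∈ hS.toFinset, |c T|) hq (hm.mul hq.1) ?_
  filter_upwards [ae_surf_mem_frontier Ω] with x hx
  rw [norm_mul]
  gcongr
  exact Finset.single_le_sum (f := fun T ↦ |c T|) (fun _ _ ↦ abs_nonneg _)
    (hS.mem_toFinset.2 (hel.1 x hx).1)

/-- The elementwise polynomials of a finite element function. -/
theorem exists_elementwise_polynomial {v : E d → ℝ} (hv : v ∈ feSpace bg Ω P) :
    ∃ p : Set (E d) → MvPolynomial (Fin d) ℝ,
      ∀ T ∈ activeMesh bg Ω, Set.EqOn v (polyFun (p T)) T := by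
  have h : ∀ T ∈ activeMesh bg Ω, ∃ p, Set.EqOn v (polyFun p) T := fun T hT ↦ by
    obtain ⟨p, -, h⟩ := exists_polyFun_eqOn hv hT
    exact ⟨p, h⟩
  choose! p hp using h
  exact ⟨p, hp⟩

theorem elemNormalDeriv_eq (hbg : IsBackgroundMesh bg Ω) {v : E d → ℝ} {T : Set (E d)}
    (hT : T ∈ activeMesh bg Ω) {p : MvPolynomial (Fin d) ℝ} (hp : Set.EqOn v (polyFun p) T)
    {x : E d} (hx : x ∈ T) :
    elemNormalDeriv Ω T v x = inner ℝ (gradient (polyFun p) x) (outerNormal Ω x) := by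
  rw [elemNormalDeriv, (hbg.isConvexCell hT).gradientWithin_eq (contDiff_polyFun p) hp hx]

theorem memLp_elemNormalDeriv (hΩ : IsLipschitzDomain Ω) (hbg : IsBackgroundMesh bg Ω)
    (hel : IsElementAssignment bg Ω el) {v : E d → ℝ} (hv : v ∈ feSpace bg Ω P) :
    MemLp (fun x ↦ elemNormalDeriv Ω (el x) v x) 2 (surf Ω) := by
  have hfin := hΩ.isFiniteMeasure_surf
  have hS := finite_activeMesh bg Ω
  obtain ⟨p, hp⟩ := exists_elementwise_polynomial hv
  have hc : ∀ T, Continuous (gradient (polyFun (p T))) := fun T ↦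
    continuous_gradient (contDiff_polyFun _)
  have hm : AEStronglyMeasurable
      (fun x ↦ inner ℝ (gradient (polyFun (p (el x))) x) (outerNormal Ω x)) (surf Ω) :=
    hel.aestronglyMeasurable
      (F := fun T x ↦ inner ℝ (gradient (polyFun (p T)) x) (outerNormal Ω x)) fun T _ ↦
        ((hc T).aestronglyMeasurable (μ := surf Ω)).inner
          hΩ.aemeasurable_outerNormal.aestronglyMeasurable
  have hb : ∀ T, ∃ M, ∀ x ∈ frontier Ω, ‖gradient (polyFun (p T)) x‖ ≤ M := fun T ↦
    hΩ.isCompact_frontier.exists_bound_of_continuousOn (hc T).continuousOn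
  choose M hM using hb
  have heq : (fun x ↦ inner ℝ (gradient (polyFun (p (el x))) x) (outerNormal Ω x))
      =ᵐ[surf Ω] fun x ↦ elemNormalDeriv Ω (el x) v x := by
    filter_upwards [ae_surf_mem_frontier Ω] with x hx
    have := hel.1 x hx
    rw [elemNormalDeriv_eq hbg this.1 (hp _ this.1) this.2]
  refine MemLp.ae_eq heq (MemLp.of_bound hm (∑ T ∈ hS.toFinset, |M T|) ?_)
  filter_upwards [ae_surf_mem_frontier Ω] with x hx
  refine (norm_inner_le_norm _ _).trans ((mul_le_of_le_one_right (norm_nonneg _)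
    (norm_outerNormal_le Ω x)).trans ((hM _ x hx).trans ((le_abs_self _).trans ?_)))
  exact Finset.single_le_sum (f := fun T ↦ |M T|) (fun _ _ ↦ abs_nonneg _)
    (hS.mem_toFinset.2 (hel.1 x hx).1)

theorem elemNormalDeriv_sub (hbg : IsBackgroundMesh bg Ω) {v w : E d → ℝ}
    (hv : v ∈ feSpace bg Ω P) (hw : w ∈ feSpace bg Ω P) {T : Set (E d)}
    (hT : T ∈ activeMesh bg Ω) {x : E d} (hx : x ∈ T) :
    elemNormalDeriv Ω T (v - w) x = elemNormalDeriv Ω T v x - elemNormalDeriv Ω T w x := by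
  obtain ⟨p, -, hp⟩ := exists_polyFun_eqOn hv hT
  obtain ⟨q, -, hq⟩ := exists_polyFun_eqOn hw hT
  have hpq : Set.EqOn (v - w) (polyFun (p - q)) T := fun y hy ↦ by
    simp [hp hy, hq hy, polyFun]
  have hsub : polyFun (p - q) = polyFun p - polyFun q := by ext y; simp [polyFun]
  have hd : ∀ p : MvPolynomial (Fin d) ℝ, DifferentiableAt ℝ (polyFun p) x := fun p ↦
    (contDiff_polyFun p (n := 1)).differentiable (by simp) x
  rw [elemNormalDeriv_eq hbg hT hp hx, elemNormalDeriv_eq hbg hT hq hx,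
    elemNormalDeriv_eq hbg hT hpq hx, hsub, gradient_sub (hd p) (hd q), inner_sub_left]

/-- Only almost everywhere: on element interfaces the functions may fail to be differentiable and
`gradient` takes default values. -/
theorem ae_gradient_sub (hΩ : IsLipschitzDomain Ω) (hbg : IsBackgroundMesh bg Ω)
    {v w : E d → ℝ} (hv : v ∈ feSpace bg Ω P) (hw : w ∈ feSpace bg Ω P) :
    ∀ᵐ x ∂volume.restrict Ω, gradient (v - w) x = gradient v x - gradient w x := by
  rw [ae_restrict_iff' hΩ.1.measurableSet]
  filter_upwards [hbg.ae_mem_interior] with x hx hxΩ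
  obtain ⟨T, hT, hxT⟩ := hx hxΩ
  have hd : ∀ v ∈ feSpace bg Ω P, DifferentiableAt ℝ v x := fun v hv ↦ by
    obtain ⟨p, -, hp⟩ := exists_polyFun_eqOn hv hT
    have h1 := (contDiff_polyFun p (n := 1)).differentiable (by simp) x
    refine h1.congr_of_eventuallyEq ?_
    filter_upwards [mem_interior_iff_mem_nhds.1 hxT] with y hy using hp hy
  exact gradient_sub (hd v hv) (hd w hw)

theorem memLp_gradient_feSpace (hΩ : IsLipschitzDomain Ω) (hbg : IsBackgroundMesh bg Ω)
    {v : E d → ℝ} (hv : v ∈ feSpace bg Ω P) :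
    MemLp (gradient v) 2 (volume.restrict Ω) := by
  have hfin := isFiniteMeasure_restrict hΩ.2.1
  obtain ⟨C, g, hg, hvg⟩ := exists_lipschitz_extension hΩ hbg hv
  have heq : gradient g =ᵐ[volume.restrict Ω] gradient v := by
    filter_upwards [ae_restrict_mem hΩ.1.measurableSet] with x hx
    refine (gradient_eq_of_mem_interior (hvg.mono subset_closure) ?_).symm
    rwa [hΩ.1.interior_eq]
  refine MemLp.ae_eq heq (MemLp.of_bound
    (measurable_gradient_of_continuous g).aestronglyMeasurable C (.of_forall fun x ↦ ?_))
  rw [norm_gradient_eq]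
  exact norm_fderiv_le_of_lipschitz ℝ hg

theorem memLp_surf_feSpace (hΩ : IsLipschitzDomain Ω) (hbg : IsBackgroundMesh bg Ω)
    {v : E d → ℝ} (hv : v ∈ feSpace bg Ω P) : MemLp v 2 (surf Ω) := by
  obtain ⟨C, g, hg, hvg⟩ := exists_lipschitz_extension hΩ hbg hv
  refine MemLp.ae_eq ?_ (Continuous.memLp_surf hg.continuous hΩ)
  filter_upwards [ae_surf_mem_frontier Ω] with x hx using (hvg hx.1).symm

/-- The finitely many elements that meet ∂Ω in a null set can be discarded; on the others the
parameter is positive. -/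
theorem ae_stabParam_pos (hd : 1 ≤ d) (hΩ : IsLipschitzDomain Ω) (hbg : IsBackgroundMesh bg Ω)
    (hP : IsLocalPolySpace bg k P) (hk : 1 ≤ k) (hel : IsElementAssignment bg Ω el) :
    ∀ᵐ x ∂surf Ω, 0 < stabParam Ω (feSpace bg Ω P) (el x) := by
  have h : ∀ᵐ x ∂surf Ω, ∀ T ∈ activeMesh bg Ω, surf Ω T = 0 → x ∉ T := by
    refine (ae_ball_iff (finite_activeMesh bg Ω).countable).2 fun T hT ↦ ?_
    by_cases h0 : surf Ω T = 0
    · filter_upwards [measure_eq_zero_iff_ae_notMem.1 h0] with x hx _ using hx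
    · exact .of_forall fun x h ↦ absurd h h0
  filter_upwards [h, ae_surf_mem_frontier Ω] with x hx hxf
  have := hel.1 x hxf
  exact stabParam_pos hd hΩ hP hk (hbg.isConvexCell this.1) this.1
    fun h0 ↦ hx _ this.1 h0 this.2

/-- The global inverse inequality. -/
theorem integral_inv_stabParam_mul_sq_le (hd : 1 ≤ d) (hΩ : IsLipschitzDomain Ω)
    (hbg : IsBackgroundMesh bg Ω) (hP : IsLocalPolySpace bg k P) (hk : 1 ≤ k)
    (hel : IsElementAssignment bg Ω el) {v : E d → ℝ} (hv : v ∈ feSpace bg Ω P) :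
    2 * ∫ x, (stabParam Ω (feSpace bg Ω P) (el x))⁻¹ * elemNormalDeriv Ω (el x) v x ^ 2 ∂surf Ω ≤
      ∫ x in Ω, ‖gradient v x‖ ^ 2 := by
  have hfin := hΩ.isFiniteMeasure_surf
  have hS := finite_activeMesh bg Ω
  set L := stabParam Ω (feSpace bg Ω P) with hL
  set S : Set (E d) → Set (E d) := fun T ↦ {x | x ∈ frontier Ω ∧ el x = T} with hSdef
  have hint : Integrable (fun x ↦ (L (el x))⁻¹ * elemNormalDeriv Ω (el x) v x ^ 2) (surf Ω) := by
    have h1 := memLp_elemNormalDeriv hΩ hbg hel hv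
    have h2 := (hel.memLp_mul (fun T ↦ (L T)⁻¹) h1).integrable_mul h1
    refine h2.congr (.of_forall fun x ↦ ?_)
    simp only [Pi.mul_apply]
    ring
  have hcover : (surf Ω).restrict (⋃ T ∈ hS.toFinset, S T) = surf Ω := by
    refine Measure.restrict_eq_self_of_ae_mem ?_
    filter_upwards [ae_surf_mem_frontier Ω] with x hx
    exact Set.mem_biUnion (hS.mem_toFinset.2 (hel.1 x hx).1) ⟨hx, rfl⟩
  have hdisj : Set.Pairwise (hS.toFinset : Set (Set (E d))) (Function.onFun Disjoint S) := by
    intro T _ T' _ hne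
    refine Set.disjoint_left.2 fun x hx hx' ↦ hne ?_
    rw [← hx.2, ← hx'.2]
  -- Disjoint interiors allow the volume terms to be summed without overlap. Closed elements may
  -- share faces, but these are null sets.
  have hdisj' : Set.Pairwise (hS.toFinset : Set (Set (E d)))
      (Function.onFun Disjoint fun T ↦ Ω ∩ interior T) := by
    intro T hT T' hT' hne
    exact (hbg.2.1 T (hS.mem_toFinset.1 hT).1 T' (hS.mem_toFinset.1 hT').1 hne).mono
      Set.inter_subset_right Set.inter_subset_right
  have hgi : IntegrableOn (fun x ↦ ‖gradient v x‖ ^ 2) Ω :=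
    (memLp_gradient_feSpace hΩ hbg hv).norm.integrable_sq
  have hT : ∀ T ∈ hS.toFinset,
      2 * ∫ x in S T, (L (el x))⁻¹ * elemNormalDeriv Ω (el x) v x ^ 2 ∂surf Ω ≤
        ∫ x in Ω ∩ interior T, ‖gradient v x‖ ^ 2 := by
    intro T hT
    have hTm := hS.mem_toFinset.1 hT
    have hTc := hbg.isConvexCell hTm
    have hL0 : 0 ≤ L T := stabParam_nonneg hd hΩ hP hk hTc hTm
    obtain ⟨p, -, hp⟩ := exists_polyFun_eqOn hv hTm
    have e1 : ∫ x in S T, (L (el x))⁻¹ * elemNormalDeriv Ω (el x) v x ^ 2 ∂surf Ω =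
        (L T)⁻¹ * ∫ x in S T, elemNormalDeriv Ω T v x ^ 2 ∂surf Ω := by
      rw [← integral_const_mul]
      refine setIntegral_congr_fun (hel.2 T hTm) fun x hx ↦ ?_
      rw [hx.2]
    have hsub : S T ⊆ T := fun x hx ↦ by
      have := (hel.1 x hx.1).2
      rwa [hx.2] at this
    have hiT : IntegrableOn (fun x ↦ elemNormalDeriv Ω T v x ^ 2) T (surf Ω) := by
      have hc := continuous_gradient (contDiff_polyFun p (n := 1))
      refine (integrable_normal_mul_normal hΩ hc hc).integrableOn.congr_fun (fun x hx ↦ ?_)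
        hTc.isClosed.measurableSet
      simp only
      rw [elemNormalDeriv_eq hbg hTm hp hx, sq]
    have e2 : ∫ x in S T, elemNormalDeriv Ω T v x ^ 2 ∂surf Ω ≤
        ∫ x in T, elemNormalDeriv Ω T v x ^ 2 ∂surf Ω :=
      setIntegral_mono_set hiT (.of_forall fun x ↦ sq_nonneg _) hsub.eventuallyLE
    have e3 := setIntegral_sq_elemNormalDeriv_le hd hΩ hP hk hTc hTm hv
    have e4 : ∫ x in Ω ∩ T, ‖gradientWithin v T x‖ ^ 2 =
        ∫ x in Ω ∩ interior T, ‖gradient v x‖ ^ 2 := by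
      have hae : (Ω ∩ interior T : Set (E d)) =ᵐ[volume] (Ω ∩ T : Set (E d)) := by
        refine EventuallyEq.inter (ae_eq_refl _) ?_
        exact interior_ae_eq_of_null_frontier (hTc.convex.addHaar_frontier volume)
      rw [← setIntegral_congr_set hae]
      refine setIntegral_congr_fun (hΩ.1.inter isOpen_interior).measurableSet fun x hx ↦ ?_
      rw [hTc.gradientWithin_eq (contDiff_polyFun p) hp (interior_subset hx.2),
        gradient_eq_of_mem_interior hp hx.2]
    rw [e4] at e3
    have e5 : 0 ≤ ∫ x in Ω ∩ interior T, ‖gradient v x‖ ^ 2 :=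
      integral_nonneg fun _ ↦ sq_nonneg _
    rw [e1]
    rcases hL0.eq_or_lt with h0 | h0
    -- For λ_T = 0 the inverse is 0 by convention, so the left-hand side vanishes.
    · rw [← h0]; simpa using e5
    · rw [← mul_assoc, mul_comm 2, mul_assoc, inv_mul_le_iff₀ h0]
      exact (mul_le_mul_of_nonneg_left e2 zero_le_two).trans e3
  calc 2 * ∫ x, (L (el x))⁻¹ * elemNormalDeriv Ω (el x) v x ^ 2 ∂surf Ω
      = ∑ T ∈ hS.toFinset,
          2 * ∫ x in S T, (L (el x))⁻¹ * elemNormalDeriv Ω (el x) v x ^ 2 ∂surf Ω := by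
        rw [← Finset.mul_sum, ← integral_biUnion_finset _
          (fun T hT ↦ hel.2 T (hS.mem_toFinset.1 hT)) hdisj fun T _ ↦ hint.integrableOn, hcover]
    _ ≤ ∑ T ∈ hS.toFinset, ∫ x in Ω ∩ interior T, ‖gradient v x‖ ^ 2 := Finset.sum_le_sum hT
    _ = ∫ x in ⋃ T ∈ hS.toFinset, Ω ∩ interior T, ‖gradient v x‖ ^ 2 := by
        rw [integral_biUnion_finset _ (fun T _ ↦ (hΩ.1.inter isOpen_interior).measurableSet) hdisj'
          fun T _ ↦ hgi.mono_set Set.inter_subset_left]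
    _ ≤ ∫ x in Ω, ‖gradient v x‖ ^ 2 :=
        setIntegral_mono_set hgi (.of_forall fun x ↦ sq_nonneg _)
          (Set.iUnion₂_subset fun _ _ ↦ Set.inter_subset_left).eventuallyLE

end Assignment


/-! ### The energy norm as a Hilbert space norm. -/

section EnergyNorm

theorem inner_toLp_toLp {α F : Type*} [MeasurableSpace α] {μ : Measure α} [NormedAddCommGroup F]
    [InnerProductSpace ℝ F] {f g : α → F} (hf : MemLp f 2 μ) (hg : MemLp g 2 μ) :
    inner ℝ (hf.toLp f) (hg.toLp g) = ∫ x, inner ℝ (f x) (g x) ∂μ := by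
  rw [L2.inner_def]
  refine integral_congr_ae ?_
  filter_upwards [hf.coeFn_toLp, hg.coeFn_toLp] with x h1 h2
  rw [h1, h2]

theorem norm_toLp_sq {α F : Type*} [MeasurableSpace α] {μ : Measure α} [NormedAddCommGroup F]
    [InnerProductSpace ℝ F] {f : α → F} (hf : MemLp f 2 μ) :
    ‖hf.toLp f‖ ^ 2 = ∫ x, ‖f x‖ ^ 2 ∂μ := by
  rw [← real_inner_self_eq_norm_sq, inner_toLp_toLp]
  simp only [real_inner_self_eq_norm_sq]

variable {Ω : Set (E d)} {V : Set (E d → ℝ)} {el : E d → Set (E d)}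

theorem ofReal_norm_toLp_sq {α F : Type*} [MeasurableSpace α] {μ : Measure α}
    [NormedAddCommGroup F] [InnerProductSpace ℝ F] {f : α → F} (hf : MemLp f 2 μ) :
    ENNReal.ofReal (‖hf.toLp f‖ ^ 2) = ∫⁻ x, ENNReal.ofReal (‖f x‖ ^ 2) ∂μ := by
  rw [norm_toLp_sq, ofReal_integral_eq_lintegral_ofReal hf.norm.integrable_sq
    (.of_forall fun x ↦ by positivity)]

/-- Absorbing the roots of the weights into the functions turns the weighted norm into the plain L²
norm of a triple, to which the abstract estimate applies. -/
theorem energyNorm_eq_ofReal (hpos : ∀ᵐ x ∂surf Ω, 0 < stabParam Ω V (el x)) {G : E d → E d}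
    {q b : E d → ℝ} (hG : MemLp G 2 (volume.restrict Ω))
    (hq : MemLp (fun x ↦ √(stabParam Ω V (el x))⁻¹ * q x) 2 (surf Ω))
    (hb : MemLp (fun x ↦ √(stabParam Ω V (el x)) * b x) 2 (surf Ω)) :
    energyNorm Ω V el G q b =
      ENNReal.ofReal (tripleNorm (hG.toLp G) (hq.toLp _) (hb.toLp _)) := by
  have e1 : ∫⁻ x, ENNReal.ofReal ((stabParam Ω V (el x))⁻¹ * q x ^ 2) ∂surf Ω =
      ENNReal.ofReal (‖hq.toLp _‖ ^ 2) := by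
    rw [ofReal_norm_toLp_sq]
    refine lintegral_congr_ae ?_
    filter_upwards [hpos] with x hx
    rw [Real.norm_eq_abs, sq_abs, mul_pow, Real.sq_sqrt (inv_nonneg.2 hx.le)]
  have e2 : ∫⁻ x, ENNReal.ofReal (stabParam Ω V (el x) * b x ^ 2) ∂surf Ω =
      ENNReal.ofReal (‖hb.toLp _‖ ^ 2) := by
    rw [ofReal_norm_toLp_sq]
    refine lintegral_congr_ae ?_
    filter_upwards [hpos] with x hx
    rw [Real.norm_eq_abs, sq_abs, mul_pow, Real.sq_sqrt hx.le]
  rw [energyNorm, e1, e2, ← ofReal_norm_toLp_sq hG, ← ENNReal.ofReal_add (by positivity)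
    (by positivity), ← ENNReal.ofReal_add (by positivity) (by positivity),
    ENNReal.ofReal_rpow_of_nonneg (by positivity) (by positivity), tripleNorm,
    Real.sqrt_eq_rpow]

/-- The opposite weights cancel, so the flux terms of a_h are unweighted inner products of scaled
components. -/
theorem inner_scaled (hpos : ∀ᵐ x ∂surf Ω, 0 < stabParam Ω V (el x)) {q b : E d → ℝ}
    (hq : MemLp (fun x ↦ √(stabParam Ω V (el x))⁻¹ * q x) 2 (surf Ω))
    (hb : MemLp (fun x ↦ √(stabParam Ω V (el x)) * b x) 2 (surf Ω)) :
    inner ℝ (hq.toLp _) (hb.toLp _) = ∫ x, q x * b x ∂surf Ω := by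
  rw [inner_toLp_toLp]
  refine integral_congr_ae ?_
  filter_upwards [hpos] with x hx
  have h : √(stabParam Ω V (el x)) * √(stabParam Ω V (el x))⁻¹ = 1 := by
    rw [← Real.sqrt_mul hx.le, mul_inv_cancel₀ hx.ne', Real.sqrt_one]
  simp only [RCLike.inner_apply, conj_trivial]
  linear_combination (q x * b x) * h

theorem inner_scaled_boundary (hpos : ∀ᵐ x ∂surf Ω, 0 < stabParam Ω V (el x)) {b c : E d → ℝ}
    (hb : MemLp (fun x ↦ √(stabParam Ω V (el x)) * b x) 2 (surf Ω))
    (hc : MemLp (fun x ↦ √(stabParam Ω V (el x)) * c x) 2 (surf Ω)) :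
    inner ℝ (hb.toLp _) (hc.toLp _) = ∫ x, stabParam Ω V (el x) * b x * c x ∂surf Ω := by
  rw [inner_toLp_toLp]
  refine integral_congr_ae ?_
  filter_upwards [hpos] with x hx
  have h : √(stabParam Ω V (el x)) * √(stabParam Ω V (el x)) = stabParam Ω V (el x) :=
    Real.mul_self_sqrt hx.le
  simp only [RCLike.inner_apply, conj_trivial]
  linear_combination (b x * c x) * h

end EnergyNorm

/-! ### Consistency of the discrete problem. -/

section Consistency

variable {bg : Finset (Set (E d))} {Ω : Set (E d)} {P : Submodule ℝ (MvPolynomial (Fin d) ℝ)}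
  {el : E d → Set (E d)} {k : ℕ}

/-- Green's identity for `u ∈ H²(Ω)` and a finite element test function. -/
theorem MemH2.green_feSpace (hΩ : IsLipschitzDomain Ω) (hbg : IsBackgroundMesh bg Ω)
    {u v : E d → ℝ} (hu : MemH2 Ω u) (hv : v ∈ feSpace bg Ω P) :
    (∫ x in Ω, inner ℝ (weakGrad Ω u x) (gradient v x)) + ∫ x in Ω, laplacian Ω u x * v x =
      ∫ x, normalDeriv Ω u x * v x ∂surf Ω := by
  obtain ⟨C, g, hg, hvg⟩ := exists_lipschitz_extension hΩ hbg hv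
  have h := hu.green hΩ hg
  have h1 : ∫ x in Ω, inner ℝ (weakGrad Ω u x) (gradient v x) =
      ∫ x in Ω, inner ℝ (weakGrad Ω u x) (gradient g x) := by
    refine setIntegral_congr_fun hΩ.1.measurableSet fun x hx ↦ ?_
    rw [gradient_eq_of_mem_interior (hvg.mono subset_closure) (by rwa [hΩ.1.interior_eq])]
  have h2 : ∫ x in Ω, laplacian Ω u x * v x = ∫ x in Ω, laplacian Ω u x * g x :=
    setIntegral_congr_fun hΩ.1.measurableSet fun x hx ↦ by simp only [hvg (subset_closure hx)]
  rw [h1, h2, h]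
  refine integral_congr_ae ?_
  filter_upwards [ae_surf_mem_frontier Ω] with x hx
  rw [hvg hx.1]

/-- The discrete problem is consistent: the exact solution satisfies the discrete equations. -/
theorem SolvesPoisson.consistent (hΩ : IsLipschitzDomain Ω) (hbg : IsBackgroundMesh bg Ω)
    (hel : IsElementAssignment bg Ω el) {f g u v : E d → ℝ} (hu : SolvesPoisson Ω f g u)
    (hv : v ∈ feSpace bg Ω P) :
    (∫ x in Ω, inner ℝ (weakGrad Ω u x) (gradient v x))
      - (∫ x, normalDeriv Ω u x * v x ∂surf Ω)
      - (∫ x, elemNormalDeriv Ω (el x) v x * trace Ω u x ∂surf Ω)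
      + (∫ x, stabParam Ω (feSpace bg Ω P) (el x) * trace Ω u x * v x ∂surf Ω) =
      lForm Ω (feSpace bg Ω P) el f g v := by
  have h1 := hu.1.green_feSpace hΩ hbg hv
  have h2 : ∫ x in Ω, f x * v x = -∫ x in Ω, laplacian Ω u x * v x := by
    rw [← integral_neg]
    refine integral_congr_ae ?_
    filter_upwards [hu.2.1] with x hx
    rw [← hx, neg_mul]
  have mt := memLp_trace Ω u
  have mn := memLp_elemNormalDeriv hΩ hbg hel hv
  have mv := memLp_surf_feSpace hΩ hbg hv
  have i1 : Integrable (fun x ↦ elemNormalDeriv Ω (el x) v x * trace Ω u x) (surf Ω) :=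
    mn.integrable_mul mt
  have i2 : Integrable (fun x ↦ stabParam Ω (feSpace bg Ω P) (el x) * trace Ω u x * v x)
      (surf Ω) := (hel.memLp_mul _ mt).integrable_mul mv
  have h3 : ∫ x, (-elemNormalDeriv Ω (el x) v x +
      stabParam Ω (feSpace bg Ω P) (el x) * v x) * g x ∂surf Ω =
      -(∫ x, elemNormalDeriv Ω (el x) v x * trace Ω u x ∂surf Ω)
      + (∫ x, stabParam Ω (feSpace bg Ω P) (el x) * trace Ω u x * v x ∂surf Ω) := by
    rw [← integral_neg, ← integral_add i1.fun_neg i2]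
    refine integral_congr_ae ?_
    filter_upwards [hu.2.2] with x hx
    rw [← hx]
    ring
  rw [lForm, h2, h3]
  linarith

end Consistency

/-! ### Assembly of the quasi-optimality estimate. -/

section Main

variable {bg : Finset (Set (E d))} {Ω : Set (E d)} {P : Submodule ℝ (MvPolynomial (Fin d) ℝ)}
  {el : E d → Set (E d)} {k : ℕ}

/-- The error norm is finite, and the discrete solution is a quasi-best approximation. -/
theorem errorNorm_le (hd : 1 ≤ d) (hΩ : IsLipschitzDomain Ω) (hbg : IsBackgroundMesh bg Ω)
    (hP : IsLocalPolySpace bg k P) (hk : 1 ≤ k) (hel : IsElementAssignment bg Ω el)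
    {f g u uh vh : E d → ℝ} (hu : SolvesPoisson Ω f g u)
    (huh : SolvesNitsche Ω (feSpace bg Ω P) el f g uh) (hvh : vh ∈ feSpace bg Ω P) :
    errorNorm Ω (feSpace bg Ω P) el u vh ≠ ⊤ ∧
      errorNorm Ω (feSpace bg Ω P) el u uh ≤ 11 * errorNorm Ω (feSpace bg Ω P) el u vh := by
  have hpos := ae_stabParam_pos hd hΩ hbg hP hk hel
  set V := feSpace bg Ω P with hV
  have mq : ∀ {q : E d → ℝ}, MemLp q 2 (surf Ω) →
      MemLp (fun x ↦ √(stabParam Ω V (el x))⁻¹ * q x) 2 (surf Ω) :=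
    fun h ↦ hel.memLp_mul (fun T ↦ √(stabParam Ω V T)⁻¹) h
  have mb : ∀ {b : E d → ℝ}, MemLp b 2 (surf Ω) →
      MemLp (fun x ↦ √(stabParam Ω V (el x)) * b x) 2 (surf Ω) :=
    fun h ↦ hel.memLp_mul (fun T ↦ √(stabParam Ω V T)) h
  have uG : MemLp (weakGrad Ω u) 2 (volume.restrict Ω) := hu.1.1.2.2
  have uq := memLp_normalDeriv hΩ u
  have ub := memLp_trace Ω u
  have vG : ∀ {v}, v ∈ V → MemLp (gradient v) 2 (volume.restrict Ω) :=
    fun h ↦ memLp_gradient_feSpace hΩ hbg h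
  have vq : ∀ {v}, v ∈ V → MemLp (fun x ↦ elemNormalDeriv Ω (el x) v x) 2 (surf Ω) :=
    fun h ↦ memLp_elemNormalDeriv hΩ hbg hel h
  have vb : ∀ {v}, v ∈ V → MemLp v 2 (surf Ω) := fun h ↦ memLp_surf_feSpace hΩ hbg h
  -- Finiteness of the error norm is part of this identity, since the right-hand side is a real
  -- number.
  have hnorm : ∀ {v} (hv : v ∈ V), errorNorm Ω V el u v = ENNReal.ofReal (tripleNorm
      (uG.toLp _ - (vG hv).toLp _) ((mq uq).toLp _ - (mq (vq hv)).toLp _)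
      ((mb ub).toLp _ - (mb (vb hv)).toLp _)) := by
    intro v hv
    refine (energyNorm_eq_ofReal hpos (uG.sub (vG hv)) (mq (uq.sub (vq hv)))
      (mb (ub.sub (vb hv)))).trans ?_
    rw [← MemLp.toLp_sub, ← MemLp.toLp_sub, ← MemLp.toLp_sub]
    congr 2
    · exact MemLp.toLp_congr _ _ (.of_forall fun x ↦ mul_sub _ _ _)
    · exact MemLp.toLp_congr _ _ (.of_forall fun x ↦ mul_sub _ _ _)
  have huV : uh ∈ V := huh.1
  refine ⟨by rw [hnorm hvh]; exact ENNReal.ofReal_ne_top, ?_⟩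
  have he : uh - vh ∈ V := feSpace_sub huV hvh
  have eG : (vG he).toLp _ = (vG huV).toLp _ - (vG hvh).toLp _ := by
    rw [← MemLp.toLp_sub]
    exact MemLp.toLp_congr _ _ (ae_gradient_sub hΩ hbg huV hvh)
  have eq : (mq (vq he)).toLp _ = (mq (vq huV)).toLp _ - (mq (vq hvh)).toLp _ := by
    rw [← MemLp.toLp_sub]
    refine MemLp.toLp_congr _ _ ?_
    filter_upwards [ae_surf_mem_frontier Ω] with x hx
    have := hel.1 x hx
    simp only [Pi.sub_apply]
    rw [elemNormalDeriv_sub hbg huV hvh this.1 this.2, mul_sub]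
  have eb : (mb (vb he)).toLp _ = (mb (vb huV)).toLp _ - (mb (vb hvh)).toLp _ := by
    rw [← MemLp.toLp_sub]
    exact MemLp.toLp_congr _ _ (.of_forall fun x ↦ mul_sub _ _ _)
  have hinv : 2 * ‖(mq (vq he)).toLp _‖ ^ 2 ≤ ‖(vG he).toLp _‖ ^ 2 := by
    rw [norm_toLp_sq, norm_toLp_sq]
    refine le_trans (le_of_eq ?_) (integral_inv_stabParam_mul_sq_le hd hΩ hbg hP hk hel he)
    congr 1
    refine integral_congr_ae ?_
    filter_upwards [hpos] with x hx
    rw [Real.norm_eq_abs, sq_abs, mul_pow, Real.sq_sqrt (inv_nonneg.2 hx.le)]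
  have hgal : inner ℝ (uG.toLp _) ((vG he).toLp _) - inner ℝ ((mq uq).toLp _) ((mb (vb he)).toLp _)
      - inner ℝ ((mq (vq he)).toLp _) ((mb ub).toLp _)
      + inner ℝ ((mb ub).toLp _) ((mb (vb he)).toLp _) =
      inner ℝ ((vG huV).toLp _) ((vG he).toLp _)
      - inner ℝ ((mq (vq huV)).toLp _) ((mb (vb he)).toLp _)
      - inner ℝ ((mq (vq he)).toLp _) ((mb (vb huV)).toLp _)
      + inner ℝ ((mb (vb huV)).toLp _) ((mb (vb he)).toLp _) := by
    -- Galerkin orthogonality: u and u_h satisfy the same equation when tested with u_h - v_h.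
    have h1 := hu.consistent hΩ hbg hel he
    rw [← huh.2 _ he, aForm] at h1
    simp only [neg_mul, integral_neg] at h1
    simp only [inner_scaled hpos, inner_scaled_boundary hpos]
    rw [inner_toLp_toLp, inner_toLp_toLp, h1]
    ring
  have hmain := tripleNorm_sub_le_of_orthogonal (uG.toLp _ - (vG hvh).toLp _) ((vG he).toLp _)
    ((mq uq).toLp _ - (mq (vq hvh)).toLp _) ((mq (vq he)).toLp _)
    ((mb ub).toLp _ - (mb (vb hvh)).toLp _) ((mb (vb he)).toLp _) hinv (by
      -- Subtracting the terms of v_h from both sides replaces u by u - v_h and u_h by u_h - v_h in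
      -- the orthogonality relation.
      have k1 := congrArg (fun z ↦ inner ℝ z ((vG he).toLp _)) eG
      have k2 := congrArg (fun z ↦ inner ℝ z ((mb (vb he)).toLp _)) eq
      have k3 := congrArg (fun z ↦ inner ℝ ((mq (vq he)).toLp _) z) eb
      have k4 := congrArg (fun z ↦ inner ℝ z ((mb (vb he)).toLp _)) eb
      simp only [inner_sub_left, inner_sub_right] at k1 k2 k3 k4 ⊢
      linarith)
  rw [eG, eq, eb, sub_sub_sub_cancel_right, sub_sub_sub_cancel_right,
    sub_sub_sub_cancel_right] at hmain
  rw [hnorm huV, hnorm hvh]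
  refine (ENNReal.ofReal_le_ofReal hmain).trans (le_of_eq ?_)
  rw [ENNReal.ofReal_mul (by norm_num)]
  norm_num

end Main

end Nitsche

theorem mainTheorem1 (d : ℕ) (hd : 1 ≤ d)
    (Ω : Set (Nitsche.E d)) (hΩ : Nitsche.IsLipschitzDomain Ω)
    (bg : Finset (Set (Nitsche.E d))) (hbg : Nitsche.IsBackgroundMesh bg Ω)
    (k : ℕ) (hk : 1 ≤ k)
    (P : Submodule ℝ (MvPolynomial (Fin d) ℝ)) (hP : Nitsche.IsLocalPolySpace bg k P)
    (V : Set (Nitsche.E d → ℝ)) (hV : V = Nitsche.feSpace bg Ω P)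
    (el : Nitsche.E d → Set (Nitsche.E d)) (hel : Nitsche.IsElementAssignment bg Ω el)
    (f g u uh : Nitsche.E d → ℝ)
    (hu : Nitsche.SolvesPoisson Ω f g u)
    (huh : Nitsche.SolvesNitsche Ω V el f g uh) :
    (∀ vh ∈ V, Nitsche.errorNorm Ω V el u vh ≠ ⊤) ∧
      Nitsche.errorNorm Ω V el u uh ≤ 11 * ⨅ vh ∈ V, Nitsche.errorNorm Ω V el u vh := by
  subst hV
  have h := fun vh hvh ↦
    Nitsche.errorNorm_le (vh := vh) hd hΩ hbg hP hk hel hu huh hvh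
  refine ⟨fun vh hvh ↦ (h vh hvh).1, ?_⟩
  -- The factor 11 is neither 0 nor ∞, so it passes through both infima and the bound for each
  -- single v_h suffices.
  rw [ENNReal.mul_iInf_of_ne (by norm_num) (by norm_num)]
  refine le_iInf fun vh ↦ ?_
  rw [ENNReal.mul_iInf_of_ne (by norm_num) (by norm_num)]
  exact le_iInf fun hvh ↦ (h vh hvh).2
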